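/- Let $|\psi\rangle$ be an $N$-qubit stabilizer state: a unit vector of $(\mathbb{C}^2)^{\otimes N}$ fixed by $N$ pairwise commuting, independent elements $g_1,\dots,g_N$ of the $N$-qubit Pauli group $\{i^k P_1\otimes\cdots\otimes P_N : P_j\in\{I,X,Y,Z\},\ 0\le k\le 3\}$ (independent: no $g_i$ lies in the group generated by the others), and let $G=\langle g_1,\dots,g_N\rangle$ be its stabilizer group. Partition the qubits into three parties $A,B,C$. For a union $S$ of parties let $G_S$ be the subgroup of those elements of $G$ that act as the identity on every qubit outside $S$, and let $G_{AB}\cdot G_{BC}\cdot G_{AC}=\{fgh: f\in G_{AB},\,g\in G_{BC},\,h\in G_{AC}\}$. Reflected entropy: let $\rho_{AB}=\mathrm{Tr}_C|\psi\rangle\langle\psi|$, let $|\sqrt{\rho_{AB}}\rangle\in\mathcal H_A\otimes\mathcal H_B\otimes\mathcal H_A^\star\otimes\mathcal H_B^\star$ be $\sqrt{\rho_{AB}}$ regarded as a vector, $\rho_{AA^\star}=\mathrm{Tr}_{BB^\star}|\sqrt{\rho_{AB}}\rangle\langle\sqrt{\rho_{AB}}|$, and $S^{(R)}(A:B)=-\mathrm{Tr}(\rho_{AA^\star}\log_2\rho_{AA^\star})$.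 Multi-entropy: for $n\ge 1$ let $\mathcal Z_n$ be the number obtained by placing a copy of the tensor $\psi_{\alpha_A\alpha_B\alpha_C}$ and a copy of $\bar\psi_{\alpha_A\alpha_B\alpha_C}$ at each site of the periodic lattice $(\mathbb Z/n)^3$ and contracting, for every site $r$ and every party $a$, the leg $a$ of $\psi$ at $r$ with the leg $a$ of $\bar\psi$ at $r+e_a$. The multi-entropy is $$S^{(3)}(A:B:C)=\lim_{n\to1}\frac{1}{(1-n)\,n}\log_2\mathcal Z_n ,$$ where the sequence $\frac{1}{(1-n)n}\log_2\mathcal Z_n$, $n=2,3,\dots$, is first continued analytically in $n$ in the sense of Carlson's theorem: to a function that is holomorphic on a connected open set containing $[1,\infty)$ and a half plane $\{\mathrm{Re}\, z>R\}$, and is bounded on that half plane by $K e^{\tau|\mathrm{Re}\, z|+c|\mathrm{Im}\, z|}$ for some constants $K,\tau$ and some $c<\pi$. Then $$S^{(R)}(A:B)=\log_2\frac{|G_{AB}|}{|G_A|\,|G_B|},$$ and $S^{(3)}(A:B:C)$ exists (such a continuation exists, and its limit at $1$ does not depend on the choice of the continuation) and equals $$S^{(3)}(A:B:C)=\frac12\log_2\frac{|G|}{|G_A|\,|G_B|\,|G_C|}+\frac12\log_2\frac{|G|}{|G_{AB}\cdot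 G_{BC}\cdot G_{AC}|}.$$ -/

import Mathlib

open scoped Pointwise ComplexConjugate

noncomputable section

namespace StabEntropy

/-! ### Pauli operators and stabilizer states -/

/-- The single-qubit Pauli labels. -/
inductive Pauli where
  | I | X | Y | Z

/-- The `2 × 2` Pauli matrices. -/
def Pauli.mat : Pauli → Matrix (Fin 2) (Fin 2) ℂ
  | .I => 1
  | .X => !![0, 1; 1, 0]
  | .Y => !![0, -Complex.I; Complex.I, 0]
  | .Z => !![1, 0; 0, -1]

/-- The operator `i ^ k • (P 0 ⊗ ⋯ ⊗ P (N - 1))` on `N` qubits, as a matrix in the computational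
basis, which is indexed by bit strings `Fin N → Fin 2`. -/
def pauliString {N : ℕ} (k : Fin 4) (P : Fin N → Pauli) :
    Matrix (Fin N → Fin 2) (Fin N → Fin 2) ℂ :=
  Matrix.of fun x y => Complex.I ^ (k : ℕ) * ∏ i, (P i).mat (x i) (y i)

/-- The unitary operators on `N` qubits. -/
abbrev QubitUnitary (N : ℕ) := Matrix.unitaryGroup (Fin N → Fin 2) ℂ

/-- Membership in the `N`-qubit Pauli group. -/
def IsPauli {N : ℕ} (U : QubitUnitary N) : Prop :=
  ∃ (k : Fin 4) (P : Fin N → Pauli), U.1 = pauliString k P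

/-- `ψ` is an `N`-qubit stabilizer state with stabilizer group `G`: a unit vector fixed by `N`
commuting independent elements of the Pauli group, which generate `G`. (Such a vector is
automatically unique up to a phase.) -/
def IsStabilizerState {N : ℕ} (ψ : (Fin N → Fin 2) → ℂ) (G : Subgroup (QubitUnitary N)) : Prop :=
  ∑ x, ‖ψ x‖ ^ 2 = 1 ∧
  ∃ g : Fin N → QubitUnitary N,
    (∀ i, IsPauli (g i)) ∧
    (∀ i j, g i * g j = g j * g i) ∧
    (∀ i, g i ∉ Subgroup.closure (g '' {j | j ≠ i})) ∧
    (∀ i, (g i).1.mulVec ψ = ψ) ∧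
    G = Subgroup.closure (Set.range g)

/-- The subgroup `G_S` (as a set) of the elements of `G` that act as the identity on all qubits
outside `S`. -/
def supportedOn {N : ℕ} (G : Subgroup (QubitUnitary N)) (S : Set (Fin N)) :
    Set (QubitUnitary N) :=
  {U | U ∈ G ∧ ∃ (k : Fin 4) (P : Fin N → Pauli),
    U.1 = pauliString k P ∧ ∀ i, i ∉ S → P i = Pauli.I}

/-! ### Tripartite tensors

A pure state of three parties `0, 1, 2` (that is, `A, B, C`) is given by its coefficients
`ψ : (∀ a : Fin 3, H a) → ℂ`, where `H a` indexes an orthonormal basis of party `a`. -/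

/-- Bit strings on the qubits belonging to party `a`. -/
abbrev Block {N : ℕ} (party : Fin N → Fin 3) (a : Fin 3) := {i : Fin N // party i = a} → Fin 2

/-- The coefficients of an `N`-qubit state when its qubits are grouped into three parties. -/
def grouped {N : ℕ} (party : Fin N → Fin 3) (ψ : (Fin N → Fin 2) → ℂ) :
    (∀ a : Fin 3, Block party a) → ℂ :=
  fun x => ψ fun i => x (party i) ⟨i, rfl⟩

section Measures

variable {H : Fin 3 → Type} [∀ a, Fintype (H a)] [∀ a, DecidableEq (H a)]

/-- The joint basis label with labels `a`, `b`, `c` for the three parties. -/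
def triple (a : H 0) (b : H 1) (c : H 2) : ∀ p : Fin 3, H p :=
  Fin.cons a (Fin.cons b (Fin.cons c finZeroElim))

/-- The reduced density matrix `ρ_AB`. -/
def rhoAB (ψ : (∀ a, H a) → ℂ) : Matrix (H 0 × H 1) (H 0 × H 1) ℂ :=
  Matrix.of fun x y => ∑ c, ψ (triple x.1 x.2 c) * conj (ψ (triple y.1 y.2 c))

/-- The von Neumann entropy `-Tr (ρ log₂ ρ)`. -/
def vonNeumann {m : Type} [Fintype m] [DecidableEq m] (ρ : Matrix m m ℂ) : ℝ :=
  -(Matrix.trace (ρ * cfc (Real.logb 2) ρ)).re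

/-- The reduction `ρ_{AA*} = Tr_{BB*} |√ρ_AB⟩⟨√ρ_AB|` of the canonical purification, whose
coefficient at `|a⟩|b⟩|a'⟩|b'⟩` is the matrix entry `√ρ_AB (a, b) (a', b')`. -/
def rhoAAstar (ψ : (∀ a, H a) → ℂ) : Matrix (H 0 × H 0) (H 0 × H 0) ℂ :=
  Matrix.of fun x y => ∑ b : H 1, ∑ b' : H 1,
    cfc Real.sqrt (rhoAB ψ) (x.1, b) (x.2, b') *
      conj (cfc Real.sqrt (rhoAB ψ) (y.1, b) (y.2, b'))

/-- The reflected entropy `S^(R)(A : B)`, in bits. -/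
def reflectedEntropy (ψ : (∀ a, H a) → ℂ) : ℝ := vonNeumann (rhoAAstar ψ)

/-- The replica contraction `𝒵_n`: each site `r` of the periodic lattice `(ℤ/n)³` carries a copy of
`ψ` and of its conjugate, and the leg `a` of `ψ` at `r` is contracted with the leg `a` of the
conjugate at `r + e_a`. Here `k r a` is the label on the leg `a` of the copy of `ψ` at `r`. -/
def replicaZ (ψ : (∀ a, H a) → ℂ) (n : ℕ) [NeZero n] : ℂ :=
  ∑ k : (Fin 3 → ZMod n) → ∀ a, H a,
    ∏ r : Fin 3 → ZMod n, ψ (k r) * conj (ψ fun a => k (r - Pi.single a 1) a)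

/-- `(1 / ((1 - n) n)) log₂ 𝒵_n`. -/
def renyiMulti (ψ : (∀ a, H a) → ℂ) (n : ℕ) [NeZero n] : ℂ :=
  1 / ((1 - (n : ℂ)) * n) * (Complex.log (replicaZ ψ n) / Complex.log 2)

end Measures

/-- `f` is an analytic continuation, of the kind singled out by Carlson's theorem, of the sequence
`s 2, s 3, …`: it is holomorphic on a connected open set containing `[1, ∞)` and some right half
plane, on which it has exponential type, less than `π` in the imaginary direction. -/
def IsCarlsonContinuation (s : ∀ n : ℕ, [NeZero n] → ℂ) (f : ℂ → ℂ) : Prop :=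
  (∃ (U : Set ℂ) (R : ℝ), IsOpen U ∧ IsPreconnected U ∧
    (∀ x : ℝ, 1 ≤ x → (x : ℂ) ∈ U) ∧ (∀ z : ℂ, R < z.re → z ∈ U) ∧
    DifferentiableOn ℂ f U ∧
    ∃ K τ c : ℝ, c < Real.pi ∧
      ∀ z : ℂ, R < z.re → ‖f z‖ ≤ K * Real.exp (τ * |z.re| + c * |z.im|)) ∧
  ∀ (n : ℕ) [NeZero n], 2 ≤ n → f n = s n

/-- `L` is the tripartite multi-entropy `S^(3)(A : B : C)`, in bits: the limit as `n → 1` of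
`(1 / ((1 - n) n)) log₂ 𝒵_n`, continued analytically from the integers `n ≥ 2`. -/
def IsMultiEntropy {H : Fin 3 → Type} [∀ a, Fintype (H a)] [∀ a, DecidableEq (H a)]
    (ψ : (∀ a, H a) → ℂ) (L : ℝ) : Prop :=
  ∃ f : ℂ → ℂ, IsCarlsonContinuation (fun n _ => renyiMulti ψ n) f ∧
    Filter.Tendsto f (nhdsWithin 1 {1}ᶜ) (nhds (L : ℂ))

end StabEntropy

end

open scoped Pointwise ComplexConjugate

noncomputable section
namespace StabEntropy

set_option linter.unusedSectionVars false

/-! ### Carlson's theorem -/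

/-! The stabilizer group becomes linear algebra over `ZMod 2`. A group element is determined by its
binary label, because two elements with the same label differ by a sign and `-1` cannot fix a
nonzero vector. The labels form an `N`-dimensional isotropic, hence self-orthogonal, subspace of the
space of all labels. The projection onto `ψ` is the normalized sum of the group
(`IsStabilizerState.mul_conj_eq`), and tracing out `C` keeps only the elements trivial there, so
ρ_AB is a multiple of the sum over a bipartite group `S`, which is a multiple of a projection.

Reflected entropy: √ρ_AB is therefore proportional to ρ_AB. Its realignment `R`, with rows indexed
by the two copies of `A` and columns by the two copies of `B`, satisfies R R† R = const · R by
orthogonality of Pauli strings (`realigned_cube`). So ρ_{AA*} has a single nonzero eigenvalue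
|S_A||S_B|/|S|, and the entropy is minus its logarithm.

Multi-entropy: pairing `ψ` at `r` with its conjugate at `r + e₂` contracts the `C` legs, and the
cubic lattice decouples into `n` equal layers, each a torus of `n²` copies of ρ_AB with `A`
contracted along one direction and `B` along the other (`replicaZ_eq_pow`). Each layer expands into
a sum over labelings of the torus by `S`. Inserting Pauli strings on the bonds is a gauge symmetry.
Constant gauges force zero sums along the cycles; other gauges remove the parts of a labeling that
lie in S_A or S_B. Write S = L ⊕ L' ⊕ S_A ⊕ S_B, with `L` isotropic for the commutation form of
party `A` and `L'` paired faithfully with `L` (`exists_splitting`). Translating the `L`-part by a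
second difference multiplies a term by a sign that depends on the `L'`-part alone, so the sum over
`L` cancels unless the `L'`-part is constant along antidiagonals; then every term equals the trivial
one. Counting the survivors (`Splitting.sum_amp_torus`) makes 𝒵_n an explicit power of 2 whose
normalized logarithm is affine in `n`.

An affine sequence is its own continuation, and Carlson's theorem together with the identity theorem
makes the value at 1 independent of the continuation. That value is |A| + |B| − dim S_A − dim S_B −
dim L', where |A|, |B| count qubits and 2 dim L' = dim S − dim(radical of the `A`-form on S). The
radical is the intersection of the labels of G_AB with the sum of those of G_BC and G_AC
(`finrank_radical`), which is how the product of the three subgroups enters. -/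

/-- A holomorphic function vanishing at the (simple) zeros of another one is divisible by it. -/
lemma exists_differentiableOn_eq_mul {U : Set ℂ} (hU : IsOpen U) {f g : ℂ → ℂ}
    (hf : DifferentiableOn ℂ f U) (hg : DifferentiableOn ℂ g U)
    (h0 : ∀ z ∈ U, g z = 0 → f z = 0 ∧ deriv g z ≠ 0) :
    ∃ h : ℂ → ℂ, DifferentiableOn ℂ h U ∧ ∀ z ∈ U, f z = h z * g z := by
  classical
  -- At a simple zero the quotient takes its l'Hôpital value; nearby it equals the quotient of the
  -- two `dslope`s, whose denominator does not vanish.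
  refine ⟨fun z => if g z = 0 then deriv f z / deriv g z else f z / g z, ?_, ?_⟩
  · intro z hz
    have hUz : U ∈ nhds z := hU.mem_nhds hz
    apply DifferentiableAt.differentiableWithinAt
    by_cases hgz : g z = 0
    · obtain ⟨hfz, hd⟩ := h0 z hz hgz
      have d1 : DifferentiableAt ℂ (dslope f z) z :=
        ((Complex.differentiableOn_dslope hUz).2 hf).differentiableAt hUz
      have d2 : DifferentiableAt ℂ (dslope g z) z :=
        ((Complex.differentiableOn_dslope hUz).2 hg).differentiableAt hUz
      have hne : dslope g z z ≠ 0 := by rwa [dslope_same]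
      refine (d1.div d2 hne).congr_of_eventuallyEq ?_
      filter_upwards [d2.continuousAt.eventually_ne hne] with w hw
      by_cases hwz : w = z
      · subst hwz
        simp [hgz]
      · have hwz' : w - z ≠ 0 := sub_ne_zero.2 hwz
        have eg : g w = (w - z) * dslope g z w := by
          have := sub_smul_dslope g z w
          simpa [hgz] using this.symm
        have ef : f w = (w - z) * dslope f z w := by
          have := sub_smul_dslope f z w
          simpa [hfz] using this.symm
        have : g w ≠ 0 := by rw [eg]; exact mul_ne_zero hwz' hw
        rw [if_neg this, Pi.div_apply, ef, eg, mul_div_mul_left _ _ hwz']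
    · have hgd := hg.differentiableAt hUz
      have hfd := hf.differentiableAt hUz
      refine (hfd.div hgd hgz).congr_of_eventuallyEq ?_
      filter_upwards [hgd.continuousAt.eventually_ne hgz] with w hw
      simp [hw]
  · intro z hz
    by_cases hgz : g z = 0
    · simp [hgz, (h0 z hz hgz).1]
    · simp [hgz]

lemma normSq_cos (x y : ℝ) :
    ‖Complex.cos (x + y * Complex.I)‖ ^ 2 = Real.cos x ^ 2 + Real.sinh y ^ 2 := by
  have e : Complex.cos (x + y * Complex.I) = ((Real.cos x * Real.cosh y : ℝ) : ℂ) +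
      ((-(Real.sin x * Real.sinh y) : ℝ) : ℂ) * Complex.I := by
    rw [Complex.cos_add, Complex.cos_mul_I, Complex.sin_mul_I]
    push_cast; ring
  rw [e, ← Complex.normSq_eq_norm_sq, Complex.normSq_add_mul_I]
  have h1 := Real.cosh_sq y
  have h2 := Real.sin_sq_add_cos_sq x
  linear_combination (Real.cos x)^2 * h1 + (Real.sinh y)^2 * h2

/-- Lower bound for `cos (π z)` away from its zeros. -/
lemma exp_le_norm_cos {z : ℂ} (h : (∃ k : ℤ, z.re = k) ∨ 1 ≤ |z.im|) :
    Real.exp (Real.pi * |z.im|) ≤ 4 * ‖Complex.cos (Real.pi * z)‖ := by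
  have hz : (Real.pi : ℂ) * z = ((Real.pi * z.re : ℝ) : ℂ) + ((Real.pi * z.im : ℝ) : ℂ) * Complex.I := by
    conv_lhs => rw [← Complex.re_add_im z]
    push_cast; ring
  have key := normSq_cos (Real.pi * z.re) (Real.pi * z.im)
  rw [← hz] at key
  set E := Real.exp (Real.pi * |z.im|) with hE
  have hEpos : 0 < E := Real.exp_pos _
  have hE1 : 1 ≤ E := Real.one_le_exp (by positivity)
  have hEi : Real.exp (-(Real.pi * |z.im|)) = E⁻¹ := Real.exp_neg _
  have hsinh : Real.sinh (Real.pi * z.im) ^ 2 = ((E - E⁻¹) / 2) ^ 2 := by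
    rw [← sq_abs, Real.abs_sinh, abs_mul, abs_of_pos Real.pi_pos, Real.sinh_eq, hEi]
  have hmul : E * E⁻¹ = 1 := mul_inv_cancel₀ hEpos.ne'
  have hi : 0 < E⁻¹ := by positivity
  -- With E = exp(π|y|), 16‖cos‖² = 16 cos²(πx) + 4(E − 1/E)². On integer vertical lines cos² = 1
  -- compensates the cross term −8; when |y| ≥ 1, E ≥ 4 makes the hyperbolic part sufficient alone.
  have goal : E ^ 2 ≤ (4 * ‖Complex.cos (Real.pi * z)‖) ^ 2 := by
    rw [mul_pow, key, hsinh]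
    rcases h with ⟨k, hk⟩ | h
    · have : Real.cos (Real.pi * z.re) ^ 2 = 1 := by
        have hs : Real.sin (Real.pi * z.re) = 0 := by
          rw [hk, mul_comm]; exact Real.sin_int_mul_pi k
        have := Real.sin_sq_add_cos_sq (Real.pi * z.re)
        rw [hs] at this; linarith
      rw [this]
      nlinarith [sq_nonneg (E⁻¹), sq_nonneg E]
    · have h4 : 4 ≤ E := by
        have : Real.pi ≤ Real.pi * |z.im| := by nlinarith [Real.pi_pos]
        have h3 := Real.pi_gt_three
        have := Real.add_one_le_exp (Real.pi * |z.im|)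
        linarith
      have hi1 : E⁻¹ ≤ 1 := inv_le_one_of_one_le₀ hE1
      nlinarith [sq_nonneg (E⁻¹), sq_nonneg E, sq_nonneg (Real.cos (Real.pi * z.re))]
  exact le_of_sq_le_sq goal (by positivity)

/-- A function of exponential type that decays in the imaginary direction vanishes. -/
lemma eq_zero_of_exp_decay {h : ℂ → ℂ} {K τ δ : ℝ} (hτ : 0 ≤ τ) (hδ : 0 < δ)
    (hd : DifferentiableOn ℂ h {z | -1 < z.re})
    (hb : ∀ z : ℂ, 0 ≤ z.re → ‖h z‖ ≤ K * Real.exp (τ * z.re - δ * |z.im|)) :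
    ∀ z : ℂ, 0 ≤ z.re → h z = 0 := by
  have hK : 0 ≤ K := by
    have := (norm_nonneg _).trans (hb 0 (by simp))
    simpa using this
  -- Multiplication by exp(−κ (z+1) log(z+1)) gives superexponential decay along the positive reals.
  -- Its cost in the imaginary direction is at most exp(κ |y| π/2), and κ is chosen so that this is
  -- exactly the available decay exp(−δ|y|) inverted. Phragmén–Lindelöf then applies.
  set κ : ℝ := 2 * δ / Real.pi with hκ
  have hκ0 : 0 < κ := by positivity
  set E : ℂ → ℂ := fun z => h z * Complex.exp (-κ * ((z + 1) * Complex.log (z + 1))) with hE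
  have hslit : ∀ z : ℂ, -1 < z.re → z + 1 ∈ Complex.slitPlane := fun z hz => by
    left; simp; linarith
  have hEd : DifferentiableOn ℂ E {z | -1 < z.re} := by
    apply hd.mul
    intro z hz
    have : DifferentiableAt ℂ (fun z : ℂ => Complex.log (z + 1)) z :=
      (differentiableAt_id.add_const 1).clog (hslit z hz)
    exact (((differentiableAt_id.add_const (1 : ℂ)).mul this).const_mul
      (-(κ : ℂ))).cexp.differentiableWithinAt
  have hbound : ∀ z : ℂ, 0 ≤ z.re →
      ‖E z‖ ≤ K * Real.exp (τ * z.re - κ * ((z.re + 1) * Real.log (z.re + 1))) := by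
    intro z hz
    have hnorm : z.re + 1 ≤ ‖z + 1‖ := by
      have := Complex.re_le_norm (z + 1)
      simpa using this
    have hlog : Real.log (z.re + 1) ≤ Real.log ‖z + 1‖ :=
      Real.log_le_log (by linarith) hnorm
    have harg : |Complex.arg (z + 1)| ≤ Real.pi / 2 := by
      rw [Complex.abs_arg_le_pi_div_two_iff]; simp; linarith
    have h1 : z.im * Complex.arg (z + 1) ≤ |z.im| * (Real.pi / 2) := by
      calc _ ≤ |z.im * Complex.arg (z + 1)| := le_abs_self _
        _ = |z.im| * |Complex.arg (z + 1)| := abs_mul _ _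
        _ ≤ _ := by gcongr
    have hre : (-(κ : ℂ) * ((z + 1) * Complex.log (z + 1))).re =
        -κ * ((z.re + 1) * Real.log ‖z + 1‖ - z.im * Complex.arg (z + 1)) := by
      simp [Complex.mul_re, Complex.log_re, Complex.log_im]
    rw [hE]
    simp only [norm_mul, Complex.norm_exp, hre]
    calc _ ≤ (K * Real.exp (τ * z.re - δ * |z.im|)) * Real.exp
          (-κ * ((z.re + 1) * Real.log ‖z + 1‖ - z.im * Complex.arg (z + 1))) := by
          gcongr; exact hb z hz
      _ = K * Real.exp ((τ * z.re - δ * |z.im|) +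
          (-κ * ((z.re + 1) * Real.log ‖z + 1‖ - z.im * Complex.arg (z + 1)))) := by
          rw [Real.exp_add]; ring
      _ ≤ _ := by
          gcongr
          have e1 : κ * (|z.im| * (Real.pi / 2)) = δ * |z.im| := by
            rw [hκ]; field_simp
          have e2 : κ * (z.im * Complex.arg (z + 1)) ≤ κ * (|z.im| * (Real.pi / 2)) := by gcongr
          have e3 : κ * ((z.re + 1) * Real.log (z.re + 1)) ≤
              κ * ((z.re + 1) * Real.log ‖z + 1‖) := by gcongr
          linarith
  have hzero : Set.EqOn E 0 {z : ℂ | 0 ≤ z.re} := by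
    apply PhragmenLindelof.eq_zero_on_right_half_plane_of_superexponential_decay
    · apply DifferentiableOn.diffContOnCl
      rw [Complex.closure_setOfPred_lt_re]
      exact hEd.mono fun z (hz : 0 ≤ z.re) => by
        show -1 < z.re
        linarith
    · refine ⟨1, by norm_num, τ, Asymptotics.IsBigO.of_bound K ?_⟩
      rw [Filter.eventually_inf_principal]
      refine Filter.Eventually.of_forall fun z (hz : 0 < z.re) => (hbound z hz.le).trans ?_
      rw [Real.norm_of_nonneg (Real.exp_pos _).le, Real.rpow_one]
      gcongr
      have h1 := Real.log_nonneg (show 1 ≤ z.re + 1 by linarith)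
      have h2 : τ * z.re ≤ τ * ‖z‖ := by gcongr; exact Complex.re_le_norm z
      have h3 : 0 ≤ κ * ((z.re + 1) * Real.log (z.re + 1)) := by positivity
      linarith
    · intro n
      have hlim : Filter.Tendsto (fun x : ℝ => K * Real.exp (-x)) Filter.atTop (nhds 0) := by
        simpa using (Real.tendsto_exp_neg_atTop_nhds_zero).const_mul K
      refine squeeze_zero' (Filter.Eventually.of_forall fun x => by positivity) ?_ hlim
      have hl : Filter.Tendsto (fun x : ℝ => Real.log (x + 1)) Filter.atTop Filter.atTop :=
        Real.tendsto_log_atTop.comp (Filter.tendsto_atTop_add_const_right _ _ Filter.tendsto_id)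
      filter_upwards [hl.eventually_ge_atTop ((n + τ + 1) / κ), Filter.eventually_ge_atTop 0]
        with x hx hx0
      have hb := hbound x (by simpa using hx0)
      simp only [Complex.ofReal_re] at hb
      calc _ ≤ Real.exp x ^ n * (K * Real.exp (τ * x - κ * ((x + 1) * Real.log (x + 1)))) := by
            gcongr
        _ = K * Real.exp (n * x + (τ * x - κ * ((x + 1) * Real.log (x + 1)))) := by
            rw [Real.exp_add, Real.exp_nat_mul]; ring
        _ ≤ _ := by
            gcongr
            have h1 : n + τ + 1 ≤ κ * Real.log (x + 1) := by
              rw [div_le_iff₀ hκ0] at hx; linarith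
            have h2 : 0 ≤ (n + τ + 1 : ℝ) := by positivity
            nlinarith
    · refine ⟨K, fun x => ?_⟩
      have := hbound (x * Complex.I) (by simp)
      simpa using this
  intro z hz
  have := hzero hz
  simp only [hE, Pi.zero_apply, mul_eq_zero, Complex.exp_ne_zero, or_false] at this
  exact this

/-- **Carlson's theorem**: a function on a half plane, of exponential type less than `π` in the
imaginary direction, that vanishes at almost all natural numbers vanishes on a half plane. -/
theorem carlson {F : ℂ → ℂ} {R K τ c : ℝ} (hc : c < Real.pi)
    (hd : DifferentiableOn ℂ F {z | R < z.re})
    (hb : ∀ z : ℂ, R < z.re → ‖F z‖ ≤ K * Real.exp (τ * |z.re| + c * |z.im|))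
    (hz0 : ∀ n : ℕ, 2 ≤ n → F n = 0) :
    ∃ R' : ℝ, ∀ z : ℂ, R' < z.re → F z = 0 := by
  -- The shift by m + 1/2 brings Re z > −1 into the domain of `F` and sends the zeros of cos(πz)
  -- there, the half-integers from −1/2 on, to integers at least m ≥ 2, where `F` vanishes. So the
  -- shifted function is divisible by cos(πz).
  obtain ⟨m, hm⟩ := exists_nat_ge (|R| + 2)
  have hRm : R + 2 ≤ m := by linarith [le_abs_self R]
  have hm2 : (2 : ℝ) ≤ m := by linarith [abs_nonneg R]
  have hm2' : 2 ≤ m := by exact_mod_cast hm2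
  set F₁ : ℂ → ℂ := fun z => F (z + (m + 1 / 2 : ℝ)) with hF₁
  have hmem : ∀ z : ℂ, -1 < z.re → R < (z + (m + 1 / 2 : ℝ)).re := fun z h => by
    rw [Complex.add_re, Complex.ofReal_re]; linarith
  have hopen : IsOpen {z : ℂ | -1 < z.re} := isOpen_lt continuous_const Complex.continuous_re
  have hd₁ : DifferentiableOn ℂ F₁ {z | -1 < z.re} :=
    hd.comp (by fun_prop) fun z hz => hmem z hz
  have hK : 0 ≤ K := by
    have h1 := (norm_nonneg _).trans (hb ((R + 1 : ℝ) : ℂ) (by simp))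
    exact nonneg_of_mul_nonneg_left h1 (Real.exp_pos _)
  set c₁ := max c 0
  have hc₁ : c₁ < Real.pi := max_lt hc Real.pi_pos
  set K₁ := K * Real.exp (|τ| * (m + 1 / 2)) with hK₁
  have hK₁0 : 0 ≤ K₁ := by positivity
  have hb₁ : ∀ z : ℂ, 0 ≤ z.re → ‖F₁ z‖ ≤ K₁ * Real.exp (|τ| * z.re + c₁ * |z.im|) := by
    intro z hz
    refine (hb _ (hmem z (by linarith))).trans ?_
    rw [hK₁, mul_assoc, ← Real.exp_add]
    have e1 : (z + (m + 1 / 2 : ℝ)).re = z.re + (m + 1 / 2) := by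
      rw [Complex.add_re, Complex.ofReal_re]
    have e2 : (z + (m + 1 / 2 : ℝ)).im = z.im := by
      rw [Complex.add_im, Complex.ofReal_im, add_zero]
    rw [e1, e2, abs_of_nonneg (show 0 ≤ z.re + (m + 1 / 2) by linarith)]
    refine mul_le_mul_of_nonneg_left (Real.exp_le_exp.2 ?_) hK
    have h1 : τ * (z.re + (m + 1 / 2)) ≤ |τ| * (z.re + (m + 1 / 2)) := by
      gcongr; exact le_abs_self _
    have h2 : c * |z.im| ≤ c₁ * |z.im| := by gcongr; exact le_max_left _ _
    linarith
  obtain ⟨h, hhd, hh⟩ := exists_differentiableOn_eq_mul hopen hd₁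
    (g := fun z => Complex.cos (Real.pi * z)) (by fun_prop) (by
      intro z hz hcz
      obtain ⟨k, hk⟩ := Complex.cos_eq_zero_iff.1 hcz
      have hpi : (Real.pi : ℂ) ≠ 0 := by exact_mod_cast Real.pi_ne_zero
      have hzk : z = k + 1 / 2 := by
        have : (Real.pi : ℂ) * z = Real.pi * (k + 1 / 2) := by rw [hk]; ring
        exact mul_left_cancel₀ hpi this
      constructor
      · have hre : z.re = k + 1 / 2 := by rw [hzk]; simp
        have hz' : -1 < z.re := hz
        have hk1 : (-2 : ℝ) < k := by linarith
        have hk2 : -1 ≤ k := by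
          have : (-2 : ℤ) < k := by exact_mod_cast hk1
          omega
        obtain ⟨j, hj⟩ := Int.eq_ofNat_of_zero_le (show 0 ≤ k + 1 by omega)
        have hzj : z + (m + 1 / 2 : ℝ) = ((j + m : ℕ) : ℂ) := by
          have : (k : ℂ) + 1 = (j : ℂ) := by exact_mod_cast hj
          rw [hzk]; push_cast
          rw [← this]; ring
        simp only [hF₁]
        rw [hzj]
        exact hz0 _ (by omega)
      · have hder : HasDerivAt (fun z : ℂ => Complex.cos (Real.pi * z))
            (-Complex.sin (Real.pi * z) * Real.pi) z := by
          have h1 : HasDerivAt (fun z : ℂ => (Real.pi : ℂ) * z) Real.pi z := by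
            simpa using (hasDerivAt_id z).const_mul (Real.pi : ℂ)
          exact h1.ccos
        rw [hder.deriv]
        refine mul_ne_zero (neg_ne_zero.2 fun hs => ?_) hpi
        have := Complex.sin_sq_add_cos_sq (Real.pi * z)
        rw [hs] at this
        rw [hcz] at this
        simp at this)
  set δ := Real.pi - c₁
  have hδ : 0 < δ := sub_pos.2 hc₁
  -- Away from the zeros of the cosine, dividing by it gains exp(−π|y|), which beats the growth
  -- exp(c₁|y|).
  have hgood : ∀ z : ℂ, 0 ≤ z.re → ((∃ k : ℤ, z.re = k) ∨ 1 ≤ |z.im|) →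
      ‖h z‖ ≤ 4 * K₁ * Real.exp (|τ| * z.re - δ * |z.im|) := by
    intro z hz hz'
    have h1 := exp_le_norm_cos hz'
    have h2 := hb₁ z hz
    rw [hh z (show -1 < z.re by linarith), norm_mul] at h2
    have h3 : ‖h z‖ * Real.exp (Real.pi * |z.im|) ≤
        4 * (K₁ * Real.exp (|τ| * z.re + c₁ * |z.im|)) := by
      calc _ ≤ ‖h z‖ * (4 * ‖Complex.cos (Real.pi * z)‖) := by gcongr
        _ = 4 * (‖h z‖ * ‖Complex.cos (Real.pi * z)‖) := by ring
        _ ≤ _ := by gcongr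
    rw [← le_div_iff₀ (Real.exp_pos _)] at h3
    refine h3.trans (le_of_eq ?_)
    rw [mul_div_assoc, mul_div_assoc, ← Real.exp_sub]
    simp only [δ]
    ring_nf
  have hall : ∀ z : ℂ, 0 ≤ z.re →
      ‖h z‖ ≤ (4 * K₁ * Real.exp (|τ| + δ)) * Real.exp (|τ| * z.re - δ * |z.im|) := by
    intro z hz
    rw [mul_assoc _ (Real.exp _), ← Real.exp_add]
    by_cases hz1 : 1 ≤ |z.im|
    · refine (hgood z hz (Or.inr hz1)).trans ?_
      gcongr
      linarith [abs_nonneg τ]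
    push Not at hz1
    set k : ℤ := ⌊z.re⌋
    have hk0 : (0 : ℝ) ≤ k := by exact_mod_cast Int.floor_nonneg.2 hz
    have hk1 : (k : ℝ) ≤ z.re := Int.floor_le _
    have hk2 : z.re < k + 1 := Int.lt_floor_add_one _
    by_cases hzk : z.re = k
    · refine (hgood z hz (Or.inl ⟨k, hzk⟩)).trans ?_
      gcongr
      linarith [abs_nonneg τ]
    -- What remains lies in boxes between consecutive integer lines with |Im| < 1. Their boundary is
    -- in the region already bounded, so the maximum modulus principle costs only the constant
    -- factor exp(|τ| + δ).
    set U : Set ℂ := Set.Ioo (k : ℝ) (k + 1) ×ℂ Set.Ioo (-1 : ℝ) 1 with hU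
    have hcl : closure U = Set.Icc (k : ℝ) (k + 1) ×ℂ Set.Icc (-1 : ℝ) 1 := by
      rw [hU, Complex.closure_reProdIm, closure_Ioo (by simp), closure_Ioo (by norm_num)]
    have hUb : Bornology.IsBounded U :=
      (Metric.isBounded_Ioo _ _).reProdIm (Metric.isBounded_Ioo _ _)
    have hUd : DiffContOnCl ℂ h U := by
      apply DifferentiableOn.diffContOnCl
      rw [hcl]
      refine hhd.mono fun w hw => ?_
      have : (k : ℝ) ≤ w.re := hw.1.1
      show -1 < w.re
      linarith
    have hfr : ∀ w ∈ frontier U, ‖h w‖ ≤ 4 * K₁ * Real.exp (|τ| * (k + 1)) := by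
      intro w hw
      rw [frontier, hcl, (isOpen_Ioo.reProdIm isOpen_Ioo).interior_eq] at hw
      obtain ⟨⟨hw1, hw2⟩, hw3⟩ := hw
      have hw0 : 0 ≤ w.re := hk0.trans hw1.1
      have : (∃ k : ℤ, w.re = k) ∨ 1 ≤ |w.im| := by
        by_contra hcon
        push Not at hcon
        obtain ⟨hc1, hc2⟩ := hcon
        refine hw3 ⟨⟨lt_of_le_of_ne hw1.1 (fun h => hc1 k h.symm), lt_of_le_of_ne hw1.2 ?_⟩, ?_⟩
        · have := hc1 (k + 1)
          push_cast at this
          exact this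
        · exact abs_lt.1 hc2
      refine (hgood w hw0 this).trans ?_
      gcongr
      have h1 : |τ| * w.re ≤ |τ| * (k + 1) := by gcongr; exact hw1.2
      have h2 : 0 ≤ δ * |w.im| := by positivity
      linarith
    have hzU : z ∈ closure U := subset_closure
      ⟨⟨lt_of_le_of_ne hk1 (Ne.symm hzk), hk2⟩, abs_lt.1 hz1⟩
    refine (Complex.norm_le_of_forall_mem_frontier_norm_le hUb hUd hfr hzU).trans ?_
    gcongr
    have h1 : |τ| * k ≤ |τ| * z.re := by gcongr
    have h2 : δ * |z.im| ≤ δ * 1 := by gcongr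
    linarith
  have hzero := eq_zero_of_exp_decay (abs_nonneg τ) hδ hhd hall
  refine ⟨m + 1 / 2, fun z hz => ?_⟩
  have h1 : 0 ≤ (z - (m + 1 / 2 : ℝ)).re := by
    rw [Complex.sub_re, Complex.ofReal_re]; linarith
  have h2 := hh (z - (m + 1 / 2 : ℝ)) (show -1 < (z - (m + 1 / 2 : ℝ)).re by linarith)
  rw [hzero _ h1, zero_mul] at h2
  simpa [hF₁] using h2

/-- If the sequence defining the multi-entropy is affine in `n`, the multi-entropy is the value of
the affine function at `1`. -/
theorem isMultiEntropy_iff_of_affine {H : Fin 3 → Type} [∀ a, Fintype (H a)]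
    [∀ a, DecidableEq (H a)] {ψ : (∀ a, H a) → ℂ} {p q : ℝ}
    (hs : ∀ (n : ℕ) [NeZero n], 2 ≤ n → renyiMulti ψ n = p * n + q) (L : ℝ) :
    IsMultiEntropy ψ L ↔ L = p + q := by
  have hlin : ∀ z : ℂ, ‖(p : ℂ) * z + q‖ ≤
      (|p| + |q|) * Real.exp (1 * |z.re| + 1 * |z.im|) := by
    intro z
    have h1 : ‖z‖ ≤ Real.exp (1 * |z.re| + 1 * |z.im|) := by
      have := Real.add_one_le_exp (1 * |z.re| + 1 * |z.im|)
      linarith [Complex.norm_le_abs_re_add_abs_im z]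
    have h2 : 1 ≤ Real.exp (1 * |z.re| + 1 * |z.im|) := Real.one_le_exp (by positivity)
    calc _ ≤ ‖(p : ℂ) * z‖ + ‖(q : ℂ)‖ := norm_add_le _ _
      _ = |p| * ‖z‖ + |q| * 1 := by simp
      _ ≤ |p| * Real.exp (1 * |z.re| + 1 * |z.im|) +
          |q| * Real.exp (1 * |z.re| + 1 * |z.im|) := by gcongr
      _ = _ := by ring
  have hcont : Filter.Tendsto (fun z : ℂ => (p : ℂ) * z + q) (nhdsWithin 1 {1}ᶜ)
      (nhds ((p + q : ℝ) : ℂ)) := by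
    have : Continuous fun z : ℂ => (p : ℂ) * z + q := by fun_prop
    have h := (this.tendsto 1).mono_left (nhdsWithin_le_nhds (s := {1}ᶜ))
    simpa using h
  constructor
  · rintro ⟨f, ⟨⟨U, R, hUo, hUc, hU1, hUR, hfd, K, τ, c, hc, hb⟩, hfn⟩, hL⟩
    have hgd : DifferentiableOn ℂ (fun z : ℂ => (p : ℂ) * z + q) U := by fun_prop
    obtain ⟨R', hR'⟩ := carlson (F := fun z => f z - (p * z + q)) (R := R)
      (K := |K| + (|p| + |q|)) (τ := max τ 1) (c := max c 1)
      (max_lt hc (by linarith [Real.pi_gt_three]))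
      ((hfd.sub hgd).mono fun z hz => hUR z hz) (by
        intro z hz
        refine (norm_sub_le _ _).trans ?_
        rw [add_mul]
        refine add_le_add ((hb z hz).trans ?_) ((hlin z).trans ?_)
        · gcongr
          · exact le_abs_self _
          · exact le_max_left _ _
          · exact le_max_left _ _
        · gcongr
          · exact le_max_right _ _
          · exact le_max_right _ _)
      (by
        intro n hn
        have : NeZero n := ⟨by omega⟩
        have h1 : f n = renyiMulti ψ n := hfn n hn
        simp only [h1, hs n hn, sub_self])
    have h1U : (1 : ℂ) ∈ U := by simpa using hU1 1 le_rfl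
    set x₀ : ℂ := ((max R R' + 1 : ℝ) : ℂ) with hx₀
    have hx₀R : R < x₀.re := by
      rw [hx₀, Complex.ofReal_re]; linarith [le_max_left R R']
    have hx₀R' : R' < x₀.re := by
      rw [hx₀, Complex.ofReal_re]; linarith [le_max_right R R']
    -- Carlson gives equality only on a far half plane; connectedness of `U` carries it back to a
    -- neighbourhood of 1.
    have heq : Set.EqOn f (fun z => (p : ℂ) * z + q) U := by
      refine (hfd.analyticOnNhd hUo).eqOn_of_preconnected_of_eventuallyEq
        (hgd.analyticOnNhd hUo) hUc (hUR x₀ hx₀R) ?_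
      filter_upwards [(isOpen_lt continuous_const Complex.continuous_re).mem_nhds hx₀R'] with z hz
      exact sub_eq_zero.1 (hR' z hz)
    have hL' : Filter.Tendsto (fun z : ℂ => (p : ℂ) * z + q) (nhdsWithin 1 {1}ᶜ)
        (nhds (L : ℂ)) := by
      refine hL.congr' ?_
      filter_upwards [nhdsWithin_le_nhds (hUo.mem_nhds h1U)] with z hz
      exact heq hz
    exact_mod_cast tendsto_nhds_unique hL' hcont
  · rintro rfl
    refine ⟨fun z => p * z + q, ⟨⟨Set.univ, 0, isOpen_univ, isPreconnected_univ,
      fun _ _ => trivial, fun _ _ => trivial, by fun_prop, |p| + |q|, 1, 1,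
      by linarith [Real.pi_gt_three], fun z _ => hlin z⟩, ?_⟩, hcont⟩
    intro n _ hn
    exact (hs n hn).symm

/-! ### Pauli strings labelled by binary vectors -/

/-- The sign character of `ℤ/2`. -/
def sgn (x : ZMod 2) : ℂ := if x = 0 then 1 else -1

lemma sgn_add (x y : ZMod 2) : sgn (x + y) = sgn x * sgn y := by
  revert x y
  have h : ∀ x : ZMod 2, x = 0 ∨ x = 1 := by decide
  intro x y
  have h11 : (1 + 1 : ZMod 2) = 0 := by decide
  rcases h x with rfl | rfl <;> rcases h y with rfl | rfl <;> simp [sgn, h11]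

@[simp] lemma sgn_zero : sgn 0 = 1 := by simp [sgn]

lemma sgn_eq_one_iff {x : ZMod 2} : sgn x = 1 ↔ x = 0 := by
  unfold sgn
  split_ifs with h
  · simp [h]
  · constructor
    · intro h'; norm_num at h'
    · intro h'; exact absurd h' h

lemma sgn_sum {κ : Type*} (s : Finset κ) (f : κ → ZMod 2) :
    sgn (∑ i ∈ s, f i) = ∏ i ∈ s, sgn (f i) := by
  classical
  induction s using Finset.induction_on with
  | empty => simp
  | insert a s ha ih => rw [Finset.sum_insert ha, Finset.prod_insert ha, sgn_add, ih]

/-- The binary label of a Pauli matrix. -/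
def Pauli.label : Pauli → ZMod 2 × ZMod 2
  | .I => (0, 0)
  | .X => (1, 0)
  | .Y => (1, 1)
  | .Z => (0, 1)

/-- The Pauli matrix with a given binary label. -/
def Pauli.ofLabel (u : ZMod 2 × ZMod 2) : Pauli :=
  if u.1 = 0 then (if u.2 = 0 then .I else .Z) else (if u.2 = 0 then .X else .Y)

lemma Pauli.ofLabel_label (P : Pauli) : Pauli.ofLabel P.label = P := by
  cases P <;> simp [Pauli.label, Pauli.ofLabel]

lemma label_cases (u : ZMod 2 × ZMod 2) :
    u = (0, 0) ∨ u = (1, 0) ∨ u = (0, 1) ∨ u = (1, 1) := by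
  revert u; decide

lemma Pauli.label_ofLabel (u : ZMod 2 × ZMod 2) : (Pauli.ofLabel u).label = u := by
  rcases label_cases u with rfl | rfl | rfl | rfl <;> simp [Pauli.label, Pauli.ofLabel]

/-- The single-qubit Pauli matrix with label `u`. -/
def qmat (u : ZMod 2 × ZMod 2) : Matrix (Fin 2) (Fin 2) ℂ := (Pauli.ofLabel u).mat

/-- The commutation form of single-qubit labels. -/
def qsymp (u w : ZMod 2 × ZMod 2) : ZMod 2 := u.1 * w.2 + u.2 * w.1

/-- The phase in the product of two Pauli matrices. -/
def qphase (u w : ZMod 2 × ZMod 2) : ℂ := (qmat u * qmat w * qmat (u + w)).trace / 2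

lemma qmat_00 : qmat (0, 0) = !![1, 0; 0, 1] := by
  simp [qmat, Pauli.ofLabel, Pauli.mat, Matrix.one_fin_two]
lemma qmat_10 : qmat (1, 0) = !![0, 1; 1, 0] := by simp [qmat, Pauli.ofLabel, Pauli.mat]
lemma qmat_01 : qmat (0, 1) = !![1, 0; 0, -1] := by simp [qmat, Pauli.ofLabel, Pauli.mat]
lemma qmat_11 : qmat (1, 1) = !![0, -Complex.I; Complex.I, 0] := by
  simp [qmat, Pauli.ofLabel, Pauli.mat]

lemma zmod_two_one_add_one : (1 + 1 : ZMod 2) = 0 := by decide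

/-- The product of two Pauli matrices is a scalar times the one with the added label. Multiplying by
that matrix, which squares to 1, and taking the trace isolates the scalar, which is why `qphase` is
a trace divided by 2. -/
lemma qmat_mul (u w : ZMod 2 × ZMod 2) : qmat u * qmat w = qphase u w • qmat (u + w) := by
  rcases label_cases u with rfl | rfl | rfl | rfl <;>
  rcases label_cases w with rfl | rfl | rfl | rfl <;>
  simp [qphase, qmat_00, qmat_10, qmat_01, qmat_11, zmod_two_one_add_one, Matrix.trace_fin_two]

lemma qphase_comm (u w : ZMod 2 × ZMod 2) : qphase u w = sgn (qsymp u w) * qphase w u := by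
  rcases label_cases u with rfl | rfl | rfl | rfl <;>
  rcases label_cases w with rfl | rfl | rfl | rfl <;>
  simp [qphase, qsymp, sgn, qmat_00, qmat_10, qmat_01, qmat_11, zmod_two_one_add_one, Matrix.trace_fin_two]

lemma qphase_ne_zero (u w : ZMod 2 × ZMod 2) : qphase u w ≠ 0 := by
  rcases label_cases u with rfl | rfl | rfl | rfl <;>
  rcases label_cases w with rfl | rfl | rfl | rfl <;>
  simp [qphase, qmat_00, qmat_10, qmat_01, qmat_11, zmod_two_one_add_one, Matrix.trace_fin_two]

lemma qphase_self (u : ZMod 2 × ZMod 2) : qphase u u = 1 := by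
  rcases label_cases u with rfl | rfl | rfl | rfl <;>
  simp [qphase, qmat_00, qmat_10, qmat_01, qmat_11, zmod_two_one_add_one, Matrix.trace_fin_two]

lemma qphase_zero_right (u : ZMod 2 × ZMod 2) : qphase u 0 = 1 := by
  rcases label_cases u with rfl | rfl | rfl | rfl <;>
  simp [← Prod.mk_zero_zero, -Prod.mk_eq_zero, qphase, qmat_00, qmat_10, qmat_01, qmat_11,
    Matrix.trace_fin_two]

lemma qmat_zero : qmat 0 = 1 := by
  simp [qmat, Pauli.ofLabel, Pauli.mat]

lemma qmat_conj (u : ZMod 2 × ZMod 2) (x y : Fin 2) : conj (qmat u x y) = qmat u y x := by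
  rcases label_cases u with rfl | rfl | rfl | rfl <;> fin_cases x <;> fin_cases y <;>
  simp [qmat_00, qmat_10, qmat_01, qmat_11]

lemma qmat_trace (u : ZMod 2 × ZMod 2) : ∑ x, qmat u x x = if u = 0 then 2 else 0 := by
  rcases label_cases u with rfl | rfl | rfl | rfl <;>
  norm_num [qmat_00, qmat_10, qmat_01, qmat_11]

/-- Binary labels of the Pauli strings on the qubits `ι`. -/
abbrev PLabel (ι : Type*) := ι → ZMod 2 × ZMod 2

lemma plabel_add_self {ι : Type*} (v : PLabel ι) : v + v = 0 := ZModModule.add_self v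

section Strings

variable {ι : Type*} [Fintype ι]

/-- The Hermitian Pauli string with label `v`. -/
def pmat (v : PLabel ι) : Matrix (ι → Fin 2) (ι → Fin 2) ℂ :=
  Matrix.of fun x y => ∏ i, qmat (v i) (x i) (y i)

/-- The phase in the product of two Pauli strings. -/
def pphase (v w : PLabel ι) : ℂ := ∏ i, qphase (v i) (w i)

/-- The commutation form of Pauli strings. -/
def psymp (v w : PLabel ι) : ZMod 2 := ∑ i, qsymp (v i) (w i)

lemma pmat_apply (v : PLabel ι) (x y : ι → Fin 2) : pmat v x y = ∏ i, qmat (v i) (x i) (y i) := rfl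

lemma pmat_mul [DecidableEq ι] (v w : PLabel ι) : pmat v * pmat w = pphase v w • pmat (v + w) := by
  ext x y
  rw [Matrix.mul_apply, Matrix.smul_apply, smul_eq_mul]
  simp only [pmat_apply, pphase, ← Finset.prod_mul_distrib]
  rw [← Fintype.prod_sum (fun i z => qmat (v i) (x i) z * qmat (w i) z (y i))]
  refine Finset.prod_congr rfl fun i _ => ?_
  have := congrFun (congrFun (qmat_mul (v i) (w i)) (x i)) (y i)
  simpa [Matrix.mul_apply] using this

lemma pphase_comm (v w : PLabel ι) : pphase v w = sgn (psymp v w) * pphase w v := by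
  rw [pphase, pphase, psymp, sgn_sum, ← Finset.prod_mul_distrib]
  exact Finset.prod_congr rfl fun i _ => qphase_comm _ _

lemma pphase_ne_zero (v w : PLabel ι) : pphase v w ≠ 0 :=
  Finset.prod_ne_zero_iff.2 fun _ _ => qphase_ne_zero _ _

@[simp] lemma pphase_self (v : PLabel ι) : pphase v v = 1 :=
  Finset.prod_eq_one fun _ _ => qphase_self _

@[simp] lemma pphase_zero_right (v : PLabel ι) : pphase v 0 = 1 :=
  Finset.prod_eq_one fun _ _ => qphase_zero_right _

lemma psymp_comm (v w : PLabel ι) : psymp v w = psymp w v :=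
  Finset.sum_congr rfl fun i _ => by simp only [qsymp]; ring

lemma psymp_add_right (v w w' : PLabel ι) : psymp v (w + w') = psymp v w + psymp v w' := by
  simp only [psymp, ← Finset.sum_add_distrib]
  exact Finset.sum_congr rfl fun i _ => by simp only [qsymp, Pi.add_apply, Prod.fst_add, Prod.snd_add]; ring

@[simp] lemma psymp_zero_right (v : PLabel ι) : psymp v 0 = 0 := by
  simp [psymp, qsymp]

@[simp] lemma psymp_self (v : PLabel ι) : psymp v v = 0 := by
  refine Finset.sum_eq_zero fun i _ => ?_
  simp only [qsymp]
  rw [mul_comm (v i).2]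
  exact CharTwo.add_self_eq_zero _

lemma pmat_zero [DecidableEq ι] : pmat (0 : PLabel ι) = 1 := by
  ext x y
  rw [pmat_apply, Matrix.one_apply]
  simp only [Pi.zero_apply, qmat_zero, Matrix.one_apply]
  rw [Finset.prod_ite_zero]
  simp [funext_iff]

lemma pmat_mul_self [DecidableEq ι] (v : PLabel ι) : pmat v * pmat v = 1 := by
  rw [pmat_mul, pphase_self, one_smul, plabel_add_self, pmat_zero]

lemma pmat_comm [DecidableEq ι] (v w : PLabel ι) :
    pmat v * pmat w = sgn (psymp v w) • (pmat w * pmat v) := by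
  rw [pmat_mul, pmat_mul, pphase_comm, smul_smul, add_comm]

lemma pmat_conj (v : PLabel ι) (x y : ι → Fin 2) : conj (pmat v x y) = pmat v y x := by
  simp only [pmat_apply, map_prod, qmat_conj]

lemma pmat_conjTranspose (v : PLabel ι) : (pmat v).conjTranspose = pmat v := by
  ext x y
  exact pmat_conj v y x

lemma pmat_trace [DecidableEq ι] (v : PLabel ι) :
    (pmat v).trace = if v = 0 then (2 : ℂ) ^ Fintype.card ι else 0 := by
  simp only [Matrix.trace, Matrix.diag_apply, pmat_apply]
  rw [← Fintype.prod_sum (fun i z => qmat (v i) z z)]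
  simp only [qmat_trace]
  rw [Finset.prod_ite_zero]
  simp [funext_iff]

lemma pmat_trace_mul [DecidableEq ι] (v w : PLabel ι) :
    (pmat v * pmat w).trace = if v = w then (2 : ℂ) ^ Fintype.card ι else 0 := by
  rw [pmat_mul, Matrix.trace_smul, pmat_trace]
  by_cases h : v = w
  · subst h; simp [plabel_add_self]
  · rw [if_neg h, if_neg, smul_zero]
    intro h'
    exact h (by rw [← sub_eq_zero, ZModModule.sub_eq_add, h'])

/-- The commutation form separates labels. -/
lemma exists_psymp_ne_zero [DecidableEq ι] {v : PLabel ι} (hv : v ≠ 0) : ∃ u, psymp u v ≠ 0 := by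
  obtain ⟨i, hi⟩ := Function.ne_iff.1 hv
  have key : ∀ z : ZMod 2 × ZMod 2, psymp (Pi.single i z) v = qsymp z (v i) := by
    intro z
    rw [psymp, Finset.sum_eq_single i]
    · simp
    · intro j _ hj; simp [hj, qsymp]
    · simp
  -- On qubit `i`, X detects the second component of the label and Z the first.
  by_cases h1 : (v i).1 = 0
  · refine ⟨Pi.single i (1, 0), ?_⟩
    rw [key]
    intro h2
    refine hi (Prod.ext h1 ?_)
    simpa [qsymp] using h2
  · refine ⟨Pi.single i (0, 1), ?_⟩
    rw [key]
    simpa [qsymp] using h1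

end Strings

/-! ### Cyclic contractions and their gauge invariance -/

section Cyc

variable {X H : Type*} [Fintype X] [DecidableEq X] [Fintype H]

/-- The contraction of one matrix per site along the cycles of a permutation of the sites. -/
def cyc (s : Equiv.Perm X) (M : X → Matrix H H ℂ) : ℂ :=
  ∑ k : X → H, ∏ r, M r (k r) (k (s r))

lemma cyc_smul (s : Equiv.Perm X) (c : X → ℂ) (M : X → Matrix H H ℂ) :
    cyc s (fun r => c r • M r) = (∏ r, c r) * cyc s M := by
  simp only [cyc, Matrix.smul_apply, smul_eq_mul, Finset.prod_mul_distrib, Finset.mul_sum]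

/-- Expanding the matrix products puts a second label on every site. Exchanging the roles of outer
and inner labels carries each `Y` across its bond to the preceding site of the cycle. -/
lemma cyc_mul_comm (s : Equiv.Perm X) (Y M : X → Matrix H H ℂ) :
    cyc s (fun r => Y r * M r) = cyc s (fun r => M r * Y (s r)) := by
  simp only [cyc, Matrix.mul_apply, Fintype.prod_sum]
  rw [Finset.sum_comm]
  refine Finset.sum_congr rfl fun a _ => ?_
  refine Fintype.sum_equiv (Equiv.arrowCongr s.symm (Equiv.refl H)) _ _ fun k => ?_
  simp only [Equiv.arrowCongr_apply, Equiv.coe_refl, Function.comp, id, Equiv.symm_symm]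
  rw [Finset.prod_mul_distrib, Finset.prod_mul_distrib, mul_comm]
  congr 1
  exact (Equiv.prod_comp s fun r => Y r (k r) (a r)).symm

/-- The two copies of `Y` attached to a bond meet there and square to 1. -/
lemma cyc_gauge [DecidableEq H] (s : Equiv.Perm X) (Y M : X → Matrix H H ℂ) (hY : ∀ r, Y r * Y r = 1) :
    cyc s (fun r => Y r * M r * Y (s r)) = cyc s M := by
  simp only [Matrix.mul_assoc]
  rw [cyc_mul_comm]
  simp only [Matrix.mul_assoc, hY, Matrix.mul_one]

end Cyc

section PauliCyc

variable {X ι : Type*} [Fintype X] [DecidableEq X] [Fintype ι] [DecidableEq ι]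

/-- A Pauli gauge shifts each label by the coboundary of `u`. The sign comes from moving the gauge
string past the original one, the other phases from merging the strings. -/
lemma cyc_pmat_gauge (s : Equiv.Perm X) (u v : X → PLabel ι) :
    cyc s (fun r => pmat (v r)) =
      (∏ r, (sgn (psymp (u r) (v r)) *
        (pphase (u r) (u (s r)) * pphase (v r) (u r + u (s r))))) *
        cyc s (fun r => pmat (v r + (u r + u (s r)))) := by
  rw [← cyc_smul, ← cyc_gauge s (fun r => pmat (u r)) _ fun r => pmat_mul_self _]
  congr 1
  funext r
  rw [pmat_comm (u r) (v r), Matrix.smul_mul, Matrix.mul_assoc, pmat_mul (u r), Matrix.mul_smul,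
    pmat_mul (v r), smul_smul, smul_smul, mul_assoc]

/-- A cyclic contraction of Pauli strings vanishes unless its labels add up to zero on every
union of cycles. -/
lemma sum_eq_zero_of_cyc_ne_zero (s : Equiv.Perm X) (v : X → PLabel ι) (T : Finset X)
    (hT : ∀ r, s r ∈ T ↔ r ∈ T) (h : cyc s (fun r => pmat (v r)) ≠ 0) : ∑ r ∈ T, v r = 0 := by
  by_contra hne
  obtain ⟨w, hw⟩ := exists_psymp_ne_zero hne
  -- A gauge equal to `w` on a union of cycles and 0 elsewhere shifts no label; it only multiplies
  -- the contraction by the sign of ω(w, Σ_T v), which must then be 1.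
  have key := cyc_pmat_gauge s (fun r => if r ∈ T then w else 0) v
  have hu : ∀ r, (if r ∈ T then w else 0) + (if s r ∈ T then w else 0) = 0 := fun r => by
    simp only [hT]; exact plabel_add_self _
  have hp : ∀ r, pphase (if r ∈ T then w else 0) (if s r ∈ T then w else 0) = 1 := fun r => by
    simp only [hT]; exact pphase_self _
  simp only [hu, hp, add_zero, pphase_zero_right, mul_one] at key
  have hs : ∏ r, sgn (psymp (if r ∈ T then w else 0) (v r)) = sgn (psymp w (∑ r ∈ T, v r)) := by
    have hsum : psymp w (∑ r ∈ T, v r) = ∑ r ∈ T, psymp w (v r) :=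
      map_sum (AddMonoidHom.mk' (psymp w) (psymp_add_right w)) v T
    rw [hsum, sgn_sum, ← Finset.prod_filter_mul_prod_filter_not Finset.univ (· ∈ T)]
    rw [Finset.prod_congr (g := fun r => sgn (psymp w (v r))) rfl
      (fun r hr => by rw [if_pos (Finset.mem_filter.1 hr).2])]
    rw [Finset.prod_eq_one (s := Finset.univ.filter fun r => ¬ r ∈ T)
      (fun r hr => by
        rw [if_neg (Finset.mem_filter.1 hr).2, psymp_comm, psymp_zero_right, sgn_zero])]
    simp
  rw [hs] at key
  have : sgn (psymp w (∑ r ∈ T, v r)) = 1 := by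
    exact mul_right_cancel₀ h (by rw [one_mul]; exact key.symm)
  exact hw (sgn_eq_one_iff.1 this)

end PauliCyc

/-! ### Contractions of bipartite stabilizer groups -/

section Amp

variable {ιA ιB : Type*} [Fintype ιA] [DecidableEq ιA] [Fintype ιB] [DecidableEq ιB]

/-- The operators `ph v • (pmat v.1 ⊗ pmat v.2)`, `v ∈ S`, form a group. -/
structure IsPhase (S : Submodule (ZMod 2) (PLabel ιA × PLabel ιB))
    (ph : PLabel ιA × PLabel ιB → ℂ) : Prop where
  one_or : ∀ v ∈ S, ph v = 1 ∨ ph v = -1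
  add : ∀ v ∈ S, ∀ w ∈ S, ph (v + w) = ph v * ph w * (pphase v.1 w.1 * pphase v.2 w.2)

namespace IsPhase

variable {S : Submodule (ZMod 2) (PLabel ιA × PLabel ιB)} {ph : PLabel ιA × PLabel ιB → ℂ}

lemma mul_self (h : IsPhase S ph) {v : PLabel ιA × PLabel ιB} (hv : v ∈ S) : ph v * ph v = 1 := by
  rcases h.one_or v hv with h | h <;> rw [h] <;> norm_num

lemma ne_zero (h : IsPhase S ph) {v : PLabel ιA × PLabel ιB} (hv : v ∈ S) : ph v ≠ 0 := by
  intro h0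
  have := h.mul_self hv
  simp [h0] at this

lemma zero (h : IsPhase S ph) : ph 0 = 1 := by
  have := h.add 0 S.zero_mem 0 S.zero_mem
  simp only [add_zero, Prod.fst_zero, Prod.snd_zero, pphase_zero_right, mul_one,
    h.mul_self S.zero_mem] at this
  exact this

/-- The commutation forms of the two parties agree on the group. -/
lemma psymp_eq (h : IsPhase S ph) {v w : PLabel ιA × PLabel ιB} (hv : v ∈ S) (hw : w ∈ S) :
    psymp v.1 w.1 = psymp v.2 w.2 := by
  have h1 := h.add v hv w hw
  rw [add_comm v w, h.add w hw v hv, mul_comm (ph w)] at h1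
  have h2 := mul_left_cancel₀ (mul_ne_zero (h.ne_zero hv) (h.ne_zero hw)) h1
  rw [pphase_comm v.1, pphase_comm v.2] at h2
  have h3 : sgn (psymp v.1 w.1 + psymp v.2 w.2) = 1 := by
    rw [sgn_add]
    refine mul_right_cancel₀ (mul_ne_zero (pphase_ne_zero w.1 v.1) (pphase_ne_zero w.2 v.2)) ?_
    rw [one_mul]; conv_rhs => rw [h2]
    ring
  have h4 := sgn_eq_one_iff.1 h3
  rw [← sub_eq_zero, CharTwo.sub_eq_add, h4]

end IsPhase

variable {X : Type*} [Fintype X] [DecidableEq X]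

/-- The contraction of the operators with labels `q`, along `s` for the first party and along `t`
for the second. -/
def amp (ph : PLabel ιA × PLabel ιB → ℂ) (s t : Equiv.Perm X) (q : X → PLabel ιA × PLabel ιB) : ℂ :=
  (∏ r, ph (q r)) * (cyc s (fun r => pmat (q r).1) * cyc t (fun r => pmat (q r).2))

variable {S : Submodule (ZMod 2) (PLabel ιA × PLabel ιB)} {ph : PLabel ιA × PLabel ιB → ℂ}
  {s t : Equiv.Perm X}

/-- The parties may be gauged by unrelated strings `u` and `v`, not in `S` themselves, provided that
the resulting label shifts `d` are in `S`. Then the phases from merging `q` with `d` reassemble, by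
`IsPhase.add`, into ph(d) · ph(q + d). -/
lemma amp_gauge (h : IsPhase S ph) {q d : X → PLabel ιA × PLabel ιB} (u : X → PLabel ιA)
    (v : X → PLabel ιB) (hq : ∀ r, q r ∈ S) (hd : ∀ r, d r ∈ S)
    (hd1 : ∀ r, (d r).1 = u r + u (s r)) (hd2 : ∀ r, (d r).2 = v r + v (t r)) :
    amp ph s t q = (∏ r, sgn (psymp (u r) (q r).1 + psymp (v r) (q r).2)) *
      (∏ r, ph (d r) * (pphase (u r) (u (s r)) * pphase (v r) (v (t r)))) *
      amp ph s t (q + d) := by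
  have e1 : ∀ r, ph (q r) * pphase (q r).1 (d r).1 * pphase (q r).2 (d r).2 =
      ph (d r) * ph (q r + d r) := by
    intro r
    rw [h.add _ (hq r) _ (hd r)]
    have := h.mul_self (hd r)
    linear_combination (-(ph (q r) * pphase (q r).1 (d r).1 * pphase (q r).2 (d r).2)) * this
  rw [amp, amp, cyc_pmat_gauge s u, cyc_pmat_gauge t v]
  simp only [← hd1, ← hd2, Pi.add_apply, Prod.fst_add, Prod.snd_add, ← mul_assoc,
    ← Finset.prod_mul_distrib]
  have key : (∏ r, ph (q r) * sgn (psymp (u r) (q r).1) * pphase (u r) (u (s r)) *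
        pphase (q r).1 (d r).1) *
      (∏ r, sgn (psymp (v r) (q r).2) * pphase (v r) (v (t r)) * pphase (q r).2 (d r).2) =
      ∏ r, sgn (psymp (u r) (q r).1 + psymp (v r) (q r).2) * ph (d r) * pphase (u r) (u (s r)) *
        pphase (v r) (v (t r)) * ph (q r + d r) := by
    rw [← Finset.prod_mul_distrib]
    refine Finset.prod_congr rfl fun r _ => ?_
    rw [sgn_add]
    linear_combination (sgn (psymp (u r) (q r).1) * sgn (psymp (v r) (q r).2) *
      pphase (u r) (u (s r)) * pphase (v r) (v (t r))) * e1 r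
  linear_combination (cyc s (fun r => pmat ((q r).1 + (d r).1)) *
    cyc t (fun r => pmat ((q r).2 + (d r).2))) * key

end Amp

/-! ### Gauge transformations by group elements, and second differences. -/

section Gauge

variable {ιA ιB : Type*} [Fintype ιA] [DecidableEq ιA] [Fintype ιB] [DecidableEq ιB]
  {X : Type*} [Fintype X] [DecidableEq X]
  {S : Submodule (ZMod 2) (PLabel ιA × PLabel ιB)} {ph : PLabel ιA × PLabel ιB → ℂ}
  {s t : Equiv.Perm X}

lemma zmod_two_cases (c : ZMod 2) : c = 0 ∨ c = 1 := by revert c; decide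

lemma psymp_smul_left {ι : Type*} [Fintype ι] (c : ZMod 2) (v w : PLabel ι) :
    psymp (c • v) w = c * psymp v w := by
  rcases zmod_two_cases c with rfl | rfl
  · simp [psymp_comm 0 w]
  · simp

lemma pphase_smul_smul {ι : Type*} [Fintype ι] (c c' : ZMod 2) (v : PLabel ι) :
    pphase (c • v) (c' • v) = 1 := by
  have h0 : pphase 0 v = 1 := by
    rw [pphase_comm, psymp_comm, psymp_zero_right, sgn_zero, pphase_zero_right, one_mul]
  rcases zmod_two_cases c with rfl | rfl <;> rcases zmod_two_cases c' with rfl | rfl <;>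
    simp [h0]

/-- Gauge transformation by multiples of a single group element. -/
lemma amp_add_smul (h : IsPhase S ph) {q : X → PLabel ιA × PLabel ιB} (hq : ∀ r, q r ∈ S)
    {l : PLabel ιA × PLabel ιB} (hl : l ∈ S) (x y : X → ZMod 2)
    (hxy : ∀ r, x r + x (s r) = y r + y (t r)) :
    amp ph s t q = sgn (∑ r, (x r + y r) * psymp l.1 (q r).1) *
      amp ph s t (q + fun r => (x r + x (s r)) • l) := by
  have key := amp_gauge (s := s) (t := t) h (q := q) (d := fun r => (x r + x (s r)) • l)
    (fun r => x r • l.1) (fun r => y r • l.2) hq (fun r => S.smul_mem _ hl)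
    (fun r => by simp [add_smul]) (fun r => by simp [hxy, add_smul])
  rw [key]
  have h1 : ∏ r, sgn (psymp (x r • l.1) (q r).1 + psymp (y r • l.2) (q r).2) =
      sgn (∑ r, (x r + y r) * psymp l.1 (q r).1) := by
    rw [sgn_sum]
    refine Finset.prod_congr rfl fun r _ => ?_
    rw [psymp_smul_left, psymp_smul_left, ← h.psymp_eq hl (hq r), add_mul]
  -- On multiples of one element `ph` is multiplicative, and `s` only permutes the sites, so the
  -- product consists of squares of signs.
  have h2 : ∏ r, ph ((x r + x (s r)) • l) * (pphase (x r • l.1) (x (s r) • l.1) *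
      pphase (y r • l.2) (y (t r) • l.2)) = 1 := by
    have e : ∀ r, ph ((x r + x (s r)) • l) * (pphase (x r • l.1) (x (s r) • l.1) *
        pphase (y r • l.2) (y (t r) • l.2)) = ph (x r • l) * ph (x (s r) • l) := by
      intro r
      rw [add_smul, h.add _ (S.smul_mem _ hl) _ (S.smul_mem _ hl)]
      simp only [Prod.smul_fst, Prod.smul_snd, pphase_smul_smul, mul_one]
    simp only [e]
    rw [Finset.prod_mul_distrib, Equiv.prod_comp s (fun r => ph (x r • l)),
      ← Finset.prod_mul_distrib]
    exact Finset.prod_eq_one fun r _ => h.mul_self (S.smul_mem _ hl)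
  simp only [h1, h2, mul_one]

/-- Gauge transformation by group elements. -/
lemma amp_add_gauge (h : IsPhase S ph) {q w w' : X → PLabel ιA × PLabel ιB} (hq : ∀ r, q r ∈ S)
    (hw : ∀ r, w r ∈ S) (hw' : ∀ r, w' r ∈ S) (h1 : ∀ r, (w' r).1 = (w (s r)).1)
    (h2 : ∀ r, (w' r).2 = (w (t r)).2) (h3 : ∏ r, ph (w' r) = ∏ r, ph (w r)) :
    amp ph s t (q + (w + w')) = amp ph s t q := by
  have key := amp_gauge (s := s) (t := t) h (q := q) (d := w + w')
    (fun r => (w r).1) (fun r => (w r).2) hq (fun r => S.add_mem (hw r) (hw' r))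
    (fun r => by simp [h1]) (fun r => by simp [h2])
  rw [key]
  -- The commutation signs of the two parties coincide for elements of `S`, so they cancel.
  have e1 : ∏ r, sgn (psymp (w r).1 (q r).1 + psymp (w r).2 (q r).2) = 1 := by
    refine Finset.prod_eq_one fun r _ => ?_
    rw [h.psymp_eq (hw r) (hq r), CharTwo.add_self_eq_zero, sgn_zero]
  have e2 : ∏ r, ph ((w + w') r) * (pphase (w r).1 (w (s r)).1 * pphase (w r).2 (w (t r)).2) =
      1 := by
    have e : ∀ r, ph ((w + w') r) * (pphase (w r).1 (w (s r)).1 * pphase (w r).2 (w (t r)).2) =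
        ph (w r) * ph (w' r) := by
      intro r
      have ha := h.add _ (hw r) _ (hw' r)
      have hs := h.mul_self (S.add_mem (hw r) (hw' r))
      have hs1 := h.mul_self (hw r)
      have hs2 := h.mul_self (hw' r)
      rw [← h1, ← h2, Pi.add_apply]
      set P := pphase (w r).1 (w' r).1 * pphase (w r).2 (w' r).2
      have hP : P = ph (w r) * ph (w' r) * ph (w r + w' r) := by
        rw [ha]
        linear_combination (-P * ph (w r) ^ 2) * hs2 - P * hs1
      rw [hP]
      linear_combination (ph (w r) * ph (w' r)) * hs
    simp only [e]
    rw [Finset.prod_mul_distrib, h3, ← Finset.prod_mul_distrib]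
    exact Finset.prod_eq_one fun r _ => h.mul_self (hw r)
  rw [e1, e2, one_mul, one_mul]

/-- The second difference along `s` and `t`, modulo 2. -/
def diff₂ {X Y : Type*} [AddCommGroup Y] (s t : Equiv.Perm X) (p : X → Y) (r : X) : Y :=
  p r + p (s r) + (p (t r) + p (s (t r)))

lemma diff₂_add {X Y : Type*} [AddCommGroup Y] (s t : Equiv.Perm X) (p p' : X → Y) :
    diff₂ s t (p + p') = diff₂ s t p + diff₂ s t p' := by
  funext r
  simp only [diff₂, Pi.add_apply]
  abel

/-- Translation by an elementary second difference. -/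
lemma amp_add_diff₂_single (h : IsPhase S ph) (hst : ∀ r, s (t r) = t (s r))
    {q : X → PLabel ιA × PLabel ιB} (hq : ∀ r, q r ∈ S)
    {l : PLabel ιA × PLabel ιB} (hl : l ∈ S) (r₀ : X) :
    amp ph s t q = sgn (psymp l.1 (q (s r₀) + q (t r₀)).1) *
      amp ph s t (q + diff₂ s t (Pi.single (s (t r₀)) l)) := by
  -- Gauging the first party by p + p∘t and the second by p + p∘s produces the same shift, the
  -- second difference of `p`. The sum of the two gauges is p∘t + p∘s, supported at `s r₀` and `t
  -- r₀`, so only these sites contribute to the sign.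
  set p : X → ZMod 2 := Pi.single (s (t r₀)) 1 with hp
  have key := amp_add_smul (s := s) (t := t) h hq hl (fun r => p r + p (t r))
    (fun r => p r + p (s r)) (fun r => by simp only [hst]; ring)
  rw [key]
  have e1 : ∑ r, ((p r + p (t r)) + (p r + p (s r))) * psymp l.1 (q r).1 =
      psymp l.1 (q (s r₀) + q (t r₀)).1 := by
    have : ∀ r, ((p r + p (t r)) + (p r + p (s r))) * psymp l.1 (q r).1 =
        p (t r) * psymp l.1 (q r).1 + p (s r) * psymp l.1 (q r).1 := by
      intro r
      linear_combination (p r * psymp l.1 (q r).1) * (CharTwo.two_eq_zero (R := ZMod 2))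
    simp only [this, Finset.sum_add_distrib, Prod.fst_add, psymp_add_right]
    congr 1
    · rw [Finset.sum_eq_single (s r₀)]
      · simp [hp, hst]
      · intro r _ hr
        rw [hp, Pi.single_eq_of_ne, zero_mul]
        rw [hst]; exact fun h => hr (t.injective h)
      · simp
    · rw [Finset.sum_eq_single (t r₀)]
      · simp [hp]
      · intro r _ hr
        rw [hp, Pi.single_eq_of_ne, zero_mul]
        exact fun h => hr (s.injective h)
      · simp
  have e2 : (fun r => ((p r + p (t r)) + (p (s r) + p (t (s r)))) • l) =
      diff₂ s t (Pi.single (s (t r₀)) l) := by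
    funext r
    have : ∀ r, (Pi.single (s (t r₀)) l : X → _) r = p r • l := by
      intro r
      by_cases hr : r = s (t r₀)
      · subst hr; simp [hp]
      · simp [hp, hr]
    simp only [diff₂, this, add_smul]
    rw [hst r]
    abel
  rw [e1, e2]

/-- Translation by a second difference with values in an isotropic subspace. -/
lemma amp_add_diff₂ (h : IsPhase S ph) (hst : ∀ r, s (t r) = t (s r))
    {L : Submodule (ZMod 2) (PLabel ιA × PLabel ιB)} (hLS : L ≤ S)
    (hL : ∀ l ∈ L, ∀ l' ∈ L, psymp l.1 l'.1 = 0)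
    {q : X → PLabel ιA × PLabel ιB} (hq : ∀ r, q r ∈ S)
    (hqL : ∀ l ∈ L, ∀ r, psymp l.1 (q (s r) + q (t r)).1 = 0)
    (p : X → PLabel ιA × PLabel ιB) (hp : ∀ r, p r ∈ L) :
    amp ph s t (q + diff₂ s t p) = amp ph s t q := by
  have hd : ∀ p : X → PLabel ιA × PLabel ιB, (∀ r, p r ∈ L) → ∀ r, diff₂ s t p r ∈ L :=
    fun p hp r => L.add_mem (L.add_mem (hp _) (hp _)) (L.add_mem (hp _) (hp _))
  -- The translation is assembled one site at a time. Earlier translations take values in `L`, so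
  -- isotropy keeps every later sign trivial.
  have key : ∀ T : Finset X, amp ph s t (q + diff₂ s t (∑ r ∈ T, Pi.single r (p r))) =
      amp ph s t q := by
    intro T
    have hT : ∀ (T : Finset X) (r : X), (∑ r ∈ T, Pi.single r (p r) : X → _) r ∈ L := by
      intro T r
      rw [Finset.sum_apply]
      refine L.sum_mem fun r' _ => ?_
      by_cases hr : r = r'
      · subst hr; simpa using hp r
      · simp [hr]
    induction T using Finset.induction_on with
    | empty =>
      have : diff₂ s t (0 : X → PLabel ιA × PLabel ιB) = 0 := by funext r; simp [diff₂]
      simp [this]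
    | insert a T ha ih =>
      rw [Finset.sum_insert ha, add_comm (Pi.single _ _), diff₂_add, ← add_assoc, ← ih]
      set q' := q + diff₂ s t (∑ r ∈ T, Pi.single r (p r)) with hq'
      have hTd := hd _ (hT T)
      have hq'S : ∀ r, q' r ∈ S := fun r => S.add_mem (hq r) (hLS (hTd r))
      obtain ⟨r₀, hr₀⟩ : ∃ r₀, s (t r₀) = a := ⟨t.symm (s.symm a), by simp⟩
      have := amp_add_diff₂_single h hst hq'S (hLS (hp a)) r₀
      have hz : psymp (p a).1 (q' (s r₀) + q' (t r₀)).1 = 0 := by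
        have e : q' (s r₀) + q' (t r₀) = (q (s r₀) + q (t r₀)) +
            (diff₂ s t (∑ r ∈ T, Pi.single r (p r)) (s r₀) +
              diff₂ s t (∑ r ∈ T, Pi.single r (p r)) (t r₀)) := by
          simp only [hq', Pi.add_apply]; abel
        rw [e, Prod.fst_add, psymp_add_right, hqL _ (hp a),
          hL _ (hp a) _ (L.add_mem (hTd _) (hTd _)), add_zero]
      rw [hz, sgn_zero, one_mul, hr₀] at this
      exact this.symm
  have := key Finset.univ
  rwa [Finset.univ_sum_single] at this

end Gauge

/-! ### The torus -/

section Torus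

/-- The shift of the first coordinate of the torus. -/
def shiftA (n : ℕ) : Equiv.Perm (ZMod n × ZMod n) := (Equiv.addRight 1).prodCongr (Equiv.refl _)

/-- The shift of the second coordinate of the torus. -/
def shiftB (n : ℕ) : Equiv.Perm (ZMod n × ZMod n) := (Equiv.refl _).prodCongr (Equiv.addRight 1)

lemma shiftA_apply {n : ℕ} (r : ZMod n × ZMod n) : shiftA n r = (r.1 + 1, r.2) := rfl
lemma shiftB_apply {n : ℕ} (r : ZMod n × ZMod n) : shiftB n r = (r.1, r.2 + 1) := rfl

lemma shift_comm {n : ℕ} (r : ZMod n × ZMod n) : shiftA n (shiftB n r) = shiftB n (shiftA n r) := rfl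

variable {n : ℕ} [NeZero n]

/-- A function on `ℤ/n` with zero sum is a difference. -/
lemma exists_eq_add_shift {Y : Type*} [AddCommGroup Y] [Module (ZMod 2) Y] (v : ZMod n → Y)
    (hv : ∑ i, v i = 0) : ∃ p : ZMod n → Y, p 0 = 0 ∧ ∀ i, v i = p i + p (i + 1) := by
  -- Partial sums are primitives, as signs do not matter modulo 2; the vanishing total makes them
  -- periodic, so they descend to ℤ/n.
  set P : ℕ → Y := fun m => ∑ k ∈ Finset.range m, v k with hP
  have hsum : ∀ w : ZMod n → Y, ∑ k ∈ Finset.range n, w k = ∑ i, w i := by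
    intro w
    refine Finset.sum_nbij' (fun k : ℕ => (k : ZMod n)) ZMod.val (fun _ _ => Finset.mem_univ _)
      (fun i _ => Finset.mem_range.2 (ZMod.val_lt i)) (fun k hk => ?_) (fun i _ => ?_)
      (fun _ _ => rfl)
    · exact ZMod.val_cast_of_lt (Finset.mem_range.1 hk)
    · exact ZMod.natCast_zmod_val i
  have hper : Function.Periodic P n := by
    intro m
    simp only [hP]
    rw [Finset.sum_range_add]
    have : ∑ x ∈ Finset.range n, v ((m + x : ℕ) : ZMod n) = 0 := by
      rw [← hv, ← Equiv.sum_comp (Equiv.addLeft (m : ZMod n)) v, ← hsum]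
      simp
    rw [this, add_zero]
  refine ⟨fun i => P i.val, by simp [hP], fun i => ?_⟩
  have h1 : (i + 1).val = (i.val + 1) % n := by
    rw [← ZMod.val_natCast]; simp
  have h2 : P (i + 1).val = P i.val + v i := by
    rw [h1, hper.map_mod_nat]
    simp [hP, Finset.sum_range_succ]
  show v i = P i.val + P (i + 1).val
  rw [h2, ← add_assoc, ZModModule.add_self, zero_add]

lemma card_zeroSum (Y : Type*) [AddCommGroup Y] [Finite Y] :
    Nat.card {v : ZMod n → Y // ∑ i, v i = 0} = Nat.card Y ^ (n - 1) := by
  have hn : n = (n - 1) + 1 := (Nat.succ_pred_eq_of_pos (NeZero.pos n)).symm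
  let φ : (ZMod n → Y) →+ Y :=
    { toFun := fun v => ∑ i, v i
      map_zero' := by simp
      map_add' := fun v w => by simp [Finset.sum_add_distrib] }
  have hφ : Function.Surjective φ := fun y => ⟨Pi.single 0 y, by
    show ∑ i, (Pi.single 0 y : ZMod n → Y) i = y
    simp⟩
  have h1 := AddSubgroup.card_eq_card_quotient_mul_card_addSubgroup φ.ker
  rw [Nat.card_congr (QuotientAddGroup.quotientKerEquivOfSurjective φ hφ).toEquiv, Nat.card_fun,
    Nat.card_zmod] at h1
  conv_lhs at h1 => rw [hn, pow_succ, mul_comm]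
  have h2 := Nat.eq_of_mul_eq_mul_left Nat.card_pos h1
  rw [h2]
  rfl

/-- Zero sum along the first coordinate. -/
def ZeroA {Y : Type*} [AddCommGroup Y] (a : ZMod n × ZMod n → Y) : Prop := ∀ j, ∑ i, a (i, j) = 0

/-- Zero sum along the second coordinate. -/
def ZeroB {Y : Type*} [AddCommGroup Y] (a : ZMod n × ZMod n → Y) : Prop := ∀ i, ∑ j, a (i, j) = 0

lemma card_zeroB (Y : Type*) [AddCommGroup Y] [Finite Y] :
    Nat.card {a : ZMod n × ZMod n → Y // ZeroB a} = (Nat.card Y ^ (n - 1)) ^ n := by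
  have e : {a : ZMod n × ZMod n → Y // ZeroB a} ≃ (ZMod n → {v : ZMod n → Y // ∑ i, v i = 0}) :=
    { toFun := fun a i => ⟨fun j => a.1 (i, j), a.2 i⟩
      invFun := fun f => ⟨fun r => (f r.1).1 r.2, fun i => (f i).2⟩
      left_inv := fun _ => rfl
      right_inv := fun _ => rfl }
  rw [Nat.card_congr e, Nat.card_fun, card_zeroSum, Nat.card_zmod]

lemma card_zeroA (Y : Type*) [AddCommGroup Y] [Finite Y] :
    Nat.card {a : ZMod n × ZMod n → Y // ZeroA a} = (Nat.card Y ^ (n - 1)) ^ n := by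
  have e : {a : ZMod n × ZMod n → Y // ZeroA a} ≃ (ZMod n → {v : ZMod n → Y // ∑ i, v i = 0}) :=
    { toFun := fun a j => ⟨fun i => a.1 (i, j), a.2 j⟩
      invFun := fun f => ⟨fun r => (f r.2).1 r.1, fun i => (f i).2⟩
      left_inv := fun _ => rfl
      right_inv := fun _ => rfl }
  rw [Nat.card_congr e, Nat.card_fun, card_zeroSum, Nat.card_zmod]

/-- Such a function is a zero-sum sequence with values in the group of zero-sum sequences, so
`card_zeroSum` applies twice. -/
lemma card_zeroA_zeroB (Y : Type*) [AddCommGroup Y] [Finite Y] :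
    Nat.card {a : ZMod n × ZMod n → Y // ZeroA a ∧ ZeroB a} =
      (Nat.card Y ^ (n - 1)) ^ (n - 1) := by
  let Z : AddSubgroup (ZMod n → Y) :=
    { carrier := {v | ∑ i, v i = 0}
      zero_mem' := by simp
      add_mem' := fun {v w} hv hw => by
        simp only [Set.mem_ofPred_eq] at hv hw
        simp [Finset.sum_add_distrib, hv, hw]
      neg_mem' := fun {v} hv => by
        simp only [Set.mem_ofPred_eq] at hv
        simp [hv] }
  have e : {a : ZMod n × ZMod n → Y // ZeroA a ∧ ZeroB a} ≃ {v : ZMod n → Z // ∑ i, v i = 0} :=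
    { toFun := fun a => ⟨fun i => ⟨fun j => a.1 (i, j), a.2.2 i⟩, by
        ext j
        simpa using a.2.1 j⟩
      invFun := fun f => ⟨fun r => (f.1 r.1).1 r.2, fun j => by
        have := congrArg (fun z : Z => z.1 j) f.2
        simpa using this, fun i => (f.1 i).2⟩
      left_inv := fun _ => rfl
      right_inv := fun _ => rfl }
  rw [Nat.card_congr e, card_zeroSum]
  congr 1
  exact card_zeroSum Y

/-- Functions on the torus that are constant along antidiagonals. -/
def IsHankel {Y : Type*} (a : ZMod n × ZMod n → Y) : Prop := ∃ f : ZMod n → Y, ∀ r, a r = f (r.1 + r.2)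

/-- The relation a(i+1, j) = a(i, j+1) moves the second coordinate into the first step by step. -/
lemma isHankel_of_shift {Y : Type*} {a : ZMod n × ZMod n → Y}
    (h : ∀ r, a (shiftA n r) = a (shiftB n r)) : IsHankel a := by
  refine ⟨fun i => a (i, 0), fun r => ?_⟩
  have key : ∀ (m : ℕ) (i : ZMod n), a (i, (m : ZMod n)) = a (i + m, 0) := by
    intro m
    induction m with
    | zero => intro i; simp
    | succ m ih =>
      intro i
      have := h (i, (m : ZMod n))
      rw [shiftA_apply, shiftB_apply] at this
      push_cast
      rw [← this, ih]
      congr 2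
      ring
  have := key r.2.val r.1
  rwa [ZMod.natCast_zmod_val] at this

lemma card_isHankel (Y : Type*) [AddCommGroup Y] [Finite Y] :
    Nat.card {a : ZMod n × ZMod n → Y // (ZeroA a ∧ ZeroB a) ∧ IsHankel a} =
      Nat.card Y ^ (n - 1) := by
  rw [← card_zeroSum (n := n)]
  symm
  refine Nat.card_eq_of_bijective (fun f => ⟨fun r => f.1 (r.1 + r.2), ⟨⟨fun j => ?_, fun i => ?_⟩,
    f.1, fun r => rfl⟩⟩) ⟨fun f g hfg => ?_, ?_⟩
  · exact (Equiv.sum_comp (Equiv.addRight j) f.1).trans f.2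
  · exact (Equiv.sum_comp (Equiv.addLeft i) f.1).trans f.2
  · ext i
    have := congrFun (congrArg Subtype.val hfg) (i, 0)
    simpa using this
  · rintro ⟨a, ⟨hA, hB⟩, f, hf⟩
    refine ⟨⟨f, ?_⟩, ?_⟩
    · have := hA 0
      simpa [hf] using this
    · ext r; exact (hf r).symm

/-- The contraction of identities counts the labelings constant along cycles, and the shift has `n`
cycles. -/
lemma cyc_shiftA_one (H : Type*) [Fintype H] [DecidableEq H] :
    cyc (shiftA n) (fun _ => (1 : Matrix H H ℂ)) = (Fintype.card H : ℂ) ^ n := by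
  have key : ∀ k : ZMod n × ZMod n → H, (∀ r, k r = k (shiftA n r)) → ∀ r, k r = k (0, r.2) := by
    intro k hk r
    have : ∀ m : ℕ, k ((m : ZMod n), r.2) = k (0, r.2) := by
      intro m
      induction m with
      | zero => simp
      | succ m ih => rw [← ih, hk ((m : ZMod n), r.2), shiftA_apply]; simp
    have h := this r.1.val
    rwa [ZMod.natCast_zmod_val] at h
  have e : {k : ZMod n × ZMod n → H // ∀ r, k r = k (shiftA n r)} ≃ (ZMod n → H) :=
    { toFun := fun k j => k.1 (0, j)
      invFun := fun f => ⟨fun r => f r.2, fun r => rfl⟩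
      left_inv := fun k => Subtype.ext (funext fun r => (key k.1 k.2 r).symm)
      right_inv := fun _ => rfl }
  simp only [cyc, Matrix.one_apply]
  have : ∀ k : ZMod n × ZMod n → H, (∏ r, if k r = k (shiftA n r) then (1 : ℂ) else 0) =
      if ∀ r, k r = k (shiftA n r) then 1 else 0 := fun k => by
    rw [Finset.prod_ite_zero]; simp
  simp only [this]
  rw [Finset.sum_boole, ← Fintype.card_subtype, Fintype.card_congr e, Fintype.card_fun, ZMod.card]
  push_cast; rfl

lemma cyc_shiftB_one (H : Type*) [Fintype H] [DecidableEq H] :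
    cyc (shiftB n) (fun _ => (1 : Matrix H H ℂ)) = (Fintype.card H : ℂ) ^ n := by
  rw [← cyc_shiftA_one (n := n) H, cyc, cyc]
  refine Fintype.sum_equiv (Equiv.arrowCongr (Equiv.prodComm _ _) (Equiv.refl H)) _ _ fun k => ?_
  rw [← Equiv.prod_comp (Equiv.prodComm (ZMod n) (ZMod n))]
  rfl

end Torus

/-! ### Invariances of contractions on the torus. -/

section TorusSum

variable {n : ℕ} [NeZero n] {ιA ιB : Type*} [Fintype ιA] [DecidableEq ιA] [Fintype ιB]
  [DecidableEq ιB] {S : Submodule (ZMod 2) (PLabel ιA × PLabel ιB)}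
  {ph : PLabel ιA × PLabel ιB → ℂ}

lemma amp_zero (h : IsPhase S ph) :
    amp ph (shiftA n) (shiftB n) 0 = (2 : ℂ) ^ ((Fintype.card ιA + Fintype.card ιB) * n) := by
  simp only [amp, Pi.zero_apply, h.zero, Prod.fst_zero, Prod.snd_zero, pmat_zero,
    cyc_shiftA_one, cyc_shiftB_one, Finset.prod_const_one, one_mul]
  simp only [Fintype.card_fun, Fintype.card_fin]
  push_cast
  rw [← pow_mul, ← pow_mul, ← pow_add, add_mul]

/-- Zero sums along the cycles of the first shift make `a` a difference p + p∘shift. Since elements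
of `A` are trivial on the second party, such a difference is a pure gauge. -/
lemma amp_add_zeroA (h : IsPhase S ph) {q : ZMod n × ZMod n → PLabel ιA × PLabel ιB}
    (hq : ∀ r, q r ∈ S) {A : Submodule (ZMod 2) (PLabel ιA × PLabel ιB)} (hAS : A ≤ S)
    (hA : ∀ a ∈ A, a.2 = 0) (a : ZMod n × ZMod n → A) (ha : ZeroA a) :
    amp ph (shiftA n) (shiftB n) (q + fun r => (a r : PLabel ιA × PLabel ιB)) =
      amp ph (shiftA n) (shiftB n) q := by
  choose p _ hp using fun j => exists_eq_add_shift (fun i => a (i, j)) (ha j)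
  have e : (fun r => (a r : PLabel ιA × PLabel ιB)) = (fun r => (p r.2 r.1).1) +
      fun r => (p r.2 (r.1 + 1)).1 := by
    funext r
    have := hp r.2 r.1
    simp [← Submodule.coe_add, ← this]
  rw [e]
  refine amp_add_gauge h hq (fun r => hAS (p r.2 r.1).2) (fun r => hAS (p r.2 (r.1 + 1)).2)
    (fun r => rfl) (fun r => ?_) ?_
  · rw [hA _ (p _ _).2, hA _ (p _ _).2]
  · exact Equiv.prod_comp (shiftA n) fun r => ph (p r.2 r.1).1

lemma amp_add_zeroB (h : IsPhase S ph) {q : ZMod n × ZMod n → PLabel ιA × PLabel ιB}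
    (hq : ∀ r, q r ∈ S) {B : Submodule (ZMod 2) (PLabel ιA × PLabel ιB)} (hBS : B ≤ S)
    (hB : ∀ b ∈ B, b.1 = 0) (b : ZMod n × ZMod n → B) (hb : ZeroB b) :
    amp ph (shiftA n) (shiftB n) (q + fun r => (b r : PLabel ιA × PLabel ιB)) =
      amp ph (shiftA n) (shiftB n) q := by
  choose p _ hp using fun i => exists_eq_add_shift (fun j => b (i, j)) (hb i)
  have e : (fun r => (b r : PLabel ιA × PLabel ιB)) = (fun r => (p r.1 r.2).1) +
      fun r => (p r.1 (r.2 + 1)).1 := by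
    funext r
    have := hp r.1 r.2
    simp [← Submodule.coe_add, ← this]
  rw [e]
  refine amp_add_gauge h hq (fun r => hBS (p r.1 r.2).2) (fun r => hBS (p r.1 (r.2 + 1)).2)
    (fun r => ?_) (fun r => rfl) ?_
  · rw [hB _ (p _ _).2, hB _ (p _ _).2]
  · exact Equiv.prod_comp (shiftB n) fun r => ph (p r.1 r.2).1

/-- A primitive of a Hankel function is again a function of i + j, so both shifts move it in the
same way: the neighbour's first and second components belong to one group element, and the labeling
is a pure gauge. -/
lemma amp_hankel (h : IsPhase S ph) {L : Submodule (ZMod 2) (PLabel ιA × PLabel ιB)} (hLS : L ≤ S)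
    (a : ZMod n × ZMod n → L) (ha : ZeroA a) (hH : IsHankel a) :
    amp ph (shiftA n) (shiftB n) (fun r => (a r : PLabel ιA × PLabel ιB)) =
      amp ph (shiftA n) (shiftB n) 0 := by
  obtain ⟨f, hf⟩ := hH
  have hf0 : ∑ i, f i = 0 := by simpa [hf] using ha 0
  obtain ⟨p, -, hp⟩ := exists_eq_add_shift f hf0
  have e : (fun r => (a r : PLabel ιA × PLabel ιB)) = 0 + ((fun r => (p (r.1 + r.2)).1) +
      fun r => (p (r.1 + r.2 + 1)).1) := by
    funext r
    simp [hf, hp]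
  rw [e]
  refine amp_add_gauge h (fun r => S.zero_mem) (fun r => hLS (p _).2) (fun r => hLS (p _).2)
    (fun r => ?_) (fun r => ?_) ?_
  · rw [shiftA_apply, add_right_comm]
  · rw [shiftB_apply, add_assoc]
  · rw [← Equiv.prod_comp (shiftA n) fun r => ph (p (r.1 + r.2)).1]
    refine Finset.prod_congr rfl fun r _ => ?_
    rw [shiftA_apply, add_right_comm]

/-- A function with zero sums in both directions is a second difference. -/
lemma exists_eq_diff₂ {Y : Type*} [AddCommGroup Y] [Module (ZMod 2) Y] (a : ZMod n × ZMod n → Y)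
    (hA : ZeroA a) (hB : ZeroB a) : ∃ p, a = diff₂ (shiftA n) (shiftB n) p := by
  -- Integrate along the first direction, starting from 0. This normalization and `ZeroB` give the
  -- primitive zero sums along the second direction, where it can be integrated again.
  choose u hu0 hu using fun j => exists_eq_add_shift (fun i => a (i, j)) (hA j)
  have hc : ∀ m : ℕ, ∑ j, u j (m : ZMod n) = 0 := by
    intro m
    induction m with
    | zero => simp [hu0]
    | succ m ih =>
      have h1 := hB (m : ZMod n)
      simp only [hu, Finset.sum_add_distrib, ih, zero_add] at h1
      push_cast
      exact h1
  choose p _ hp using fun i : ZMod n => exists_eq_add_shift (fun j => u j i) (by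
    have := hc i.val
    rwa [ZMod.natCast_zmod_val] at this)
  refine ⟨fun r => p r.1 r.2, funext fun r => ?_⟩
  have e := hu r.2 r.1
  have e1 := hp r.1 r.2
  have e2 := hp (r.1 + 1) r.2
  simp only [diff₂, shiftA_apply, shiftB_apply]
  rw [show a r = a (r.1, r.2) from rfl, e, e1, e2]
  abel

end TorusSum

/-! ### Summation over all labelings of the torus. -/

section TorusSum

variable {n : ℕ} [NeZero n] {ιA ιB : Type*} [Fintype ιA] [DecidableEq ιA] [Fintype ιB]
  [DecidableEq ιB]

/-- A splitting of a bipartite stabilizer group into its local parts `A` and `B`, an isotropic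
part `L`, and a part `L'` which is paired faithfully with `L`. -/
structure Splitting (S L L' A B : Submodule (ZMod 2) (PLabel ιA × PLabel ιB)) where
  /-- the decomposition as a direct sum -/
  e : (L × L' × A × B) ≃ₗ[ZMod 2] S
  e_apply : ∀ x, (e x : PLabel ιA × PLabel ιB) =
    (x.1 : PLabel ιA × PLabel ιB) + x.2.1 + x.2.2.1 + x.2.2.2
  memA : ∀ x, x ∈ A ↔ x ∈ S ∧ x.2 = 0
  memB : ∀ x, x ∈ B ↔ x ∈ S ∧ x.1 = 0
  isotropic : ∀ l ∈ L, ∀ l' ∈ L, psymp l.1 l'.1 = 0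
  faithful : ∀ x ∈ L', (∀ l ∈ L, psymp l.1 x.1 = 0) → x = 0

namespace Splitting

variable {S L L' A B : Submodule (ZMod 2) (PLabel ιA × PLabel ιB)}
  {ph : PLabel ιA × PLabel ιB → ℂ}

lemma le₁ (D : Splitting S L L' A B) : L ≤ S := fun x hx => by
  have := (D.e (⟨x, hx⟩, 0, 0, 0)).2
  rw [D.e_apply] at this
  simpa using this

lemma le₂ (D : Splitting S L L' A B) : L' ≤ S := fun x hx => by
  have := (D.e (0, ⟨x, hx⟩, 0, 0)).2
  rw [D.e_apply] at this
  simpa using this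

lemma leA (D : Splitting S L L' A B) : A ≤ S := fun x hx => ((D.memA x).1 hx).1

lemma leB (D : Splitting S L L' A B) : B ≤ S := fun x hx => ((D.memB x).1 hx).1

/-- An element trivial on the first party lies in `B`, and directness of the sum kills its other
coordinates. -/
lemma of_fst_eq_zero (D : Splitting S L L' A B) {x : L × L' × A × B}
    (hx : (D.e x : PLabel ιA × PLabel ιB).1 = 0) : x.1 = 0 ∧ x.2.1 = 0 ∧ x.2.2.1 = 0 := by
  have hB : (D.e x : PLabel ιA × PLabel ιB) ∈ B := (D.memB _).2 ⟨(D.e x).2, hx⟩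
  have : D.e x = D.e (0, 0, 0, ⟨_, hB⟩) := by
    apply Subtype.ext
    rw [D.e_apply (0, 0, 0, _)]
    simp
  have := D.e.injective this
  rw [this]
  simp

lemma of_snd_eq_zero (D : Splitting S L L' A B) {x : L × L' × A × B}
    (hx : (D.e x : PLabel ιA × PLabel ιB).2 = 0) : x.1 = 0 ∧ x.2.1 = 0 ∧ x.2.2.2 = 0 := by
  have hA : (D.e x : PLabel ιA × PLabel ιB) ∈ A := (D.memA _).2 ⟨(D.e x).2, hx⟩
  have : D.e x = D.e (0, 0, ⟨_, hA⟩, 0) := by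
    apply Subtype.ext
    rw [D.e_apply (0, 0, _, 0)]
    simp
  have := D.e.injective this
  rw [this]
  simp

/-- The contraction vanishes unless the labels have zero sums. -/
lemma zero_of_amp_ne_zero (D : Splitting S L L' A B) (x : ZMod n × ZMod n → L × L' × A × B)
    (h : amp ph (shiftA n) (shiftB n) (fun r => (D.e (x r) : PLabel ιA × PLabel ιB)) ≠ 0) :
    (ZeroA (fun r => (x r).1) ∧ ZeroB (fun r => (x r).1)) ∧
    (ZeroA (fun r => (x r).2.1) ∧ ZeroB (fun r => (x r).2.1)) ∧
    ZeroA (fun r => (x r).2.2.1) ∧ ZeroB (fun r => (x r).2.2.2) := by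
  rw [amp] at h
  have h2 := right_ne_zero_of_mul h
  -- Each line with fixed `j` is one cycle of the first shift, so a nonzero contraction forces the
  -- labels on it to add up to zero on the first party.
  have hA : ∀ j, (∑ i, x (i, j)).1 = 0 ∧ (∑ i, x (i, j)).2.1 = 0 ∧ (∑ i, x (i, j)).2.2.1 = 0 := by
    intro j
    apply D.of_fst_eq_zero
    have := sum_eq_zero_of_cyc_ne_zero (shiftA n) _ (Finset.univ.image fun i => (i, j))
      (fun r => by simp [shiftA_apply, Prod.ext_iff]) (left_ne_zero_of_mul h2)
    rw [Finset.sum_image (by intro a _ b _ hab; exact (Prod.ext_iff.1 hab).1)] at this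
    rw [map_sum, Submodule.coe_sum, Prod.fst_sum]
    exact this
  have hB : ∀ i, (∑ j, x (i, j)).1 = 0 ∧ (∑ j, x (i, j)).2.1 = 0 ∧ (∑ j, x (i, j)).2.2.2 = 0 := by
    intro i
    apply D.of_snd_eq_zero
    have := sum_eq_zero_of_cyc_ne_zero (shiftB n) _ (Finset.univ.image fun j => (i, j))
      (fun r => by simp [shiftB_apply, Prod.ext_iff]) (right_ne_zero_of_mul h2)
    rw [Finset.sum_image (by intro a _ b _ hab; exact (Prod.ext_iff.1 hab).2)] at this
    rw [map_sum, Submodule.coe_sum, Prod.snd_sum]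
    exact this
  simp only [Prod.fst_sum, Prod.snd_sum] at hA hB
  exact ⟨⟨fun j => (hA j).1, fun i => (hB i).1⟩, ⟨fun j => (hA j).2.1, fun i => (hB i).2.1⟩,
    fun j => (hA j).2.2, fun i => (hB i).2.2⟩

/-- The local parts are gauge directions, so only the `L` and `L'` parts matter. -/
lemma amp_eq (D : Splitting S L L' A B) (h : IsPhase S ph) (l : ZMod n × ZMod n → L)
    (l' : ZMod n × ZMod n → L') (a : ZMod n × ZMod n → A) (b : ZMod n × ZMod n → B)
    (ha : ZeroA a) (hb : ZeroB b) :
    amp ph (shiftA n) (shiftB n)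
      (fun r => (D.e (l r, l' r, a r, b r) : PLabel ιA × PLabel ιB)) =
    amp ph (shiftA n) (shiftB n)
      ((fun r => (l' r : PLabel ιA × PLabel ιB)) + fun r => (l r : PLabel ιA × PLabel ιB)) := by
  have e : (fun r => (D.e (l r, l' r, a r, b r) : PLabel ιA × PLabel ιB)) =
      (((fun r => (l' r : PLabel ιA × PLabel ιB)) + fun r => (l r : PLabel ιA × PLabel ιB)) +
        fun r => (a r : PLabel ιA × PLabel ιB)) + fun r => (b r : PLabel ιA × PLabel ιB) := by
    funext r
    rw [D.e_apply]
    simp only [Pi.add_apply]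
    abel
  have h1 : ∀ r, ((fun r => (l' r : PLabel ιA × PLabel ιB)) +
      fun r => (l r : PLabel ιA × PLabel ιB)) r ∈ S :=
    fun r => S.add_mem (D.le₂ (l' r).2) (D.le₁ (l r).2)
  have h2 : ∀ r, (((fun r => (l' r : PLabel ιA × PLabel ιB)) +
      fun r => (l r : PLabel ιA × PLabel ιB)) + fun r => (a r : PLabel ιA × PLabel ιB)) r ∈ S :=
    fun r => S.add_mem (h1 r) (D.leA (a r).2)
  rw [e, amp_add_zeroB h h2 D.leB (fun b hb => ((D.memB b).1 hb).2) b hb,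
    amp_add_zeroA h h1 D.leA (fun a ha => ((D.memA a).1 ha).2) a ha]

open Classical in
/-- The sum over the isotropic part. -/
lemma sum_amp (D : Splitting S L L' A B) (h : IsPhase S ph) (l' : ZMod n × ZMod n → L')
    (hl' : ZeroA l') :
    ∑ l : {l : ZMod n × ZMod n → L // ZeroA l ∧ ZeroB l}, amp ph (shiftA n) (shiftB n)
      ((fun r => (l' r : PLabel ιA × PLabel ιB)) + fun r => (l.1 r : PLabel ιA × PLabel ιB)) =
    if IsHankel l' then ((Nat.card {l : ZMod n × ZMod n → L // ZeroA l ∧ ZeroB l} : ℕ) : ℂ) *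
      amp ph (shiftA n) (shiftB n) 0 else 0 := by
  by_cases hH : IsHankel l'
  -- When `l'` is Hankel, l'(s r) + l'(t r) = 0, so translating by a second difference in `L`
  -- produces no sign. Every admissible `l` is such a difference, hence all terms are equal.
  · rw [if_pos hH, Nat.card_eq_fintype_card, ← amp_hankel h D.le₂ l' hl' hH, ← nsmul_eq_mul,
      ← Finset.card_univ]
    refine Finset.sum_eq_card_nsmul fun l _ => ?_
    obtain ⟨p, hp⟩ := exists_eq_diff₂ l.1 l.2.1 l.2.2
    have e : (fun r => (l.1 r : PLabel ιA × PLabel ιB)) =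
        diff₂ (shiftA n) (shiftB n) (fun r => (p r : PLabel ιA × PLabel ιB)) := by
      funext r
      rw [hp]
      simp [diff₂]
    rw [e]
    refine amp_add_diff₂ h shift_comm D.le₁ D.isotropic (fun r => D.le₂ (l' r).2) ?_ _
      (fun r => (p r).2)
    intro x _ r
    obtain ⟨f, hf⟩ := hH
    rw [hf, hf, shiftA_apply, shiftB_apply]
    simp only
    rw [add_right_comm, add_assoc, ZModModule.add_self, Prod.fst_zero, psymp_zero_right]
  · rw [if_neg hH]
    -- Otherwise some difference l'(s r₀) + l'(t r₀) is nonzero and, by faithfulness, pairs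
    -- nontrivially with an element `x` of `L`. Translation by the elementary second difference of
    -- `x` preserves the zero-sum conditions and flips the sign of every term, so the sum equals its
    -- own negative.
    obtain ⟨r₀, hr₀⟩ : ∃ r, l' (shiftA n r) ≠ l' (shiftB n r) := by
      by_contra hcon
      push Not at hcon
      exact hH (isHankel_of_shift hcon)
    obtain ⟨x, hxL, hx⟩ : ∃ x ∈ L, psymp x.1
        ((l' (shiftA n r₀) : PLabel ιA × PLabel ιB) + l' (shiftB n r₀)).1 ≠ 0 := by
      by_contra hcon
      push Not at hcon
      have := D.faithful _ (l' (shiftA n r₀) + l' (shiftB n r₀)).2 (by simpa using hcon)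
      rw [Submodule.coe_eq_zero, ← ZModModule.sub_eq_add, sub_eq_zero] at this
      exact hr₀ this
    set d : ZMod n × ZMod n → L := diff₂ (shiftA n) (shiftB n)
      (Pi.single (shiftA n (shiftB n r₀)) ⟨x, hxL⟩) with hd
    have hdA : ZeroA d := by
      intro j
      simp only [hd, diff₂, shiftA_apply, shiftB_apply, Finset.sum_add_distrib]
      have e : ∀ j : ZMod n, ∑ i, (Pi.single (r₀.1 + 1, r₀.2 + 1) ⟨x, hxL⟩ :
            ZMod n × ZMod n → L) (i + 1, j) =
          ∑ i, (Pi.single (r₀.1 + 1, r₀.2 + 1) ⟨x, hxL⟩ : ZMod n × ZMod n → L) (i, j) := fun j =>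
        Equiv.sum_comp (Equiv.addRight (1 : ZMod n)) fun i =>
          (Pi.single (r₀.1 + 1, r₀.2 + 1) ⟨x, hxL⟩ : ZMod n × ZMod n → L) (i, j)
      rw [e, e, ZModModule.add_self, ZModModule.add_self, add_zero]
    have hdB : ZeroB d := by
      intro i
      simp only [hd, diff₂, shiftA_apply, shiftB_apply, Finset.sum_add_distrib]
      have e : ∀ i : ZMod n, ∑ j, (Pi.single (r₀.1 + 1, r₀.2 + 1) ⟨x, hxL⟩ :
            ZMod n × ZMod n → L) (i, j + 1) =
          ∑ j, (Pi.single (r₀.1 + 1, r₀.2 + 1) ⟨x, hxL⟩ : ZMod n × ZMod n → L) (i, j) := fun i =>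
        Equiv.sum_comp (Equiv.addRight (1 : ZMod n)) fun j =>
          (Pi.single (r₀.1 + 1, r₀.2 + 1) ⟨x, hxL⟩ : ZMod n × ZMod n → L) (i, j)
      rw [e, e, ZModModule.add_self]
    have hdc : (fun r => (d r : PLabel ιA × PLabel ιB)) = diff₂ (shiftA n) (shiftB n)
        (Pi.single (shiftA n (shiftB n r₀)) x) := by
      funext r
      have : ∀ r, ((Pi.single (shiftA n (shiftB n r₀)) ⟨x, hxL⟩ : ZMod n × ZMod n → L) r :
          PLabel ιA × PLabel ιB) = (Pi.single (shiftA n (shiftB n r₀)) x : _ → _) r := by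
        intro r
        by_cases hr : r = shiftA n (shiftB n r₀)
        · subst hr; simp
        · rw [Pi.single_eq_of_ne hr, Pi.single_eq_of_ne hr]; rfl
      simp only [hd, diff₂, Submodule.coe_add, this]
    have hZ : ∀ {l : ZMod n × ZMod n → L}, ZeroA l ∧ ZeroB l → ZeroA (l + d) ∧ ZeroB (l + d) := by
      intro l hl
      constructor
      · intro j; simp [Finset.sum_add_distrib, hl.1 j, hdA j]
      · intro i; simp [Finset.sum_add_distrib, hl.2 i, hdB i]
    have hdd : ∀ l : ZMod n × ZMod n → L, l + d + d = l := fun l => by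
      rw [add_assoc, ZModModule.add_self, add_zero]
    set φ : {l : ZMod n × ZMod n → L // ZeroA l ∧ ZeroB l} ≃
        {l : ZMod n × ZMod n → L // ZeroA l ∧ ZeroB l} :=
      { toFun := fun l => ⟨l.1 + d, hZ l.2⟩
        invFun := fun l => ⟨l.1 + d, hZ l.2⟩
        left_inv := fun l => Subtype.ext (hdd l.1)
        right_inv := fun l => Subtype.ext (hdd l.1) } with hφ
    set F := fun l : {l : ZMod n × ZMod n → L // ZeroA l ∧ ZeroB l} =>
      amp ph (shiftA n) (shiftB n) ((fun r => (l' r : PLabel ιA × PLabel ιB)) +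
        fun r => (l.1 r : PLabel ιA × PLabel ιB)) with hF
    have key : ∀ l, F l = -F (φ l) := by
      intro l
      have h1 := amp_add_diff₂_single (s := shiftA n) (t := shiftB n) h shift_comm
        (q := (fun r => (l' r : PLabel ιA × PLabel ιB)) +
          fun r => (l.1 r : PLabel ιA × PLabel ιB))
        (fun r => S.add_mem (D.le₂ (l' r).2) (D.le₁ (l.1 r).2)) (D.le₁ hxL) r₀
      have h2 : sgn (psymp x.1 (((fun r => (l' r : PLabel ιA × PLabel ιB)) +
          fun r => (l.1 r : PLabel ιA × PLabel ιB)) (shiftA n r₀) +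
          ((fun r => (l' r : PLabel ιA × PLabel ιB)) +
          fun r => (l.1 r : PLabel ιA × PLabel ιB)) (shiftB n r₀)).1) = -1 := by
        have e : ((fun r => (l' r : PLabel ιA × PLabel ιB)) +
          fun r => (l.1 r : PLabel ιA × PLabel ιB)) (shiftA n r₀) +
          ((fun r => (l' r : PLabel ιA × PLabel ιB)) +
          fun r => (l.1 r : PLabel ιA × PLabel ιB)) (shiftB n r₀) =
          ((l' (shiftA n r₀) : PLabel ιA × PLabel ιB) + l' (shiftB n r₀)) +
          ((l.1 (shiftA n r₀) : PLabel ιA × PLabel ιB) + l.1 (shiftB n r₀)) := by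
          simp only [Pi.add_apply]; abel
        rw [e, Prod.fst_add, psymp_add_right, D.isotropic x hxL _
          (L.add_mem (l.1 _).2 (l.1 _).2), add_zero, sgn, if_neg hx]
      rw [h2, ← hdc, neg_one_mul] at h1
      simp only [hF, hφ, Equiv.coe_fn_mk]
      rw [h1]
      congr 2
      rw [add_assoc]
      congr 1
    have hsum : ∑ l, F l = -∑ l, F l := by
      conv_lhs => rw [Finset.sum_congr rfl fun l _ => key l]
      rw [Finset.sum_neg_distrib, Equiv.sum_comp φ F]
    exact self_eq_neg.1 hsum

open Classical in
set_option synthInstance.maxSize 1000 in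
/-- The sum of all contractions of a bipartite stabilizer group on the torus. -/
theorem sum_amp_torus (D : Splitting S L L' A B) (h : IsPhase S ph) :
    ∑ q : ZMod n × ZMod n → S,
      amp ph (shiftA n) (shiftB n) (fun r => (q r : PLabel ιA × PLabel ιB)) =
    ((Nat.card A ^ (n - 1)) ^ n * (Nat.card B ^ (n - 1)) ^ n *
      ((Nat.card L ^ (n - 1)) ^ (n - 1) * Nat.card L' ^ (n - 1)) : ℕ) *
      (2 : ℂ) ^ ((Fintype.card ιA + Fintype.card ιB) * n) := by
  set Φ : (ZMod n × ZMod n → L) → (ZMod n × ZMod n → L') → ℂ := fun l l' =>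
    amp ph (shiftA n) (shiftB n) ((fun r => (l' r : PLabel ιA × PLabel ιB)) +
      fun r => (l r : PLabel ιA × PLabel ιB)) with hΦ
  let E : ((ZMod n × ZMod n → L) × (ZMod n × ZMod n → L') ×
      (ZMod n × ZMod n → A) × (ZMod n × ZMod n → B)) ≃ (ZMod n × ZMod n → S) :=
    { toFun := fun x r => D.e (x.1 r, x.2.1 r, x.2.2.1 r, x.2.2.2 r)
      invFun := fun q => (fun r => (D.e.symm (q r)).1, fun r => (D.e.symm (q r)).2.1,
        fun r => (D.e.symm (q r)).2.2.1, fun r => (D.e.symm (q r)).2.2.2)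
      left_inv := fun x => by simp
      right_inv := fun q => by simp }
  -- The zero-sum conditions can be inserted as indicators since other terms vanish; once they hold,
  -- the dependence on `a` and `b` disappears and the sums over them become cardinalities.
  have hterm : ∀ l l' a b, amp ph (shiftA n) (shiftB n)
      (fun r => (D.e (l r, l' r, a r, b r) : PLabel ιA × PLabel ιB)) =
      ((if ZeroA a then 1 else 0) * (if ZeroB b then 1 else 0)) *
        ((if ZeroA l' ∧ ZeroB l' then 1 else 0) * ((if ZeroA l ∧ ZeroB l then 1 else 0) *
          Φ l l')) := by
    intro l l' a b
    by_cases hz : amp ph (shiftA n) (shiftB n)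
      (fun r => (D.e (l r, l' r, a r, b r) : PLabel ιA × PLabel ιB)) = 0
    · by_cases ha : ZeroA a
      · by_cases hb : ZeroB b
        · have : Φ l l' = 0 := by
            rw [hΦ, ← hz]; exact (D.amp_eq h l l' a b ha hb).symm
          rw [hz, this]; simp
        · rw [hz, if_neg hb]; simp
      · rw [hz, if_neg ha]; simp
    · obtain ⟨h1, h2, h3, h4⟩ := D.zero_of_amp_ne_zero _ hz
      rw [if_pos h1, if_pos h2, if_pos h3, if_pos h4, D.amp_eq h l l' a b h3 h4]
      simp [hΦ]
  have hcard : ∀ {Y : Type _} [Fintype Y] (P : Y → Prop),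
      ∑ y, (if P y then (1 : ℂ) else 0) = (Nat.card {y // P y} : ℂ) := by
    intro Y _ P
    rw [Finset.sum_boole, ← Fintype.card_subtype, Nat.card_eq_fintype_card]
  have hl : ∀ l', (ZeroA l' ∧ ZeroB l') → ∑ l, (if ZeroA l ∧ ZeroB l then 1 else 0) * Φ l l' =
      if IsHankel l' then ((Nat.card {l : ZMod n × ZMod n → L // ZeroA l ∧ ZeroB l} : ℕ) : ℂ) *
      amp ph (shiftA n) (shiftB n) 0 else 0 := by
    intro l' hl'
    rw [← D.sum_amp h l' hl'.1]
    simp only [ite_mul, one_mul, zero_mul]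
    rw [← Finset.sum_filter]
    exact Finset.sum_subtype _ (fun l => by simp) _
  have hreindex : ∑ q : ZMod n × ZMod n → S,
      amp ph (shiftA n) (shiftB n) (fun r => (q r : PLabel ιA × PLabel ιB)) =
      ∑ l : ZMod n × ZMod n → L, ∑ l' : ZMod n × ZMod n → L', ∑ a : ZMod n × ZMod n → A,
        ∑ b : ZMod n × ZMod n → B, amp ph (shiftA n) (shiftB n)
        (fun r => (D.e (l r, l' r, a r, b r) : PLabel ιA × PLabel ιB)) := by
    rw [← Equiv.sum_comp E]
    simp only [Fintype.sum_prod_type]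
    congr!
  rw [hreindex]
  simp only [hterm]
  have hab : ∀ K : ℂ, ∑ a : ZMod n × ZMod n → A, ∑ b : ZMod n × ZMod n → B,
      ((if ZeroA a then (1 : ℂ) else 0) * (if ZeroB b then 1 else 0)) * K =
      ((Nat.card A ^ (n - 1)) ^ n * (Nat.card B ^ (n - 1)) ^ n : ℕ) * K := by
    intro K
    rw [← card_zeroA, ← card_zeroB, Nat.cast_mul, ← hcard, ← hcard, Finset.sum_mul_sum,
      Finset.sum_mul]
    exact Finset.sum_congr rfl fun a _ => by rw [Finset.sum_mul]
  simp only [hab]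
  have hswap : ∑ l, ∑ l', (if ZeroA l' ∧ ZeroB l' then (1 : ℂ) else 0) *
      ((if ZeroA l ∧ ZeroB l then 1 else 0) * Φ l l') =
      (Nat.card {l' : ZMod n × ZMod n → L' // (ZeroA l' ∧ ZeroB l') ∧ IsHankel l'} : ℂ) *
      (((Nat.card {l : ZMod n × ZMod n → L // ZeroA l ∧ ZeroB l} : ℕ) : ℂ) *
        amp ph (shiftA n) (shiftB n) 0) := by
    rw [Finset.sum_comm, ← hcard, Finset.sum_mul]
    refine Finset.sum_congr rfl fun l' _ => ?_
    rw [← Finset.mul_sum]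
    by_cases hl' : ZeroA l' ∧ ZeroB l'
    · rw [hl l' hl', if_pos hl', one_mul]
      by_cases hH : IsHankel l'
      · rw [if_pos hH, if_pos ⟨hl', hH⟩, one_mul]
      · rw [if_neg hH, if_neg (fun h => hH h.2), zero_mul]
    · rw [if_neg hl', if_neg (fun h => hl' h.1), zero_mul, zero_mul]
  have hmul : ∀ K : ℂ, ∑ l, ∑ l', K * ((if ZeroA l' ∧ ZeroB l' then (1 : ℂ) else 0) *
      ((if ZeroA l ∧ ZeroB l then 1 else 0) * Φ l l')) = K * ∑ l, ∑ l',
        (if ZeroA l' ∧ ZeroB l' then (1 : ℂ) else 0) *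
          ((if ZeroA l ∧ ZeroB l then 1 else 0) * Φ l l') := by
    intro K
    rw [Finset.mul_sum]
    exact Finset.sum_congr rfl fun a _ => by rw [Finset.mul_sum]
  rw [hmul, hswap, card_isHankel, card_zeroA_zeroB, amp_zero h]
  push_cast
  ring

end Splitting

end TorusSum

/-! ### Isotropic subspaces -/

open Module in
/-- A maximal isotropic subspace of `S` that contains a given subspace of the radical. -/
lemma exists_maximal_isotropic {V : Type*} [AddCommGroup V] [Module (ZMod 2) V] [Finite V]
    (ω : LinearMap.BilinForm (ZMod 2) V) (halt : ∀ x, ω x x = 0) (hsymm : ∀ x y, ω x y = ω y x)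
    {S R : Submodule (ZMod 2) V} (hRS : R ≤ S) (hR : ∀ x ∈ R, ∀ y ∈ S, ω x y = 0) :
    ∃ M : Submodule (ZMod 2) V, R ≤ M ∧ M ≤ S ∧ (∀ x ∈ M, ∀ y ∈ M, ω x y = 0) ∧
      (∀ x ∈ S, (∀ y ∈ M, ω y x = 0) → x ∈ M) ∧
      2 * finrank (ZMod 2) M = finrank (ZMod 2) S +
        finrank (ZMod 2) (S ⊓ ω.orthogonal S : Submodule (ZMod 2) V) := by
  have hfin : {M : Submodule (ZMod 2) V | R ≤ M ∧ M ≤ S ∧ ∀ x ∈ M, ∀ y ∈ M, ω x y = 0}.Finite :=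
    Set.toFinite _
  obtain ⟨M, ⟨hRM, hMS, hM⟩, hmax⟩ := hfin.exists_maximal ⟨R, le_rfl, hRS, fun x hx y hy =>
    hR x hx y (hRS hy)⟩
  have hmem : ∀ x ∈ S, (∀ y ∈ M, ω y x = 0) → x ∈ M := by
    intro x hx hxM
    have hle : M ⊔ Submodule.span (ZMod 2) {x} ≤ M := hmax
      ⟨hRM.trans le_sup_left, sup_le hMS (by simpa using hx), by
        intro y hy z hz
        obtain ⟨y₁, hy₁, y₂, hy₂, rfl⟩ := Submodule.mem_sup.1 hy
        obtain ⟨z₁, hz₁, z₂, hz₂, rfl⟩ := Submodule.mem_sup.1 hz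
        obtain ⟨c, rfl⟩ := Submodule.mem_span_singleton.1 hy₂
        obtain ⟨d, rfl⟩ := Submodule.mem_span_singleton.1 hz₂
        simp [hM _ hy₁ _ hz₁, hxM _ hy₁, hsymm x, hxM _ hz₁, halt]⟩ le_sup_left
    exact hle (Submodule.mem_sup_right (Submodule.mem_span_singleton_self x))
  refine ⟨M, hRM, hMS, hM, hmem, ?_⟩
  set W := M.comap S.subtype with hW
  have hWM : finrank (ZMod 2) W = finrank (ZMod 2) M :=
    (Submodule.comapSubtypeEquivOfLe hMS).finrank_eq
  -- Maximality makes `M` its own orthogonal complement inside `S`; in particular it contains the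
  -- radical. The dimension formula for the possibly degenerate restricted form then determines dim
  -- M.
  have horth : (ω.restrict S).orthogonal W = W := by
    ext x
    rw [LinearMap.BilinForm.mem_orthogonal_iff]
    constructor
    · intro hx
      refine hmem _ x.2 fun y hy => ?_
      exact hx ⟨y, hMS hy⟩ hy
    · intro hx y hy
      exact hM _ hy _ hx
  have hker : W ⊓ (ω.restrict S).ker = (S ⊓ ω.orthogonal S).comap S.subtype := by
    ext x
    simp only [Submodule.mem_inf, LinearMap.mem_ker, Submodule.mem_comap, Submodule.subtype_apply,
      LinearMap.BilinForm.mem_orthogonal_iff]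
    constructor
    · rintro ⟨_, hx⟩
      refine ⟨x.2, fun y hy => ?_⟩
      have := LinearMap.congr_fun hx ⟨y, hy⟩
      rw [hsymm]
      exact this
    · rintro ⟨_, hx⟩
      refine ⟨hmem _ x.2 fun y hy => hx y (hMS hy), ?_⟩
      ext y
      have := hx y y.2
      rw [hsymm] at this
      exact this
  have key := LinearMap.BilinForm.finrank_add_finrank_orthogonal' (B := ω.restrict S) W
  rw [horth, hker, hWM, (Submodule.comapSubtypeEquivOfLe inf_le_left).finrank_eq] at key
  rw [two_mul, key]

/-- Relative complements of subspaces. -/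
lemma exists_relative_compl {V : Type*} [AddCommGroup V] [Module (ZMod 2) V]
    {P R : Submodule (ZMod 2) V} (h : P ≤ R) :
    ∃ C : Submodule (ZMod 2) V, C ≤ R ∧ P ⊔ C = R ∧ P ⊓ C = ⊥ := by
  obtain ⟨C, hC⟩ := Submodule.exists_isCompl P
  refine ⟨C ⊓ R, inf_le_right, ?_, ?_⟩
  · rw [← sup_inf_assoc_of_le C h, hC.sup_eq_top, top_inf_eq]
  · rw [← inf_assoc, hC.inf_eq_bot, bot_inf_eq]

section Forms

variable (ι : Type*) [Fintype ι]

/-- The commutation form as a bilinear form. -/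
def psympForm : LinearMap.BilinForm (ZMod 2) (PLabel ι) :=
  LinearMap.mk₂ (ZMod 2) psymp
    (fun v v' w => by rw [psymp_comm, psymp_add_right, psymp_comm w v, psymp_comm w v'])
    (fun c v w => by rw [psymp_smul_left, smul_eq_mul])
    psymp_add_right
    (fun c v w => by rw [psymp_comm, psymp_smul_left, smul_eq_mul, psymp_comm])

end Forms

/-! ### The splitting of a bipartite stabilizer group. -/

section Bipartite

variable {ιA ιB : Type*} [Fintype ιA] [DecidableEq ιA] [Fintype ιB] [DecidableEq ιB]

/-- The elements supported on the first party. -/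
def localA (S : Submodule (ZMod 2) (PLabel ιA × PLabel ιB)) :
    Submodule (ZMod 2) (PLabel ιA × PLabel ιB) :=
  S ⊓ LinearMap.ker (LinearMap.snd (ZMod 2) (PLabel ιA) (PLabel ιB))

/-- The elements supported on the second party. -/
def localB (S : Submodule (ZMod 2) (PLabel ιA × PLabel ιB)) :
    Submodule (ZMod 2) (PLabel ιA × PLabel ιB) :=
  S ⊓ LinearMap.ker (LinearMap.fst (ZMod 2) (PLabel ιA) (PLabel ιB))

lemma mem_localA {S : Submodule (ZMod 2) (PLabel ιA × PLabel ιB)} {x : PLabel ιA × PLabel ιB} :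
    x ∈ localA S ↔ x ∈ S ∧ x.2 = 0 := Iff.rfl

lemma mem_localB {S : Submodule (ZMod 2) (PLabel ιA × PLabel ιB)} {x : PLabel ιA × PLabel ιB} :
    x ∈ localB S ↔ x ∈ S ∧ x.1 = 0 := Iff.rfl

/-- The commutation form of the first party. -/
def formA (ιA ιB : Type*) [Fintype ιA] : LinearMap.BilinForm (ZMod 2) (PLabel ιA × PLabel ιB) :=
  (psympForm ιA).compl₁₂ (LinearMap.fst (ZMod 2) (PLabel ιA) (PLabel ιB))
    (LinearMap.fst (ZMod 2) (PLabel ιA) (PLabel ιB))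

@[simp] lemma formA_apply (v w : PLabel ιA × PLabel ιB) : formA ιA ιB v w = psymp v.1 w.1 := rfl

-- Local elements are in the radical of the form of the first party on `S`: for those on the first
-- party this is read off from the second one, where the form agrees. Extend the local part to a
-- maximal isotropic `M`; take `L` to complement the local part in `M`, and `L'` to complement `M`
-- in `S`. An element of `L'` orthogonal to `L` is orthogonal to `M`, hence in M ∩ L' = 0. The last
-- identity is 2 dim M = dim S + dim(radical) with dim M and dim S expanded.
open Module in
theorem exists_splitting {S : Submodule (ZMod 2) (PLabel ιA × PLabel ιB)}
    {ph : PLabel ιA × PLabel ιB → ℂ} (h : IsPhase S ph) :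
    ∃ L L' : Submodule (ZMod 2) (PLabel ιA × PLabel ιB),
      Nonempty (Splitting S L L' (localA S) (localB S)) ∧
      finrank (ZMod 2) L + finrank (ZMod 2) L' + finrank (ZMod 2) (localA S) +
        finrank (ZMod 2) (localB S) = finrank (ZMod 2) S ∧
      finrank (ZMod 2) L + finrank (ZMod 2) (localA S) + finrank (ZMod 2) (localB S) =
        finrank (ZMod 2) L' + finrank (ZMod 2) (S ⊓ (formA ιA ιB).orthogonal S :
          Submodule (ZMod 2) (PLabel ιA × PLabel ιB)) := by
  have hA0 : ∀ a ∈ localA S, ∀ y ∈ S, psymp a.1 y.1 = 0 := fun a ha y hy => by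
    rw [h.psymp_eq ha.1 hy, (mem_localA.1 ha).2, psymp_comm, psymp_zero_right]
  have hB0 : ∀ b ∈ localB S, ∀ y ∈ S, psymp b.1 y.1 = 0 := fun b hb y hy => by
    rw [(mem_localB.1 hb).2, psymp_comm, psymp_zero_right]
  have hAB : localA S ⊓ localB S = ⊥ := by
    rw [eq_bot_iff]
    rintro x ⟨hx, hx'⟩
    exact Prod.ext (mem_localB.1 hx').2 (mem_localA.1 hx).2
  obtain ⟨M, hRM, hMS, hM, hmax, hdim⟩ := exists_maximal_isotropic (formA ιA ιB)
    (fun x => by simp) (fun x y => by simp [psymp_comm])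
    (R := localA S ⊔ localB S) (S := S) (sup_le inf_le_left inf_le_left) (by
      intro x hx y hy
      obtain ⟨a, ha, b, hb, rfl⟩ := Submodule.mem_sup.1 hx
      simp only [map_add, LinearMap.add_apply, formA_apply, hA0 a ha y hy, hB0 b hb y hy, add_zero])
  obtain ⟨L, hLM, hL1, hL2⟩ := exists_relative_compl hRM
  obtain ⟨L', hLS, hL1', hL2'⟩ := exists_relative_compl hMS
  have hd1 := Submodule.finrank_sup_add_finrank_inf_eq (localA S) (localB S)
  have hd2 := Submodule.finrank_sup_add_finrank_inf_eq (localA S ⊔ localB S) L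
  have hd3 := Submodule.finrank_sup_add_finrank_inf_eq M L'
  rw [hAB, finrank_bot] at hd1
  rw [hL1, hL2, finrank_bot] at hd2
  rw [hL1', hL2', finrank_bot] at hd3
  refine ⟨L, L', ⟨?_⟩, by omega, by omega⟩
  let f : (L × L' × localA S × localB S) →ₗ[ZMod 2] PLabel ιA × PLabel ιB :=
    L.subtype.coprod (L'.subtype.coprod ((localA S).subtype.coprod (localB S).subtype))
  have hf : ∀ x, f x = (x.1 : PLabel ιA × PLabel ιB) + x.2.1 + x.2.2.1 + x.2.2.2 := fun x => by
    simp only [f, LinearMap.coprod_apply, Submodule.subtype_apply]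
    abel
  have hinj : Function.Injective f := by
    rw [← LinearMap.ker_eq_bot, eq_bot_iff]
    rintro ⟨l, l', a, b⟩ hx
    rw [LinearMap.mem_ker, hf] at hx
    have hab : (a : PLabel ιA × PLabel ιB) + b ∈ localA S ⊔ localB S :=
      Submodule.add_mem_sup a.2 b.2
    have hl' : (l' : PLabel ιA × PLabel ιB) ∈ M ⊓ L' := by
      refine ⟨?_, l'.2⟩
      have : (l' : PLabel ιA × PLabel ιB) = -((l : PLabel ιA × PLabel ιB) + (a + b)) := by
        rw [eq_neg_iff_add_eq_zero, ← hx]; abel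
      rw [this]
      exact M.neg_mem (M.add_mem (hLM l.2) (hRM hab))
    rw [hL2', Submodule.mem_bot] at hl'
    have hl : (l : PLabel ιA × PLabel ιB) ∈ (localA S ⊔ localB S) ⊓ L := by
      refine ⟨?_, l.2⟩
      have : (l : PLabel ιA × PLabel ιB) = -((a : PLabel ιA × PLabel ιB) + b) := by
        rw [eq_neg_iff_add_eq_zero, ← hx, hl']; abel
      rw [this]
      exact Submodule.neg_mem _ hab
    rw [hL2, Submodule.mem_bot] at hl
    have ha : (a : PLabel ιA × PLabel ιB) ∈ localA S ⊓ localB S := by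
      refine ⟨a.2, ?_⟩
      have : (a : PLabel ιA × PLabel ιB) = -(b : PLabel ιA × PLabel ιB) := by
        rw [eq_neg_iff_add_eq_zero, ← hx, hl', hl]; abel
      rw [this]
      exact Submodule.neg_mem _ b.2
    rw [hAB, Submodule.mem_bot] at ha
    have hb : (b : PLabel ιA × PLabel ιB) = 0 := by
      rw [← hx, hl', hl, ha]; abel
    rw [Submodule.mem_bot]
    exact Prod.ext (Subtype.ext hl) (Prod.ext (Subtype.ext hl')
      (Prod.ext (Subtype.ext ha) (Subtype.ext hb)))
  have hrange : LinearMap.range f = S := by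
    simp only [f, LinearMap.range_coprod, Submodule.range_subtype]
    refine Eq.trans ?_ hL1'
    rw [← hL1]
    ac_rfl
  refine
    { e := (LinearEquiv.ofInjective f hinj).trans (LinearEquiv.ofEq _ _ hrange)
      e_apply := fun x => hf x
      memA := fun x => mem_localA
      memB := fun x => mem_localB
      isotropic := fun l hl l' hl' => hM l (hLM hl) l' (hLM hl')
      faithful := ?_ }
  intro x hx hxL
  have hxM : x ∈ M ⊓ L' := by
    refine ⟨hmax x (hLS hx) fun y hy => ?_, hx⟩
    rw [← hL1] at hy
    obtain ⟨z, hz, l, hl, rfl⟩ := Submodule.mem_sup.1 hy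
    obtain ⟨a, ha, b, hb, rfl⟩ := Submodule.mem_sup.1 hz
    simp only [map_add, LinearMap.add_apply, formA_apply, hA0 a ha x (hLS hx),
      hB0 b hb x (hLS hx), hxL l hl, add_zero]
  rwa [hL2', Submodule.mem_bot] at hxM

end Bipartite

/-! ### Reflected entropy -/

/-- Functional calculus of a multiple of a projection. -/
lemma cfc_of_mul_self {m : Type*} [Fintype m] [DecidableEq m] [Nonempty m] {ρ : Matrix m m ℂ}
    (hρ : ρ.conjTranspose = ρ) {c : ℝ} (hc : 0 < c) (h : ρ * ρ = c • ρ) {f : ℝ → ℝ} (hf : f 0 = 0) :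
    cfc f ρ = (f c / c) • ρ := by
  have hsa : IsSelfAdjoint ρ := hρ
  -- The spectrum lies in {0, c}, where `f` agrees with the linear function of slope f(c)/c.
  have hspec : ∀ x ∈ spectrum ℝ ρ, x = 0 ∨ x = c := by
    intro x hx
    have h1 := spectrum.subset_polynomial_aeval ρ
      (Polynomial.X * Polynomial.X - Polynomial.C c * Polynomial.X) ⟨x, hx, rfl⟩
    have h2 : Polynomial.aeval ρ (Polynomial.X * Polynomial.X - Polynomial.C c * Polynomial.X) =
        0 := by
      simp [h, Algebra.algebraMap_eq_smul_one]
    rw [h2, spectrum.zero_eq] at h1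
    have h3 : x * x - c * x = 0 := by simpa using h1
    have h4 : x * (x - c) = 0 := by linarith
    rcases mul_eq_zero.1 h4 with h | h
    · exact Or.inl h
    · exact Or.inr (by linarith)
  rw [← cfc_const_mul_id (f c / c) ρ (by exact hsa)]
  refine cfc_congr fun x hx => ?_
  rcases hspec x hx with rfl | rfl
  · simp [hf]
  · field_simp

/-- The spectrum is flat: all weight sits at the eigenvalue `c`, so the entropy is the logarithm of
1/c. -/
lemma vonNeumann_of_mul_self {m : Type} [Fintype m] [DecidableEq m] [Nonempty m]
    {ρ : Matrix m m ℂ} (hρ : ρ.conjTranspose = ρ) {c : ℝ} (hc : 0 < c) (h : ρ * ρ = c • ρ)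
    (htr : ρ.trace = 1) : vonNeumann ρ = -Real.logb 2 c := by
  rw [vonNeumann, cfc_of_mul_self hρ hc h (by simp), Matrix.mul_smul, h, smul_smul,
    div_mul_cancel₀ _ hc.ne', Matrix.trace_smul, htr]
  simp

lemma sum_pmat_mul_conj {ι : Type*} [Fintype ι] [DecidableEq ι] (v w : PLabel ι) :
    ∑ x : (ι → Fin 2) × (ι → Fin 2), pmat v x.1 x.2 * conj (pmat w x.1 x.2) =
      if v = w then (2 : ℂ) ^ Fintype.card ι else 0 := by
  rw [← pmat_trace_mul, Matrix.trace, Fintype.sum_prod_type]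
  refine Finset.sum_congr rfl fun x _ => ?_
  rw [Matrix.diag_apply, Matrix.mul_apply]
  exact Finset.sum_congr rfl fun y _ => by rw [pmat_conj]

section Reflected

variable {ιA ιB : Type} [Fintype ιA] [DecidableEq ιA] [Fintype ιB] [DecidableEq ιB]
  {S : Submodule (ZMod 2) (PLabel ιA × PLabel ιB)} {ph : PLabel ιA × PLabel ιB → ℂ}

open Classical in
/-- The elements of a submodule as a finset. -/
def elems {V : Type*} [Fintype V] [AddCommGroup V] [Module (ZMod 2) V]
    (S : Submodule (ZMod 2) V) : Finset V := Finset.univ.filter (· ∈ S)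

@[simp] lemma mem_elems {V : Type*} [Fintype V] [AddCommGroup V] [Module (ZMod 2) V]
    {S : Submodule (ZMod 2) V} {v : V} : v ∈ elems S ↔ v ∈ S := by simp [elems]

lemma card_elems {V : Type*} [Fintype V] [AddCommGroup V] [Module (ZMod 2) V]
    (S : Submodule (ZMod 2) V) : (elems S).card = Nat.card S := by
  classical
  rw [elems, ← Fintype.card_subtype, Nat.card_eq_fintype_card]

lemma sum_elems_snd {v : PLabel ιA × PLabel ιB} (hv : v ∈ S) (f : PLabel ιA × PLabel ιB → ℂ) :
    ∑ w ∈ elems S, (if v.2 = w.2 then f w else 0) = ∑ a ∈ elems (localA S), f (v + a) := by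
  rw [← Finset.sum_filter]
  have h2 : ∀ w : PLabel ιA × PLabel ιB, v + (v + w) = w := fun w => by
    rw [← add_assoc, ZModModule.add_self, zero_add]
  refine Finset.sum_nbij' (fun w => v + w) (fun a => v + a) ?_ ?_ (fun w _ => h2 w)
    (fun a _ => h2 a) (fun w _ => by rw [h2])
  · intro w hw
    simp only [Finset.mem_filter, mem_elems] at hw
    rw [mem_elems, mem_localA]
    exact ⟨S.add_mem hv hw.1, by rw [Prod.snd_add, hw.2, plabel_add_self]⟩
  · intro a ha
    rw [mem_elems, mem_localA] at ha
    simp only [Finset.mem_filter, mem_elems]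
    exact ⟨S.add_mem hv ha.1, by rw [Prod.snd_add, ha.2, add_zero]⟩

lemma sum_elems_fst {v : PLabel ιA × PLabel ιB} (hv : v ∈ S) (f : PLabel ιA × PLabel ιB → ℂ) :
    ∑ w ∈ elems S, (if v.1 = w.1 then f w else 0) = ∑ b ∈ elems (localB S), f (v + b) := by
  rw [← Finset.sum_filter]
  have h2 : ∀ w : PLabel ιA × PLabel ιB, v + (v + w) = w := fun w => by
    rw [← add_assoc, ZModModule.add_self, zero_add]
  refine Finset.sum_nbij' (fun w => v + w) (fun a => v + a) ?_ ?_ (fun w _ => h2 w)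
    (fun a _ => h2 a) (fun w _ => by rw [h2])
  · intro w hw
    simp only [Finset.mem_filter, mem_elems] at hw
    rw [mem_elems, mem_localB]
    exact ⟨S.add_mem hv hw.1, by rw [Prod.fst_add, hw.2, plabel_add_self]⟩
  · intro a ha
    rw [mem_elems, mem_localB] at ha
    simp only [Finset.mem_filter, mem_elems]
    exact ⟨S.add_mem hv ha.1, by rw [Prod.fst_add, ha.2, add_zero]⟩

/-- The phase of merging `b` lives on the second party and does not see `a`, so the two factors ph(v
+ a) square away. -/
lemma IsPhase.mul_mul (h : IsPhase S ph) {v a b : PLabel ιA × PLabel ιB} (hv : v ∈ S)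
    (ha : a ∈ localA S) (hb : b ∈ localB S) :
    ph v * ph (v + a) * ph (v + a + b) = ph (v + b) := by
  obtain ⟨haS, ha2⟩ := mem_localA.1 ha
  obtain ⟨hbS, hb1⟩ := mem_localB.1 hb
  rw [h.add (v + a) (S.add_mem hv haS) b hbS, h.add v hv b hbS, hb1, Prod.snd_add, ha2, add_zero]
  have := h.mul_self (S.add_mem hv haS)
  simp only [Prod.fst_add, pphase_zero_right]
  linear_combination (ph v * ph b * pphase v.2 b.2) * this

lemma IsPhase.conj_eq (h : IsPhase S ph) {v : PLabel ιA × PLabel ιB} (hv : v ∈ S) :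
    conj (ph v) = ph v := by
  rcases h.one_or v hv with h | h <;> rw [h] <;> simp

/-- The realigned sum of the operators in a bipartite stabilizer group. -/
def realigned (S : Submodule (ZMod 2) (PLabel ιA × PLabel ιB)) (ph : PLabel ιA × PLabel ιB → ℂ) :
    Matrix ((ιA → Fin 2) × (ιA → Fin 2)) ((ιB → Fin 2) × (ιB → Fin 2)) ℂ :=
  Matrix.of fun x z => ∑ v ∈ elems S, ph v * (pmat v.1 x.1 x.2 * pmat v.2 z.1 z.2)

/-- Summing over both labels of the second party is a Hilbert–Schmidt product of Pauli strings. It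
keeps the pairs with equal second components, which differ by an element of `localA S`. -/
lemma realigned_mul_conjTranspose (h : IsPhase S ph) (x y : (ιA → Fin 2) × (ιA → Fin 2)) :
    (realigned S ph * (realigned S ph).conjTranspose) x y =
      2 ^ Fintype.card ιB * ∑ v ∈ elems S, ∑ a ∈ elems (localA S),
        ph v * ph (v + a) * (pmat v.1 x.1 x.2 * conj (pmat (v + a).1 y.1 y.2)) := by
  rw [Matrix.mul_apply]
  simp only [Matrix.conjTranspose_apply, realigned, Matrix.of_apply, star_sum, Finset.sum_mul_sum]
  rw [Finset.sum_comm, Finset.mul_sum]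
  refine Finset.sum_congr rfl fun v hv => ?_
  rw [mem_elems] at hv
  rw [Finset.sum_comm, ← sum_elems_snd hv
    (fun w => ph v * ph w * (pmat v.1 x.1 x.2 * conj (pmat w.1 y.1 y.2))), Finset.mul_sum]
  refine Finset.sum_congr rfl fun w hw => ?_
  rw [mem_elems] at hw
  have : ∀ z : (ιB → Fin 2) × (ιB → Fin 2), ph v * (pmat v.1 x.1 x.2 * pmat v.2 z.1 z.2) *
      star (ph w * (pmat w.1 y.1 y.2 * pmat w.2 z.1 z.2)) =
      (ph v * ph w * (pmat v.1 x.1 x.2 * conj (pmat w.1 y.1 y.2))) *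
        (pmat v.2 z.1 z.2 * conj (pmat w.2 z.1 z.2)) := by
    intro z
    rw [show star (ph w * (pmat w.1 y.1 y.2 * pmat w.2 z.1 z.2)) =
      conj (ph w * (pmat w.1 y.1 y.2 * pmat w.2 z.1 z.2)) from rfl, map_mul, map_mul, h.conj_eq hw]
    ring
  simp only [this]
  rw [← Finset.mul_sum, sum_pmat_mul_conj]
  split_ifs <;> ring

/-- A second orthogonality relation, now on the first party, leaves triples v, v + a, v + a + b with
`a`, `b` local. Their signs combine to ph(v + b), and v ↦ v + b permutes `S`, so each pair (a, b)
reproduces the realigned matrix once. -/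
lemma realigned_cube (h : IsPhase S ph) :
    realigned S ph * (realigned S ph).conjTranspose * realigned S ph =
      ((2 : ℂ) ^ (Fintype.card ιA + Fintype.card ιB) * (Nat.card (localA S) * Nat.card (localB S))) •
        realigned S ph := by
  ext x z
  rw [Matrix.mul_apply]
  simp only [realigned_mul_conjTranspose h]
  have h1 : ∀ v ∈ elems S, ∀ a ∈ elems (localA S), ∑ y : (ιA → Fin 2) × (ιA → Fin 2),
      ph v * ph (v + a) * (pmat v.1 x.1 x.2 * conj (pmat (v + a).1 y.1 y.2)) *
        realigned S ph y z = 2 ^ Fintype.card ιA * ∑ b ∈ elems (localB S),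
          ph (v + b) * (pmat (v + b).1 x.1 x.2 * pmat (v + b).2 z.1 z.2) := by
    intro v hv a ha
    rw [mem_elems] at hv ha
    have haS := (mem_localA.1 ha).1
    have hva : v + a ∈ S := S.add_mem hv haS
    have e : ∀ b ∈ elems (localB S), ph (v + b) * (pmat (v + b).1 x.1 x.2 * pmat (v + b).2 z.1 z.2) =
        ph v * ph (v + a) * ph (v + a + b) * (pmat v.1 x.1 x.2 * pmat (v + a + b).2 z.1 z.2) := by
      intro b hb
      rw [mem_elems] at hb
      rw [h.mul_mul hv ha hb]
      simp only [Prod.fst_add, Prod.snd_add, (mem_localA.1 ha).2, (mem_localB.1 hb).2, add_zero]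
    rw [Finset.sum_congr rfl e, ← sum_elems_fst hva
      (fun u => ph v * ph (v + a) * ph u * (pmat v.1 x.1 x.2 * pmat u.2 z.1 z.2)), Finset.mul_sum]
    simp only [realigned, Matrix.of_apply, Finset.mul_sum]
    rw [Finset.sum_comm]
    refine Finset.sum_congr rfl fun u _ => ?_
    have : ∀ y : (ιA → Fin 2) × (ιA → Fin 2), ph v * ph (v + a) * (pmat v.1 x.1 x.2 *
        conj (pmat (v + a).1 y.1 y.2)) * (ph u * (pmat u.1 y.1 y.2 * pmat u.2 z.1 z.2)) =
        (ph v * ph (v + a) * ph u * (pmat v.1 x.1 x.2 * pmat u.2 z.1 z.2)) *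
          (pmat u.1 y.1 y.2 * conj (pmat (v + a).1 y.1 y.2)) := fun y => by ring
    simp only [this]
    rw [← Finset.mul_sum, sum_pmat_mul_conj]
    by_cases hu : (v + a).1 = u.1
    · rw [if_pos hu, if_pos hu.symm]; ring
    · rw [if_neg hu, if_neg (fun h => hu h.symm)]; ring
  have h2 : ∀ b ∈ elems (localB S), ∑ v ∈ elems S, ph (v + b) *
      (pmat (v + b).1 x.1 x.2 * pmat (v + b).2 z.1 z.2) = realigned S ph x z := by
    intro b hb
    rw [mem_elems] at hb
    have hbS := (mem_localB.1 hb).1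
    have hbb : ∀ v : PLabel ιA × PLabel ιB, v + b + b = v := fun v => by
      rw [add_assoc, ZModModule.add_self, add_zero]
    refine Finset.sum_nbij' (fun v => v + b) (fun v => v + b) (fun v hv => ?_) (fun v hv => ?_)
      (fun v _ => hbb v) (fun v _ => hbb v) (fun v _ => rfl)
    · rw [mem_elems] at hv ⊢; exact S.add_mem hv hbS
    · rw [mem_elems] at hv ⊢; exact S.add_mem hv hbS
  simp only [mul_assoc]
  rw [← Finset.mul_sum]
  simp only [Finset.sum_mul, mul_assoc]
  rw [Finset.sum_comm]
  have h3 : ∀ v ∈ elems S, ∑ y : (ιA → Fin 2) × (ιA → Fin 2), ∑ a ∈ elems (localA S),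
      ph v * (ph (v + a) * (pmat v.1 x.1 x.2 * (conj (pmat (v + a).1 y.1 y.2) *
        realigned S ph y z))) = Nat.card (localA S) * (2 ^ Fintype.card ιA *
        ∑ b ∈ elems (localB S),
          ph (v + b) * (pmat (v + b).1 x.1 x.2 * pmat (v + b).2 z.1 z.2)) := by
    intro v hv
    rw [Finset.sum_comm, ← card_elems, ← nsmul_eq_mul]
    refine Finset.sum_eq_card_nsmul fun a ha => ?_
    rw [← h1 v hv a ha]
    exact Finset.sum_congr rfl fun y _ => by ring
  rw [Finset.sum_congr rfl h3]
  simp only [← Finset.mul_sum]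
  rw [Finset.sum_comm, Finset.sum_congr rfl h2, Finset.sum_const, card_elems, Matrix.smul_apply,
    smul_eq_mul, nsmul_eq_mul, pow_add]
  ring

lemma trace_realigned (h : IsPhase S ph) :
    (realigned S ph * (realigned S ph).conjTranspose).trace =
      (2 : ℂ) ^ (Fintype.card ιA + Fintype.card ιB) * Nat.card S := by
  rw [Matrix.trace]
  simp only [Matrix.diag_apply, realigned_mul_conjTranspose h]
  rw [← Finset.mul_sum, Finset.sum_comm]
  have : ∀ v ∈ elems S, ∑ x : (ιA → Fin 2) × (ιA → Fin 2), ∑ a ∈ elems (localA S),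
      ph v * ph (v + a) * (pmat v.1 x.1 x.2 * conj (pmat (v + a).1 x.1 x.2)) =
      2 ^ Fintype.card ιA := by
    intro v hv
    rw [mem_elems] at hv
    rw [Finset.sum_comm, Finset.sum_eq_single 0]
    · rw [← Finset.mul_sum, sum_pmat_mul_conj]
      simp [h.mul_self hv]
    · intro a ha ha0
      rw [mem_elems] at ha
      rw [← Finset.mul_sum, sum_pmat_mul_conj, if_neg, mul_zero]
      intro hva
      refine ha0 (Prod.ext ?_ (mem_localA.1 ha).2)
      simpa using hva
    · intro h0
      exact absurd (mem_elems.2 (Submodule.zero_mem _)) h0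
  rw [Finset.sum_congr rfl this, Finset.sum_const, card_elems, nsmul_eq_mul, pow_add]
  ring

/-- The sum of the operators in a bipartite stabilizer group. -/
def groupSum (S : Submodule (ZMod 2) (PLabel ιA × PLabel ιB)) (ph : PLabel ιA × PLabel ιB → ℂ) :
    Matrix ((ιA → Fin 2) × (ιB → Fin 2)) ((ιA → Fin 2) × (ιB → Fin 2)) ℂ :=
  Matrix.of fun x y => ∑ v ∈ elems S, ph v * (pmat v.1 x.1 y.1 * pmat v.2 x.2 y.2)

lemma groupSum_conjTranspose (h : IsPhase S ph) : (groupSum S ph).conjTranspose = groupSum S ph := by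
  ext x y
  simp only [Matrix.conjTranspose_apply, groupSum, Matrix.of_apply]
  rw [show ∀ c : ℂ, star c = conj c from fun _ => rfl, map_sum]
  refine Finset.sum_congr rfl fun v hv => ?_
  rw [map_mul, map_mul, pmat_conj, pmat_conj, h.conj_eq (mem_elems.1 hv)]

lemma groupSum_mul_self (h : IsPhase S ph) :
    groupSum S ph * groupSum S ph = (Nat.card S : ℂ) • groupSum S ph := by
  ext x y
  rw [Matrix.mul_apply]
  simp only [groupSum, Matrix.of_apply, Matrix.smul_apply, Finset.sum_mul_sum]
  rw [Finset.sum_comm]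
  have : ∀ v ∈ elems S, ∑ z : (ιA → Fin 2) × (ιB → Fin 2), ∑ w ∈ elems S,
      ph v * (pmat v.1 x.1 z.1 * pmat v.2 x.2 z.2) *
        (ph w * (pmat w.1 z.1 y.1 * pmat w.2 z.2 y.2)) =
      ∑ u ∈ elems S, ph u * (pmat u.1 x.1 y.1 * pmat u.2 x.2 y.2) := by
    intro v hv
    rw [mem_elems] at hv
    rw [Finset.sum_comm]
    have hvv : ∀ w : PLabel ιA × PLabel ιB, v + (v + w) = w := fun w => by
      rw [← add_assoc, ZModModule.add_self, zero_add]
    refine Finset.sum_nbij' (fun w => v + w) (fun w => v + w) (fun w hw => ?_) (fun w hw => ?_)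
      (fun w _ => hvv w) (fun w _ => hvv w) (fun w hw => ?_)
    · rw [mem_elems] at hw ⊢; exact S.add_mem hv hw
    · rw [mem_elems] at hw ⊢; exact S.add_mem hv hw
    · rw [mem_elems] at hw
      rw [h.add v hv w hw, Fintype.sum_prod_type]
      have e1 := congrFun (congrFun (pmat_mul v.1 w.1) x.1) y.1
      have e2 := congrFun (congrFun (pmat_mul v.2 w.2) x.2) y.2
      rw [Matrix.mul_apply, Matrix.smul_apply, smul_eq_mul] at e1 e2
      calc _ = ph v * ph w * ((∑ z, pmat v.1 x.1 z * pmat w.1 z y.1) *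
            ∑ z, pmat v.2 x.2 z * pmat w.2 z y.2) := by
            rw [Finset.sum_mul_sum, Finset.mul_sum]
            refine Finset.sum_congr rfl fun a _ => ?_
            rw [Finset.mul_sum]
            exact Finset.sum_congr rfl fun b _ => by ring
        _ = _ := by rw [e1, e2, Prod.fst_add, Prod.snd_add]; ring
  rw [Finset.sum_congr rfl this, Finset.sum_const, card_elems, nsmul_eq_mul, smul_eq_mul]

/-- The entropy of the realigned square root of a bipartite stabilizer density matrix. -/
theorem vonNeumann_realigned (h : IsPhase S ph)
    {ρ : Matrix ((ιA → Fin 2) × (ιB → Fin 2)) ((ιA → Fin 2) × (ιB → Fin 2)) ℂ}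
    (hρ : ρ = ((2 : ℝ) ^ (Fintype.card ιA + Fintype.card ιB))⁻¹ • groupSum S ph) :
    vonNeumann (Matrix.of fun x y : (ιA → Fin 2) × (ιA → Fin 2) =>
      ∑ b : ιB → Fin 2, ∑ b' : ιB → Fin 2, cfc Real.sqrt ρ (x.1, b) (x.2, b') *
        conj (cfc Real.sqrt ρ (y.1, b) (y.2, b'))) =
    Real.logb 2 ((Nat.card S : ℝ) / (Nat.card (localA S) * Nat.card (localB S))) := by
  set T : ℝ := (2 : ℝ) ^ (Fintype.card ιA + Fintype.card ιB) with hT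
  have hT0 : 0 < T := by positivity
  have hs : (0 : ℝ) < Nat.card S := by exact_mod_cast Nat.card_pos
  have ha : (0 : ℝ) < Nat.card (localA S) := by exact_mod_cast Nat.card_pos
  have hb : (0 : ℝ) < Nat.card (localB S) := by exact_mod_cast Nat.card_pos
  have hTc : ((2 : ℂ) ^ (Fintype.card ιA + Fintype.card ιB)) = (T : ℂ) := by rw [hT]; push_cast; rfl
  have hρh : ρ.conjTranspose = ρ := by
    rw [hρ, Matrix.conjTranspose_smul, groupSum_conjTranspose h]; simp
  have hρ2 : ρ * ρ = ((Nat.card S : ℝ) / T) • ρ := by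
    rw [hρ, Matrix.smul_mul, Matrix.mul_smul, groupSum_mul_self h, smul_smul, smul_smul]
    ext x y
    simp only [Matrix.smul_apply, Complex.real_smul, smul_eq_mul]
    push_cast
    ring
  set c : ℝ := (Nat.card S : ℝ) / T with hc
  have hc0 : 0 < c := by positivity
  rw [cfc_of_mul_self hρh hc0 hρ2 Real.sqrt_zero]
  -- The factor relating √ρ to the group sum: √ρ is √c / c times ρ, and ρ carries the normalization
  -- T⁻¹.
  set κ : ℝ := Real.sqrt c / c * T⁻¹ with hκ
  have hκ2 : κ ^ 2 = (T * Nat.card S)⁻¹ := by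
    rw [hκ, mul_pow, div_pow, Real.sq_sqrt hc0.le, hc]
    field_simp
  have hσ : (Matrix.of fun x y : (ιA → Fin 2) × (ιA → Fin 2) =>
      ∑ b : ιB → Fin 2, ∑ b' : ιB → Fin 2, ((Real.sqrt c / c) • ρ) (x.1, b) (x.2, b') *
        conj (((Real.sqrt c / c) • ρ) (y.1, b) (y.2, b'))) =
      (κ ^ 2 : ℝ) • (realigned S ph * (realigned S ph).conjTranspose) := by
    ext x y
    rw [Matrix.of_apply, Matrix.smul_apply, Matrix.mul_apply, Fintype.sum_prod_type,
      Finset.smul_sum]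
    refine Finset.sum_congr rfl fun b _ => ?_
    rw [Finset.smul_sum]
    refine Finset.sum_congr rfl fun b' _ => ?_
    rw [hρ, smul_smul, ← hκ]
    simp only [Matrix.smul_apply, Complex.real_smul, map_mul, Complex.conj_ofReal,
      Matrix.conjTranspose_apply, realigned, groupSum, Matrix.of_apply]
    rw [show ∀ c : ℂ, star c = conj c from fun _ => rfl]
    push_cast
    ring
  rw [hσ]
  -- The only nonzero eigenvalue of ρ_{AA*}: κ² = 1/(T|S|) times the constant T|S_A||S_B| of
  -- `realigned_cube`.
  set d : ℝ := Nat.card (localA S) * Nat.card (localB S) / Nat.card S with hd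
  have hd0 : 0 < d := by positivity
  rw [vonNeumann_of_mul_self (c := d) _ hd0]
  · rw [hd, ← Real.logb_inv, inv_div]
  · rw [Matrix.smul_mul, Matrix.mul_smul, ← Matrix.mul_assoc, realigned_cube h, Matrix.smul_mul,
      hTc]
    ext x y
    simp only [Matrix.smul_apply, Complex.real_smul, smul_eq_mul]
    have : κ ^ 2 * (κ ^ 2 * (T * (Nat.card (localA S) * Nat.card (localB S)))) = d * κ ^ 2 := by
      rw [hκ2, hd]; field_simp
    have hC := congrArg (fun r : ℝ => (r : ℂ)) this
    push_cast at hC ⊢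
    linear_combination ((realigned S ph * (realigned S ph).conjTranspose) x y) * hC
  · rw [Matrix.trace_smul, trace_realigned h, hTc, hκ2, Complex.real_smul]
    have : (T * Nat.card S)⁻¹ * (T * Nat.card S) = 1 := inv_mul_cancel₀ (by positivity)
    exact_mod_cast this
  · rw [Matrix.conjTranspose_smul, Matrix.conjTranspose_mul, Matrix.conjTranspose_conjTranspose]
    simp

end Reflected

/-! ### Stabilizer groups and their labels -/

lemma pauliString_eq {N : ℕ} (k : Fin 4) (P : Fin N → Pauli) :
    pauliString k P = (Complex.I ^ (k : ℕ)) • pmat fun i => (P i).label := by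
  ext x y
  simp [pauliString, pmat_apply, qmat, Pauli.ofLabel_label]

lemma pmat_smul_inj {ι : Type*} [Fintype ι] [DecidableEq ι] {v w : PLabel ι} {c c' : ℂ}
    (hc : c ≠ 0) (h : c • pmat v = c' • pmat w) : v = w := by
  by_contra hne
  have h1 := congrArg (fun M => (M * pmat v).trace) h
  simp only [Matrix.smul_mul, Matrix.trace_smul, pmat_trace_mul, if_neg (Ne.symm hne)] at h1
  simp [hc] at h1

lemma smul_pmat_inj {ι : Type*} [Fintype ι] [DecidableEq ι] {v : PLabel ι} {c c' : ℂ}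
    (h : c • pmat v = c' • pmat v) : c = c' := by
  have h1 := congrArg (fun M => (M * pmat v).trace) h
  simpa [Matrix.smul_mul, Matrix.trace_smul, pmat_trace_mul] using h1

section Stabilizer

variable {N : ℕ} {ψ : (Fin N → Fin 2) → ℂ} {G : Subgroup (QubitUnitary N)}

/-- `U` is a multiple of the Pauli string with label `v`. -/
def HasLabel (U : QubitUnitary N) (v : PLabel (Fin N)) : Prop := ∃ c : ℂ, U.1 = c • pmat v

lemma HasLabel.mul {U U' : QubitUnitary N} {v v' : PLabel (Fin N)} (h : HasLabel U v)
    (h' : HasLabel U' v') : HasLabel (U * U') (v + v') := by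
  obtain ⟨c, hc⟩ := h
  obtain ⟨c', hc'⟩ := h'
  refine ⟨c * (c' * pphase v v'), ?_⟩
  rw [Submonoid.coe_mul, hc, hc', Matrix.smul_mul, Matrix.mul_smul, pmat_mul, smul_smul, smul_smul,
    mul_assoc]

lemma HasLabel.inv {U : QubitUnitary N} {v : PLabel (Fin N)} (h : HasLabel U v) :
    HasLabel U⁻¹ v := by
  obtain ⟨c, hc⟩ := h
  refine ⟨star c, ?_⟩
  have : (U⁻¹).1 = star U.1 := rfl
  rw [this, hc, Matrix.star_eq_conjTranspose, Matrix.conjTranspose_smul, pmat_conjTranspose]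

lemma hasLabel_one : HasLabel (1 : QubitUnitary N) 0 := ⟨1, by rw [pmat_zero, one_smul]; rfl⟩

lemma HasLabel.ne_zero {U : QubitUnitary N} {v : PLabel (Fin N)} {c : ℂ} (h : U.1 = c • pmat v) :
    c ≠ 0 := by
  rintro rfl
  rw [zero_smul] at h
  have h1 : star U.1 * U.1 = 1 := Matrix.mem_unitaryGroup_iff'.1 U.2
  rw [h, mul_zero] at h1
  exact zero_ne_one h1

lemma HasLabel.unique {U : QubitUnitary N} {v w : PLabel (Fin N)} (h : HasLabel U v)
    (h' : HasLabel U w) : v = w := by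
  obtain ⟨c, hc⟩ := h
  obtain ⟨c', hc'⟩ := h'
  exact pmat_smul_inj (HasLabel.ne_zero hc) (hc.symm.trans hc')

/-- The properties of a stabilizer group that are used below. -/
structure IsStabGroup (ψ : (Fin N → Fin 2) → ℂ) (G : Subgroup (QubitUnitary N)) : Prop where
  norm : ∑ x, ‖ψ x‖ ^ 2 = 1
  label : ∀ U ∈ G, ∃ v, HasLabel U v
  fix : ∀ U ∈ G, U.1.mulVec ψ = ψ

lemma IsStabilizerState.isStabGroup (h : IsStabilizerState ψ G) : IsStabGroup ψ G := by
  obtain ⟨hn, g, hP, -, -, hfix, rfl⟩ := h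
  refine ⟨hn, fun U hU => ?_, fun U hU => ?_⟩
  · induction hU using Subgroup.closure_induction with
    | mem U hU =>
      obtain ⟨i, rfl⟩ := hU
      obtain ⟨k, P, hkP⟩ := hP i
      exact ⟨_, _, hkP.trans (pauliString_eq k P)⟩
    | one => exact ⟨0, hasLabel_one⟩
    | mul U U' _ _ h h' =>
      obtain ⟨v, hv⟩ := h
      obtain ⟨v', hv'⟩ := h'
      exact ⟨_, hv.mul hv'⟩
    | inv U _ h =>
      obtain ⟨v, hv⟩ := h
      exact ⟨_, hv.inv⟩
  · induction hU using Subgroup.closure_induction with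
    | mem U hU =>
      obtain ⟨i, rfl⟩ := hU
      exact hfix i
    | one => exact Matrix.one_mulVec ψ
    | mul U U' _ _ h h' =>
      rw [Submonoid.coe_mul, ← Matrix.mulVec_mulVec, h', h]
    | inv U _ h =>
      have h1 : (U⁻¹).1 * U.1 = 1 := congrArg Subtype.val (inv_mul_cancel U)
      conv_lhs => rw [← h]
      rw [Matrix.mulVec_mulVec, h1, Matrix.one_mulVec]

namespace IsStabGroup

lemma ne_zero (h : IsStabGroup ψ G) : ψ ≠ 0 := by
  rintro rfl
  have := h.norm
  simp at this

/-- Pauli strings square to 1, so U² = c² fixes ψ ≠ 0. -/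
lemma coeff (h : IsStabGroup ψ G) {U : QubitUnitary N} (hU : U ∈ G) {v : PLabel (Fin N)} {c : ℂ}
    (hc : U.1 = c • pmat v) : c = 1 ∨ c = -1 := by
  have h1 := h.fix _ (G.mul_mem hU hU)
  rw [Submonoid.coe_mul, hc, Matrix.smul_mul, Matrix.mul_smul, pmat_mul_self, smul_smul,
    Matrix.smul_mulVec, Matrix.one_mulVec] at h1
  obtain ⟨x, hx⟩ := Function.ne_iff.1 h.ne_zero
  have h2 := congrFun h1 x
  simp only [Pi.smul_apply, smul_eq_mul] at h2
  have h3 : c * c = 1 := mul_right_cancel₀ hx (by rw [h2, one_mul])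
  exact mul_self_eq_one_iff.1 h3

/-- Otherwise the two elements would be opposite to each other, and both could not fix ψ ≠ 0. This
is what makes labels faithful on the group. -/
lemma eq_of_hasLabel (h : IsStabGroup ψ G) {U U' : QubitUnitary N} (hU : U ∈ G) (hU' : U' ∈ G)
    {v : PLabel (Fin N)} (hv : HasLabel U v) (hv' : HasLabel U' v) : U = U' := by
  obtain ⟨c, hc⟩ := hv
  obtain ⟨c', hc'⟩ := hv'
  have key : ∀ {U U' : QubitUnitary N}, U ∈ G → U' ∈ G → U.1 = (1 : ℂ) • pmat v →
      U'.1 = (-1 : ℂ) • pmat v → False := by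
    intro U U' hU hU' h1 h2
    have e1 := h.fix U hU
    have e2 := h.fix U' hU'
    rw [h1, one_smul] at e1
    rw [h2, Matrix.smul_mulVec, e1, neg_smul, one_smul] at e2
    exact h.ne_zero (self_eq_neg.1 e2.symm)
  apply Subtype.ext
  rcases h.coeff hU hc with rfl | rfl <;> rcases h.coeff hU' hc' with rfl | rfl
  · rw [hc, hc']
  · exact (key hU hU' hc hc').elim
  · exact (key hU' hU hc' hc).elim
  · rw [hc, hc']

end IsStabGroup

/-- The labels of the elements of a group of Pauli operators. -/
def labels (G : Subgroup (QubitUnitary N)) : Submodule (ZMod 2) (PLabel (Fin N)) where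
  carrier := {v | ∃ U ∈ G, HasLabel U v}
  zero_mem' := ⟨1, G.one_mem, hasLabel_one⟩
  add_mem' := by
    rintro v w ⟨U, hU, hv⟩ ⟨U', hU', hw⟩
    exact ⟨U * U', G.mul_mem hU hU', hv.mul hw⟩
  smul_mem' := by
    rintro c v ⟨U, hU, hv⟩
    rcases zmod_two_cases c with rfl | rfl
    · rw [zero_smul]; exact ⟨1, G.one_mem, hasLabel_one⟩
    · rw [one_smul]; exact ⟨U, hU, hv⟩

lemma mem_labels {v : PLabel (Fin N)} : v ∈ labels G ↔ ∃ U ∈ G, HasLabel U v := Iff.rfl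

open Classical in
/-- The element of the group with a given label. -/
def stabElem (G : Subgroup (QubitUnitary N)) (v : PLabel (Fin N)) : QubitUnitary N :=
  if h : v ∈ labels G then (mem_labels.1 h).choose else 1

lemma stabElem_mem {v : PLabel (Fin N)} (hv : v ∈ labels G) : stabElem G v ∈ G := by
  rw [stabElem, dif_pos hv]
  exact (mem_labels.1 hv).choose_spec.1

lemma stabElem_hasLabel {v : PLabel (Fin N)} (hv : v ∈ labels G) : HasLabel (stabElem G v) v := by
  rw [stabElem, dif_pos hv]
  exact (mem_labels.1 hv).choose_spec.2

open Classical in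
/-- The sign of the element of the group with a given label. -/
def stabSign (G : Subgroup (QubitUnitary N)) (v : PLabel (Fin N)) : ℂ :=
  if h : v ∈ labels G then (stabElem_hasLabel h).choose else 1

lemma stabElem_eq {v : PLabel (Fin N)} (hv : v ∈ labels G) :
    (stabElem G v).1 = stabSign G v • pmat v := by
  rw [stabSign, dif_pos hv]
  exact (stabElem_hasLabel hv).choose_spec

namespace IsStabGroup

lemma stabElem_add (h : IsStabGroup ψ G) {v w : PLabel (Fin N)} (hv : v ∈ labels G)
    (hw : w ∈ labels G) : stabElem G (v + w) = stabElem G v * stabElem G w :=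
  h.eq_of_hasLabel (stabElem_mem (add_mem hv hw)) (G.mul_mem (stabElem_mem hv) (stabElem_mem hw))
    (stabElem_hasLabel (add_mem hv hw)) ((stabElem_hasLabel hv).mul (stabElem_hasLabel hw))

lemma stabSign_add (h : IsStabGroup ψ G) {v w : PLabel (Fin N)} (hv : v ∈ labels G)
    (hw : w ∈ labels G) : stabSign G (v + w) = stabSign G v * stabSign G w * pphase v w := by
  have h1 := congrArg Subtype.val (h.stabElem_add hv hw)
  rw [Submonoid.coe_mul, stabElem_eq (add_mem hv hw), stabElem_eq hv, stabElem_eq hw,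
    Matrix.smul_mul, Matrix.mul_smul, pmat_mul, smul_smul, smul_smul] at h1
  rw [smul_pmat_inj h1, mul_assoc]

lemma stabSign_cases (h : IsStabGroup ψ G) {v : PLabel (Fin N)} (hv : v ∈ labels G) :
    stabSign G v = 1 ∨ stabSign G v = -1 := h.coeff (stabElem_mem hv) (stabElem_eq hv)

lemma stabSign_zero (h : IsStabGroup ψ G) : stabSign G 0 = 1 := by
  have h0 : (0 : PLabel (Fin N)) ∈ labels G := zero_mem _
  have := h.stabSign_add h0 h0
  rw [add_zero, pphase_zero_right, mul_one] at this
  rcases h.stabSign_cases h0 with h1 | h1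
  · exact h1
  · rw [h1] at this; norm_num at this

lemma injOn_stabElem : Set.InjOn (stabElem G) (labels G : Set (PLabel (Fin N))) :=
  fun _ hv _ hw hvw => (stabElem_hasLabel hv).unique (hvw ▸ stabElem_hasLabel hw)

lemma stabElem_label (h : IsStabGroup ψ G) {U : QubitUnitary N} (hU : U ∈ G) {v : PLabel (Fin N)}
    (hv : HasLabel U v) : stabElem G v = U :=
  have hm : v ∈ labels G := ⟨U, hU, hv⟩
  h.eq_of_hasLabel (stabElem_mem hm) hU (stabElem_hasLabel hm) hv

lemma image_labels (h : IsStabGroup ψ G) :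
    stabElem G '' (labels G : Set (PLabel (Fin N))) = (G : Set (QubitUnitary N)) := by
  ext U
  constructor
  · rintro ⟨v, hv, rfl⟩
    exact stabElem_mem hv
  · intro hU
    obtain ⟨v, hv⟩ := h.label U hU
    exact ⟨v, ⟨U, hU, hv⟩, h.stabElem_label hU hv⟩

/-- Products in either order have the same label, hence are the same group element, so the
commutation sign is 1. -/
lemma psymp_eq_zero (h : IsStabGroup ψ G) {v w : PLabel (Fin N)} (hv : v ∈ labels G)
    (hw : w ∈ labels G) : psymp v w = 0 := by
  have h1 := h.stabSign_add hv hw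
  rw [add_comm v w, h.stabSign_add hw hv, mul_comm (stabSign G w), pphase_comm v w] at h1
  have hne : stabSign G v * stabSign G w ≠ 0 := by
    rcases h.stabSign_cases hv with e | e <;> rcases h.stabSign_cases hw with e' | e' <;>
      rw [e, e'] <;> norm_num
  have h2 := mul_left_cancel₀ hne h1
  rw [← sgn_eq_one_iff]
  exact mul_right_cancel₀ (pphase_ne_zero w v) (by rw [one_mul, ← h2])

end IsStabGroup

/-- The labels of the elements that act trivially outside `T`. -/
def labelsOn (G : Subgroup (QubitUnitary N)) (T : Set (Fin N)) :
    Submodule (ZMod 2) (PLabel (Fin N)) where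
  carrier := {v | v ∈ labels G ∧ ∀ i ∉ T, v i = 0}
  zero_mem' := ⟨zero_mem _, fun _ _ => rfl⟩
  add_mem' := fun {v w} hv hw => ⟨add_mem hv.1 hw.1, fun i hi => by
    rw [Pi.add_apply, hv.2 i hi, hw.2 i hi, add_zero]⟩
  smul_mem' := fun c v hv => ⟨Submodule.smul_mem _ c hv.1, fun i hi => by
    rw [Pi.smul_apply, hv.2 i hi, smul_zero]⟩

lemma mem_labelsOn {T : Set (Fin N)} {v : PLabel (Fin N)} :
    v ∈ labelsOn G T ↔ v ∈ labels G ∧ ∀ i ∉ T, v i = 0 := Iff.rfl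

namespace IsStabGroup

lemma supportedOn_eq (h : IsStabGroup ψ G) (T : Set (Fin N)) :
    supportedOn G T = stabElem G '' (labelsOn G T : Set (PLabel (Fin N))) := by
  ext U
  constructor
  · rintro ⟨hU, k, P, hP, hT⟩
    have hv : HasLabel U fun i => (P i).label := ⟨_, hP.trans (pauliString_eq k P)⟩
    refine ⟨_, ⟨⟨U, hU, hv⟩, fun i hi => ?_⟩, h.stabElem_label hU hv⟩
    simp only [hT i hi]
    rfl
  · rintro ⟨v, ⟨hv, hT⟩, rfl⟩
    have e : (fun i => (Pauli.ofLabel (v i)).label) = v :=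
      funext fun i => Pauli.label_ofLabel (v i)
    have hI : ∀ i, i ∉ T → Pauli.ofLabel (v i) = Pauli.I := fun i hi => by
      rw [hT i hi]; simp [Pauli.ofLabel]
    -- The signs ±1 are the powers i⁰ and i².
    rcases h.stabSign_cases hv with hs | hs
    · refine ⟨stabElem_mem hv, 0, fun i => Pauli.ofLabel (v i), ?_, hI⟩
      rw [pauliString_eq, e, stabElem_eq hv, hs]
      simp
    · refine ⟨stabElem_mem hv, 2, fun i => Pauli.ofLabel (v i), ?_, hI⟩
      rw [pauliString_eq, e, stabElem_eq hv, hs]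
      simp

lemma card_image {s : Set (PLabel (Fin N))} (hs : s ⊆ labels G) :
    Nat.card (stabElem G '' s) = Nat.card s :=
  Nat.card_image_of_injOn (injOn_stabElem.mono hs)

lemma card_supportedOn (h : IsStabGroup ψ G) (T : Set (Fin N)) :
    Nat.card (supportedOn G T) = Nat.card (labelsOn G T) := by
  rw [h.supportedOn_eq]
  exact card_image fun v hv => hv.1

lemma card_group (h : IsStabGroup ψ G) : Nat.card G = Nat.card (labels G) := by
  have := card_image (G := G) (s := (labels G : Set (PLabel (Fin N)))) subset_rfl
  rw [h.image_labels] at this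
  exact this

lemma image_mul (h : IsStabGroup ψ G) {P Q : Submodule (ZMod 2) (PLabel (Fin N))}
    (hP : P ≤ labels G) (hQ : Q ≤ labels G) :
    (stabElem G '' (P : Set (PLabel (Fin N)))) * (stabElem G '' (Q : Set (PLabel (Fin N)))) =
      stabElem G '' ((P ⊔ Q : Submodule (ZMod 2) (PLabel (Fin N))) : Set (PLabel (Fin N))) := by
  ext U
  rw [Set.mem_mul]
  constructor
  · rintro ⟨_, ⟨v, hv, rfl⟩, _, ⟨w, hw, rfl⟩, rfl⟩
    exact ⟨v + w, Submodule.add_mem_sup hv hw, h.stabElem_add (hP hv) (hQ hw)⟩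
  · rintro ⟨u, hu, rfl⟩
    obtain ⟨v, hv, w, hw, rfl⟩ := Submodule.mem_sup.1 hu
    exact ⟨_, ⟨v, hv, rfl⟩, _, ⟨w, hw, rfl⟩, (h.stabElem_add (hP hv) (hQ hw)).symm⟩

lemma labelsOn_le (T : Set (Fin N)) : labelsOn G T ≤ labels G := fun _ hv => hv.1

lemma card_mul_mul (h : IsStabGroup ψ G) (T₁ T₂ T₃ : Set (Fin N)) :
    Nat.card (supportedOn G T₁ * supportedOn G T₂ * supportedOn G T₃ : Set (QubitUnitary N)) =
      Nat.card (labelsOn G T₁ ⊔ labelsOn G T₂ ⊔ labelsOn G T₃ :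
        Submodule (ZMod 2) (PLabel (Fin N))) := by
  rw [h.supportedOn_eq, h.supportedOn_eq, h.supportedOn_eq,
    h.image_mul (labelsOn_le _) (labelsOn_le _),
    h.image_mul (sup_le (labelsOn_le _) (labelsOn_le _)) (labelsOn_le _)]
  exact card_image (sup_le (sup_le (labelsOn_le _) (labelsOn_le _)) (labelsOn_le _))

end IsStabGroup

/-- A stabilizer state has `N` independent stabilizers. -/
lemma IsStabilizerState.finrank_labels (h : IsStabilizerState ψ G) :
    Module.finrank (ZMod 2) (labels G) = N := by
  have hG := h.isStabGroup
  obtain ⟨-, g, hP, -, hind, -, rfl⟩ := h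
  set G := Subgroup.closure (Set.range g) with hGdef
  have hgG : ∀ i, g i ∈ G := fun i => Subgroup.subset_closure ⟨i, rfl⟩
  choose v hv using fun i => hG.label (g i) (hgG i)
  have hvl : ∀ i, v i ∈ labels G := fun i => ⟨g i, hgG i, hv i⟩
  -- A linear relation expressing `v i` through the other labels lifts, by faithfulness of labels,
  -- to membership of `g i` in the subgroup generated by the others.
  have hli : LinearIndependent (ZMod 2) v := by
    rw [linearIndependent_iff_notMem_span]
    intro i hi
    refine hind i ?_
    have key : ∀ w ∈ Submodule.span (ZMod 2) (v '' (Set.univ \ {i})), w ∈ labels G ∧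
        stabElem G w ∈ Subgroup.closure (g '' {j | j ≠ i}) := by
      intro w hw
      induction hw using Submodule.span_induction with
      | mem w hw =>
        obtain ⟨j, hj, rfl⟩ := hw
        refine ⟨hvl j, ?_⟩
        rw [hG.stabElem_label (hgG j) (hv j)]
        exact Subgroup.subset_closure ⟨j, by simpa using hj, rfl⟩
      | zero =>
        refine ⟨zero_mem _, ?_⟩
        rw [hG.stabElem_label G.one_mem hasLabel_one]
        exact Subgroup.one_mem _
      | add w w' _ _ hw hw' =>
        refine ⟨add_mem hw.1 hw'.1, ?_⟩
        rw [hG.stabElem_add hw.1 hw'.1]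
        exact Subgroup.mul_mem _ hw.2 hw'.2
      | smul c w _ hw =>
        rcases zmod_two_cases c with rfl | rfl
        · rw [zero_smul]
          refine ⟨zero_mem _, ?_⟩
          rw [hG.stabElem_label G.one_mem hasLabel_one]
          exact Subgroup.one_mem _
        · rwa [one_smul]
    have := (key _ hi).2
    rwa [hG.stabElem_label (hgG i) (hv i)] at this
  have hspan : labels G = Submodule.span (ZMod 2) (Set.range v) := by
    apply le_antisymm
    · rintro w ⟨U, hU, hw⟩
      have key : ∀ U ∈ G, ∃ w ∈ Submodule.span (ZMod 2) (Set.range v), HasLabel U w := by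
        intro U hU
        induction hU using Subgroup.closure_induction with
        | mem U hU =>
          obtain ⟨i, rfl⟩ := hU
          exact ⟨v i, Submodule.subset_span ⟨i, rfl⟩, hv i⟩
        | one => exact ⟨0, zero_mem _, hasLabel_one⟩
        | mul U U' _ _ h h' =>
          obtain ⟨w, hw, h⟩ := h
          obtain ⟨w', hw', h'⟩ := h'
          exact ⟨_, add_mem hw hw', h.mul h'⟩
        | inv U _ h =>
          obtain ⟨w, hw, h⟩ := h
          exact ⟨_, hw, h.inv⟩
      obtain ⟨w', hw', h'⟩ := key U hU
      rwa [hw.unique h']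
    · rw [Submodule.span_le]
      rintro _ ⟨i, rfl⟩
      exact hvl i
  rw [hspan, finrank_span_eq_card hli, Fintype.card_fin]

lemma card_eq_two_pow {V : Type*} [AddCommGroup V] [Module (ZMod 2) V] [Finite V] :
    Nat.card V = 2 ^ Module.finrank (ZMod 2) V := by
  rw [Module.natCard_eq_pow_finrank (K := ZMod 2), Nat.card_zmod]

open scoped ComplexOrder in
/-- The density matrix of a stabilizer state is the normalized sum of its stabilizers. -/
theorem IsStabilizerState.mul_conj_eq (h : IsStabilizerState ψ G) (x y : Fin N → Fin 2) :
    ψ x * conj (ψ y) = ((2 : ℂ) ^ N)⁻¹ * ∑ v ∈ elems (labels G), stabSign G v * pmat v x y := by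
  have hG := h.isStabGroup
  have hcard : (elems (labels G)).card = 2 ^ N := by
    rw [card_elems, card_eq_two_pow, h.finrank_labels]
  have h2 : ((2 : ℂ) ^ N) ≠ 0 := pow_ne_zero _ two_ne_zero
  set P : Matrix (Fin N → Fin 2) (Fin N → Fin 2) ℂ := ∑ v ∈ elems (labels G), stabSign G v • pmat v
    with hP
  set Q := ((2 : ℂ) ^ N)⁻¹ • P with hQ
  have hPP : P * P = ((2 : ℂ) ^ N) • P := by
    conv_lhs => rw [hP, Finset.sum_mul_sum]
    have : ∀ v ∈ elems (labels G), ∑ w ∈ elems (labels G),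
        (stabSign G v • pmat v) * (stabSign G w • pmat w) = P := by
      intro v hv
      rw [mem_elems] at hv
      have hvv : ∀ w : PLabel (Fin N), v + (v + w) = w := fun w => by
        rw [← add_assoc, plabel_add_self, zero_add]
      refine Finset.sum_nbij' (fun w => v + w) (fun w => v + w) (fun w hw => ?_) (fun w hw => ?_)
        (fun w _ => hvv w) (fun w _ => hvv w) (fun w hw => ?_)
      · rw [mem_elems] at hw ⊢; exact add_mem hv hw
      · rw [mem_elems] at hw ⊢; exact add_mem hv hw
      · rw [mem_elems] at hw
        rw [hG.stabSign_add hv hw, Matrix.smul_mul, Matrix.mul_smul, pmat_mul, smul_smul, smul_smul,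
          mul_assoc]
    rw [Finset.sum_congr rfl this, Finset.sum_const, hcard, ← Nat.cast_smul_eq_nsmul ℂ]
    push_cast
    rfl
  have hPh : P.conjTranspose = P := by
    rw [hP, Matrix.conjTranspose_sum]
    refine Finset.sum_congr rfl fun v hv => ?_
    rw [Matrix.conjTranspose_smul, pmat_conjTranspose]
    rcases hG.stabSign_cases (mem_elems.1 hv) with e | e <;> rw [e] <;> simp
  have hPt : P.trace = (2 : ℂ) ^ N := by
    rw [hP, Matrix.trace_sum, Finset.sum_eq_single 0]
    · rw [Matrix.trace_smul, pmat_trace, hG.stabSign_zero]; simp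
    · intro v _ hv
      rw [Matrix.trace_smul, pmat_trace, if_neg hv, smul_zero]
    · intro h0; exact absurd (mem_elems.2 (zero_mem _)) h0
  have hPψ : P.mulVec ψ = ((2 : ℂ) ^ N) • ψ := by
    rw [hP, Matrix.sum_mulVec]
    have : ∀ v ∈ elems (labels G), (stabSign G v • pmat v).mulVec ψ = ψ := by
      intro v hv
      rw [mem_elems] at hv
      rw [← stabElem_eq hv]
      exact hG.fix _ (stabElem_mem hv)
    rw [Finset.sum_congr rfl this, Finset.sum_const, hcard, ← Nat.cast_smul_eq_nsmul ℂ]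
    push_cast
    rfl
  have hQQ : Q * Q = Q := by
    rw [hQ, Matrix.smul_mul, Matrix.mul_smul, hPP, smul_smul ((2 : ℂ) ^ N)⁻¹ ((2 : ℂ) ^ N),
      inv_mul_cancel₀ h2, one_smul]
  have hQh : Q.conjTranspose = Q := by
    rw [hQ, Matrix.conjTranspose_smul, hPh]; simp
  have hQt : Q.trace = 1 := by
    rw [hQ, Matrix.trace_smul, hPt, smul_eq_mul, inv_mul_cancel₀ h2]
  have hQψ : Q.mulVec ψ = ψ := by
    rw [hQ, Matrix.smul_mulVec, hPψ, smul_smul, inv_mul_cancel₀ h2, one_smul]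
  have hψQ : Matrix.vecMul (star ψ) Q = star ψ := by
    have := congrArg star hQψ
    rwa [Matrix.star_mulVec, hQh] at this
  have hnorm : star ψ ⬝ᵥ ψ = 1 := by
    rw [dotProduct]
    have : ∀ x, (star ψ) x * ψ x = ((‖ψ x‖ ^ 2 : ℝ) : ℂ) := fun x => by
      rw [Pi.star_apply, Complex.star_def, mul_comm, Complex.mul_conj, Complex.normSq_eq_norm_sq]
    simp only [this]
    rw [← Complex.ofReal_sum, hG.norm, Complex.ofReal_one]
  set D := Matrix.vecMulVec ψ (star ψ) with hD
  have hQD : Q * D = D := by rw [hD, Matrix.mul_vecMulVec, hQψ]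
  have hDQ : D * Q = D := by rw [hD, Matrix.vecMulVec_mul, hψQ]
  have hDD : D * D = D := by
    conv_lhs => rw [hD]
    rw [Matrix.vecMulVec_mul_vecMulVec, hnorm]
    simp [hD]
  have hDh : D.conjTranspose = D := by
    ext x y
    simp [hD, Matrix.conjTranspose_apply, Matrix.vecMulVec_apply, mul_comm]
  have hDt : D.trace = 1 := by
    rw [hD, Matrix.trace_vecMulVec, dotProduct_comm, hnorm]
  -- `Q` is an orthogonal projection of trace 1 fixing ψ, so subtracting the projection `D` onto ψ
  -- leaves an orthogonal projection of trace 0, which vanishes.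
  have hE : (Q - D).conjTranspose * (Q - D) = Q - D := by
    rw [Matrix.conjTranspose_sub, hQh, hDh, sub_mul, mul_sub, mul_sub, hQQ, hQD, hDQ, hDD]
    abel
  have hE0 : Q - D = 0 := by
    rw [← Matrix.trace_conjTranspose_mul_self_eq_zero_iff, hE, Matrix.trace_sub, hQt, hDt, sub_self]
  have hfin := congrFun (congrFun (sub_eq_zero.1 hE0) x) y
  rw [hD, Matrix.vecMulVec_apply, hQ, Matrix.smul_apply, hP, Matrix.sum_apply] at hfin
  rw [show conj (ψ y) = (star ψ) y from rfl, ← hfin]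
  simp

end Stabilizer

/-! ### Restriction of labels to the parties -/

open Module

lemma finrank_map_of_injective {V W : Type*} [AddCommGroup V] [Module (ZMod 2) V] [AddCommGroup W]
    [Module (ZMod 2) W] {f : V →ₗ[ZMod 2] W} (hf : Function.Injective f)
    (p : Submodule (ZMod 2) V) : finrank (ZMod 2) (p.map f) = finrank (ZMod 2) p :=
  (Submodule.equivMapOfInjective f hf p).finrank_eq.symm

lemma finrank_map_add_finrank_ker_inf {V W : Type*} [AddCommGroup V] [Module (ZMod 2) V]
    [FiniteDimensional (ZMod 2) V] [AddCommGroup W] [Module (ZMod 2) W] (f : V →ₗ[ZMod 2] W)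
    (p : Submodule (ZMod 2) V) :
    finrank (ZMod 2) (p.map f) + finrank (ZMod 2) (p ⊓ LinearMap.ker f : Submodule (ZMod 2) V) =
      finrank (ZMod 2) p := by
  have h := LinearMap.finrank_range_add_finrank_ker (f.domRestrict p)
  rw [LinearMap.range_domRestrict] at h
  rw [← h, LinearMap.ker_domRestrict]
  congr 1
  have h2 : (LinearMap.ker f).submoduleOf p = (p ⊓ LinearMap.ker f).submoduleOf p := by
    ext x; simp [Submodule.submoduleOf]
  have h3 := (Submodule.submoduleOfEquivOfLe (inf_le_left : p ⊓ LinearMap.ker f ≤ p)).finrank_eq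
  rw [← h3, ← h2]
  rfl

section Forms

variable {ι : Type*} [Fintype ι] [DecidableEq ι]

lemma psympForm_nondegenerate : (psympForm ι).Nondegenerate := by
  constructor
  · intro v hv
    by_contra h
    obtain ⟨u, hu⟩ := exists_psymp_ne_zero h
    exact hu (by rw [psymp_comm]; exact hv u)
  · intro v hv
    by_contra h
    obtain ⟨u, hu⟩ := exists_psymp_ne_zero h
    exact hu (hv u)

lemma finrank_plabel : finrank (ZMod 2) (PLabel ι) = 2 * Fintype.card ι := by
  rw [finrank_pi_fintype]
  simp [mul_comm]

lemma finrank_psymp_orthogonal (W : Submodule (ZMod 2) (PLabel ι)) :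
    finrank (ZMod 2) ((psympForm ι).orthogonal W) + finrank (ZMod 2) W = 2 * Fintype.card ι := by
  rw [LinearMap.BilinForm.finrank_orthogonal psympForm_nondegenerate, ← finrank_plabel]
  exact Nat.sub_add_cancel (Submodule.finrank_le W)

/-- A maximal isotropic subspace is its own orthogonal complement. -/
lemma orthogonal_eq_self {W : Submodule (ZMod 2) (PLabel ι)}
    (hW : ∀ v ∈ W, ∀ w ∈ W, psymp v w = 0) (hd : finrank (ZMod 2) W = Fintype.card ι) :
    (psympForm ι).orthogonal W = W := by
  refine (Submodule.eq_of_le_of_finrank_eq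
    (show W ≤ (psympForm ι).orthogonal W from fun w hw v hv => hW v hv w hw) ?_).symm
  have := finrank_psymp_orthogonal W
  omega

lemma orthogonal_sup (W W' : Submodule (ZMod 2) (PLabel ι)) :
    (psympForm ι).orthogonal (W ⊔ W') = (psympForm ι).orthogonal W ⊓ (psympForm ι).orthogonal W' :=
  le_antisymm
    (le_inf (LinearMap.BilinForm.orthogonal_le le_sup_left)
      (LinearMap.BilinForm.orthogonal_le le_sup_right))
    (fun x hx v hv => by
      obtain ⟨w, hw, w', hw', rfl⟩ := Submodule.mem_sup.1 hv
      have h1 : psymp w x = 0 := hx.1 w hw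
      have h2 : psymp w' x = 0 := hx.2 w' hw'
      change psymp (w + w') x = 0
      rw [psymp_comm, psymp_add_right, psymp_comm x, psymp_comm x, h1, h2, add_zero])

/-- Since `W` is its own orthogonal complement, the intersection on the left is the orthogonal
complement of W + W', whose dimension follows from nondegeneracy. -/
lemma finrank_inf_orthogonal {W W' : Submodule (ZMod 2) (PLabel ι)}
    (hW : ∀ v ∈ W, ∀ w ∈ W, psymp v w = 0) (hd : finrank (ZMod 2) W = Fintype.card ι) :
    finrank (ZMod 2) (W ⊓ (psympForm ι).orthogonal W' : Submodule (ZMod 2) (PLabel ι)) +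
      finrank (ZMod 2) W' =
    Fintype.card ι + finrank (ZMod 2) (W ⊓ W' : Submodule (ZMod 2) (PLabel ι)) := by
  have h1 := finrank_psymp_orthogonal (W ⊔ W')
  rw [orthogonal_sup, orthogonal_eq_self hW hd] at h1
  have h2 := Submodule.finrank_sup_add_finrank_inf_eq W W'
  omega

end Forms

section Parties

variable {N : ℕ} (party : Fin N → Fin 3)

/-- The part of a label on the qubits of the party `a`. -/
def res (a : Fin 3) : PLabel (Fin N) →ₗ[ZMod 2] PLabel {i // party i = a} :=
  LinearMap.funLeft _ _ Subtype.val

/-- Extension by zero of a label on the qubits of the party `a`. -/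
def inj (a : Fin 3) : PLabel {i // party i = a} →ₗ[ZMod 2] PLabel (Fin N) where
  toFun u i := if h : party i = a then u ⟨i, h⟩ else 0
  map_add' u u' := by ext i <;> by_cases h : party i = a <;> simp [h]
  map_smul' c u := by ext i <;> by_cases h : party i = a <;> simp [h]

variable {party}

@[simp] lemma res_apply (a : Fin 3) (v : PLabel (Fin N)) (i : {i // party i = a}) :
    res party a v i = v i := rfl

lemma inj_apply (a : Fin 3) (u : PLabel {i // party i = a}) (i : Fin N) :
    inj party a u i = if h : party i = a then u ⟨i, h⟩ else 0 := rfl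

@[simp] lemma res_inj (a : Fin 3) (u : PLabel {i // party i = a}) :
    res party a (inj party a u) = u := by
  funext i
  rw [res_apply, inj_apply, dif_pos i.2]

lemma res_inj_of_ne {a b : Fin 3} (hab : a ≠ b) (u : PLabel {i // party i = b}) :
    res party a (inj party b u) = 0 := by
  funext i
  rw [res_apply, inj_apply, dif_neg (fun h => hab (i.2.symm.trans h))]
  rfl

lemma ext_res {v w : PLabel (Fin N)} (h : ∀ a, res party a v = res party a w) : v = w := by
  funext i
  exact congrFun (h (party i)) ⟨i, rfl⟩

lemma res_eq_zero_iff {a : Fin 3} {v : PLabel (Fin N)} :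
    res party a v = 0 ↔ ∀ i, party i = a → v i = 0 :=
  ⟨fun h i hi => congrFun h ⟨i, hi⟩, fun h => funext fun i => h i i.2⟩

lemma inj_injective (a : Fin 3) : Function.Injective (inj party a) :=
  Function.LeftInverse.injective (res_inj a)

lemma psymp_eq_sum_res (v w : PLabel (Fin N)) :
    psymp v w = ∑ a, psymp (res party a v) (res party a w) :=
  (Fintype.sum_fiberwise party fun i => qsymp (v i) (w i)).symm

lemma pphase_eq_prod_res (v w : PLabel (Fin N)) :
    pphase v w = ∏ a, pphase (res party a v) (res party a w) :=
  (Fintype.prod_fiberwise party fun i => qphase (v i) (w i)).symm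

lemma psymp_inj (a : Fin 3) (u : PLabel {i // party i = a}) (w : PLabel (Fin N)) :
    psymp (inj party a u) w = psymp u (res party a w) := by
  rw [psymp_eq_sum_res, Finset.sum_eq_single a]
  · rw [res_inj]
  · intro b _ hb
    rw [res_inj_of_ne hb, psymp_comm, psymp_zero_right]
  · simp

/-- Triviality on a party is recast as orthogonality to all strings supported there, so that duality
for Lagrangian subspaces applies. -/
lemma ker_res (a : Fin 3) :
    LinearMap.ker (res party a) =
      (psympForm (Fin N)).orthogonal (LinearMap.range (inj party a)) := by
  ext w
  rw [LinearMap.mem_ker, LinearMap.BilinForm.mem_orthogonal_iff]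
  constructor
  · rintro hw _ ⟨u, rfl⟩
    change psymp _ w = 0
    rw [psymp_inj, hw, psymp_zero_right]
  · intro hw
    by_contra h
    obtain ⟨u, hu⟩ := exists_psymp_ne_zero h
    exact hu (by rw [← psymp_inj]; exact hw _ ⟨u, rfl⟩)

variable (party) in
/-- The labels in `W` that vanish on the party `a`. -/
def avoiding (W : Submodule (ZMod 2) (PLabel (Fin N))) (a : Fin 3) :
    Submodule (ZMod 2) (PLabel (Fin N)) := W ⊓ LinearMap.ker (res party a)

lemma mem_avoiding {W : Submodule (ZMod 2) (PLabel (Fin N))} {a : Fin 3} {v : PLabel (Fin N)} :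
    v ∈ avoiding party W a ↔ v ∈ W ∧ res party a v = 0 := Iff.rfl

lemma eq_inj_of_res_eq_zero {a : Fin 3} {v : PLabel (Fin N)}
    (h : ∀ b, b ≠ a → res party b v = 0) : v = inj party a (res party a v) := by
  refine ext_res (party := party) fun b => ?_
  by_cases hb : b = a
  · subst hb; rw [res_inj]
  · rw [h b hb, res_inj_of_ne hb]

variable (party) in
/-- The labels in `W` that vanish outside the party `a`. -/
def within (W : Submodule (ZMod 2) (PLabel (Fin N))) (a : Fin 3) :
    Submodule (ZMod 2) (PLabel (Fin N)) := W ⊓ LinearMap.range (inj party a)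

lemma mem_within {W : Submodule (ZMod 2) (PLabel (Fin N))} {a : Fin 3} {v : PLabel (Fin N)} :
    v ∈ within party W a ↔ v ∈ W ∧ ∀ b, b ≠ a → res party b v = 0 := by
  refine and_congr_right fun _ => ⟨?_, fun h => ⟨res party a v, (eq_inj_of_res_eq_zero h).symm⟩⟩
  rintro ⟨u, rfl⟩ b hb
  exact res_inj_of_ne hb u

lemma card_parties :
    Fintype.card {i // party i = 0} + Fintype.card {i // party i = 1} +
      Fintype.card {i // party i = 2} = N := by
  have h := Fintype.sum_fiberwise party fun _ => (1 : ℕ)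
  rw [Fin.sum_univ_three] at h
  simpa using h

/-! ### Dimension counts for self-orthogonal label spaces. -/

section Lagrangian

variable {W : Submodule (ZMod 2) (PLabel (Fin N))}

/-- This is `finrank_inf_orthogonal` against the 2|a|-dimensional space of strings on party `a`; it
reflects that complementary regions of a pure state have equal entropy. -/
lemma finrank_avoiding (hW : ∀ v ∈ W, ∀ w ∈ W, psymp v w = 0)
    (hd : finrank (ZMod 2) W = N) (a : Fin 3) :
    finrank (ZMod 2) (avoiding party W a) + 2 * Fintype.card {i // party i = a} =
      N + finrank (ZMod 2) (within party W a) := by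
  have h := finrank_inf_orthogonal (W' := LinearMap.range (inj party a)) hW
    (by rw [hd, Fintype.card_fin])
  rw [LinearMap.finrank_range_of_inj (inj_injective a), finrank_plabel, ← ker_res,
    Fintype.card_fin] at h
  exact h

/-- The radical of the commutation form of the first party on the labels vanishing on the third. -/
lemma finrank_radical (hW : ∀ v ∈ W, ∀ w ∈ W, psymp v w = 0)
    (hd : finrank (ZMod 2) W = N) :
    finrank (ZMod 2) (avoiding party W 2 ⊓
      (W ⊓ (psympForm (Fin N)).orthogonal
        ((avoiding party W 2).map (inj party 0 ∘ₗ res party 0))) :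
          Submodule (ZMod 2) (PLabel (Fin N))) +
      finrank (ZMod 2) (avoiding party W 2 ⊔ avoiding party W 0 ⊔ avoiding party W 1 :
        Submodule (ZMod 2) (PLabel (Fin N))) =
    N + finrank (ZMod 2) (within party W 0) + finrank (ZMod 2) (within party W 1) := by
  set K := avoiding party W
  set Q := (K 2).map (inj party 0 ∘ₗ res party 0) with hQ
  set T := W ⊓ (psympForm (Fin N)).orthogonal Q with hT
  have hwi : ∀ v, ∀ a b c : Fin 3, (∀ d, d ≠ a ↔ d = b ∨ d = c) →
      (v ∈ within party W a ↔ v ∈ W ∧ res party b v = 0 ∧ res party c v = 0) := by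
    intro v a b c h
    rw [mem_within]
    refine and_congr_right fun _ => ⟨fun h' => ⟨h' b ((h b).2 (Or.inl rfl)),
      h' c ((h c).2 (Or.inr rfl))⟩, fun h' d hd => ?_⟩
    rcases (h d).1 hd with rfl | rfl
    exacts [h'.1, h'.2]
  have e0 : W ⊓ Q = within party W 0 := by
    ext v
    rw [hwi v 0 1 2 (by decide)]
    constructor
    · rintro ⟨hv, u, hu, rfl⟩
      exact ⟨hv, res_inj_of_ne (by decide) _, res_inj_of_ne (by decide) _⟩
    · rintro ⟨hv, h1, h2⟩
      refine ⟨hv, v, ⟨hv, h2⟩, ?_⟩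
      exact (eq_inj_of_res_eq_zero (fun b hb => by fin_cases b <;> simp_all)).symm
  have e1 : K 2 ⊓ LinearMap.ker (inj party 0 ∘ₗ res party 0) = within party W 1 := by
    ext v
    rw [hwi v 1 0 2 (by decide)]
    have : v ∈ LinearMap.ker (inj party 0 ∘ₗ res party 0) ↔ res party 0 v = 0 := by
      rw [LinearMap.mem_ker, LinearMap.comp_apply, map_eq_zero_iff _ (inj_injective 0)]
    rw [Submodule.mem_inf, this, mem_avoiding]
    tauto
  have e2 : K 0 ⊓ K 1 = within party W 2 := by
    ext v
    rw [hwi v 2 0 1 (by decide), Submodule.mem_inf, mem_avoiding, mem_avoiding]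
    tauto
  have d0 : finrank (ZMod 2) (K 0) + _ = _ := finrank_avoiding (party := party) hW hd 0
  have d1 : finrank (ZMod 2) (K 1) + _ = _ := finrank_avoiding (party := party) hW hd 1
  have d2 : finrank (ZMod 2) (K 2) + _ = _ := finrank_avoiding (party := party) hW hd 2
  have dN := card_parties (party := party)
  have dT := finrank_inf_orthogonal (W' := Q) hW (by rw [hd, Fintype.card_fin])
  rw [e0, Fintype.card_fin, ← hT] at dT
  have dQ := finrank_map_add_finrank_ker_inf (inj party 0 ∘ₗ res party 0) (K 2)
  rw [e1, ← hQ] at dQ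
  have dS := Submodule.finrank_sup_add_finrank_inf_eq (K 0) (K 1)
  rw [e2] at dS
  -- Let x be in `K 2`. If y vanishes on party 0, the pairing there is trivial. If y vanishes on
  -- party 1, the total pairing of x and y is 0 and only party 0 contributes to it.
  have hle : K 0 ⊔ K 1 ≤ T := by
    refine sup_le (fun y hy => ⟨hy.1, ?_⟩) (fun y hy => ⟨hy.1, ?_⟩)
    · rintro _ ⟨x, hx, rfl⟩
      change psymp (inj party 0 (res party 0 x)) y = 0
      rw [psymp_inj, (mem_avoiding.1 hy).2, psymp_zero_right]
    · rintro _ ⟨x, hx, rfl⟩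
      change psymp (inj party 0 (res party 0 x)) y = 0
      have h := hW x hx.1 y hy.1
      rw [psymp_eq_sum_res (party := party), Fin.sum_univ_three, (mem_avoiding.1 hy).2,
        (mem_avoiding.1 hx).2, psymp_zero_right, psymp_comm 0, psymp_zero_right, add_zero,
        add_zero] at h
      rw [psymp_inj, h]
  -- Both dimensions are known from the duality counts, and they agree. The radical is thus K 2 ⊓ (K
  -- 0 ⊔ K 1), and the dimension formula for a sum brings in all three subspaces.
  have hTeq : K 0 ⊔ K 1 = T := by
    refine Submodule.eq_of_le_of_finrank_eq hle ?_
    omega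
  have dF := Submodule.finrank_sup_add_finrank_inf_eq (K 2) T
  rw [← hTeq, ← sup_assoc] at dF
  rw [← hTeq]
  omega

end Lagrangian

variable (party) in
/-- The label which is given on the first two parties and vanishes on the third. -/
def extAB : PLabel {i // party i = 0} × PLabel {i // party i = 1} →ₗ[ZMod 2] PLabel (Fin N) :=
  (inj party 0).coprod (inj party 1)

lemma extAB_apply (u : PLabel {i // party i = 0} × PLabel {i // party i = 1}) :
    extAB party u = inj party 0 u.1 + inj party 1 u.2 := rfl

@[simp] lemma res_zero_extAB (u : PLabel {i // party i = 0} × PLabel {i // party i = 1}) :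
    res party 0 (extAB party u) = u.1 := by
  rw [extAB_apply, map_add, res_inj, res_inj_of_ne (by decide), add_zero]

@[simp] lemma res_one_extAB (u : PLabel {i // party i = 0} × PLabel {i // party i = 1}) :
    res party 1 (extAB party u) = u.2 := by
  rw [extAB_apply, map_add, res_inj, res_inj_of_ne (by decide), zero_add]

@[simp] lemma res_two_extAB (u : PLabel {i // party i = 0} × PLabel {i // party i = 1}) :
    res party 2 (extAB party u) = 0 := by
  rw [extAB_apply, map_add, res_inj_of_ne (by decide), res_inj_of_ne (by decide), zero_add]

lemma extAB_res {v : PLabel (Fin N)} (h : res party 2 v = 0) :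
    extAB party (res party 0 v, res party 1 v) = v := by
  refine ext_res (party := party) fun a => ?_
  fin_cases a
  · exact res_zero_extAB _
  · exact res_one_extAB _
  · exact (res_two_extAB _).trans h.symm

lemma extAB_injective : Function.Injective (extAB party) := fun u u' h =>
  Prod.ext (by rw [← res_zero_extAB u, h, res_zero_extAB])
    (by rw [← res_one_extAB u, h, res_one_extAB])

variable (W : Submodule (ZMod 2) (PLabel (Fin N)))

lemma map_extAB_comap : (W.comap (extAB party)).map (extAB party) = avoiding party W 2 := by
  ext v
  constructor
  · rintro ⟨u, hu, rfl⟩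
    exact ⟨hu, res_two_extAB u⟩
  · rintro ⟨hv, h2⟩
    have := extAB_res (party := party) h2
    exact ⟨_, by rw [SetLike.mem_coe, Submodule.mem_comap, this]; exact hv, this⟩

lemma map_extAB_localA :
    (localA (W.comap (extAB party))).map (extAB party) = within party W 0 := by
  ext v
  rw [mem_within]
  constructor
  · rintro ⟨u, hu, rfl⟩
    refine ⟨hu.1, fun b hb => ?_⟩
    fin_cases b
    · exact absurd rfl hb
    · exact (res_one_extAB u).trans (mem_localA.1 hu).2
    · exact res_two_extAB u
  · rintro ⟨hv, h⟩
    have := extAB_res (party := party) (h 2 (by decide))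
    exact ⟨(res party 0 v, res party 1 v), ⟨by
      rw [SetLike.mem_coe, Submodule.mem_comap, this]; exact hv, h 1 (by decide)⟩, this⟩

lemma map_extAB_localB :
    (localB (W.comap (extAB party))).map (extAB party) = within party W 1 := by
  ext v
  rw [mem_within]
  constructor
  · rintro ⟨u, hu, rfl⟩
    refine ⟨hu.1, fun b hb => ?_⟩
    fin_cases b
    · exact (res_zero_extAB u).trans (mem_localB.1 hu).2
    · exact absurd rfl hb
    · exact res_two_extAB u
  · rintro ⟨hv, h⟩
    have := extAB_res (party := party) (h 2 (by decide))
    exact ⟨(res party 0 v, res party 1 v), ⟨by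
      rw [SetLike.mem_coe, Submodule.mem_comap, this]; exact hv, h 0 (by decide)⟩, this⟩

/-- Pairing on the first party alone is the global pairing with the part of a label on that party
extended by zero, which is the form used in `finrank_radical`. -/
lemma map_extAB_radical :
    (W.comap (extAB party) ⊓ (formA _ _).orthogonal (W.comap (extAB party))).map (extAB party) =
      avoiding party W 2 ⊓ (W ⊓ (psympForm (Fin N)).orthogonal
        ((avoiding party W 2).map (inj party 0 ∘ₗ res party 0))) := by
  ext v
  constructor
  · rintro ⟨u, hu, rfl⟩
    refine ⟨⟨hu.1, res_two_extAB u⟩, hu.1, ?_⟩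
    rintro _ ⟨x, hx, rfl⟩
    change psymp (inj party 0 (res party 0 x)) _ = 0
    rw [psymp_inj, res_zero_extAB]
    have hx' := extAB_res (party := party) hx.2
    exact hu.2 (res party 0 x, res party 1 x) (by rw [Submodule.mem_comap, hx']; exact hx.1)
  · rintro ⟨⟨hv, h2⟩, -, h⟩
    have := extAB_res (party := party) h2
    refine ⟨(res party 0 v, res party 1 v), ⟨by
      rw [SetLike.mem_coe, Submodule.mem_comap, this]; exact hv, ?_⟩, this⟩
    intro x hx
    have h' := h (inj party 0 x.1) ⟨extAB party x, ⟨hx, res_two_extAB x⟩, by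
      rw [LinearMap.comp_apply, res_zero_extAB]⟩
    change psymp x.1 (res party 0 v) = 0
    rw [← psymp_inj]
    exact h'

end Parties

/-! ### The reduced density matrix of a stabilizer state -/

open Module

section Reduced

variable {N : ℕ} {ψ : (Fin N → Fin 2) → ℂ} {party : Fin N → Fin 3}
  {G : Subgroup (QubitUnitary N)}

variable (party G) in
/-- The labels, on the first two parties, of the stabilizers that are trivial on the third. -/
def labelsAB : Submodule (ZMod 2) (PLabel {i // party i = 0} × PLabel {i // party i = 1}) :=
  (labels G).comap (extAB party)

variable (party G) in
/-- The signs of the stabilizers that are trivial on the third party. -/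
def signAB (u : PLabel {i // party i = 0} × PLabel {i // party i = 1}) : ℂ :=
  stabSign G (extAB party u)

lemma IsStabGroup.isPhase (h : IsStabGroup ψ G) : IsPhase (labelsAB party G) (signAB party G) where
  one_or _ hv := h.stabSign_cases hv
  add v hv w hw := by
    rw [signAB, map_add, h.stabSign_add hv hw, pphase_eq_prod_res (party := party),
      Fin.prod_univ_three, res_zero_extAB, res_zero_extAB, res_one_extAB, res_one_extAB,
      res_two_extAB, res_two_extAB, pphase_zero_right, mul_one]
    rfl

lemma pmat_grouped (v : PLabel (Fin N)) (x y : ∀ a, Block party a) :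
    pmat v (fun i => x (party i) ⟨i, rfl⟩) (fun i => y (party i) ⟨i, rfl⟩) =
      ∏ a, pmat (res party a v) (x a) (y a) := by
  simp only [pmat_apply]
  rw [← Fintype.prod_fiberwise party]
  refine Finset.prod_congr rfl fun a _ => Finset.prod_congr rfl fun i _ => ?_
  obtain ⟨i, rfl⟩ := i
  rfl

/-- Tracing out the third party kills every string nontrivial there and multiplies the others by 2
to the number of its qubits, which adjusts the normalization. -/
lemma IsStabilizerState.rhoAB_eq (h : IsStabilizerState ψ G) :
    rhoAB (grouped party ψ) =
      ((2 : ℝ) ^ (Fintype.card {i // party i = 0} + Fintype.card {i // party i = 1}))⁻¹ •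
        groupSum (labelsAB party G) (signAB party G) := by
  ext x y
  rw [Matrix.smul_apply]
  simp only [rhoAB, Matrix.of_apply, grouped, h.mul_conj_eq, groupSum]
  simp only [pmat_grouped, Fin.prod_univ_three]
  rw [← Finset.mul_sum, Finset.sum_comm]
  have key : ∀ v : PLabel (Fin N), ∑ c : Block party 2, stabSign G v *
      (pmat (res party 0 v) (triple x.1 x.2 c 0) (triple y.1 y.2 c 0) *
        pmat (res party 1 v) (triple x.1 x.2 c 1) (triple y.1 y.2 c 1) *
        pmat (res party 2 v) (triple x.1 x.2 c 2) (triple y.1 y.2 c 2)) =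
      if res party 2 v = 0 then (2 : ℂ) ^ Fintype.card {i // party i = 2} *
        (stabSign G v * (pmat (res party 0 v) x.1 y.1 * pmat (res party 1 v) x.2 y.2)) else 0 := by
    intro v
    have h1 : ∀ c : Block party 2, stabSign G v *
      (pmat (res party 0 v) (triple x.1 x.2 c 0) (triple y.1 y.2 c 0) *
        pmat (res party 1 v) (triple x.1 x.2 c 1) (triple y.1 y.2 c 1) *
        pmat (res party 2 v) (triple x.1 x.2 c 2) (triple y.1 y.2 c 2)) =
        stabSign G v * (pmat (res party 0 v) x.1 y.1 * pmat (res party 1 v) x.2 y.2) *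
          pmat (res party 2 v) c c := fun c => by rw [mul_assoc (stabSign G v)]; rfl
    simp only [h1]
    rw [← Finset.mul_sum]
    have h2 : ∑ c : Block party 2, pmat (res party 2 v) c c = (pmat (res party 2 v)).trace := rfl
    rw [h2, pmat_trace]
    split_ifs
    · rw [mul_comm]
    · rw [mul_zero]
  rw [Finset.sum_congr rfl fun v _ => key v, ← Finset.sum_filter, ← Finset.mul_sum, ← mul_assoc]
  have hsum : ∑ v ∈ (elems (labels G)).filter (fun v => res party 2 v = 0),
      stabSign G v * (pmat (res party 0 v) x.1 y.1 * pmat (res party 1 v) x.2 y.2) =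
      ∑ u ∈ elems (labelsAB party G), signAB party G u * (pmat u.1 x.1 y.1 * pmat u.2 x.2 y.2) := by
    refine Finset.sum_nbij' (fun v => (res party 0 v, res party 1 v)) (extAB party) ?_ ?_ ?_ ?_ ?_
    · intro v hv
      rw [Finset.mem_filter, mem_elems] at hv
      rw [mem_elems, labelsAB, Submodule.mem_comap, extAB_res hv.2]
      exact hv.1
    · intro u hu
      rw [Finset.mem_filter, mem_elems]
      exact ⟨Submodule.mem_comap.1 (mem_elems.1 hu), res_two_extAB u⟩
    · intro v hv
      exact extAB_res (Finset.mem_filter.1 hv).2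
    · intro u _
      exact Prod.ext (res_zero_extAB u) (res_one_extAB u)
    · intro v hv
      rw [signAB, extAB_res (Finset.mem_filter.1 hv).2]
  rw [hsum, Complex.real_smul]
  congr 1
  have hN : (2 : ℂ) ^ N = 2 ^ (Fintype.card {i // party i = 0} + Fintype.card {i // party i = 1}) *
      2 ^ Fintype.card {i // party i = 2} := by rw [← pow_add, card_parties]
  have : ((2 : ℂ) ^ Fintype.card {i // party i = 2}) ≠ 0 := pow_ne_zero _ two_ne_zero
  rw [hN, mul_inv, mul_assoc, inv_mul_cancel₀ this, mul_one]
  push_cast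
  rfl

lemma labelsOn_eq_avoiding (a b c : Fin 3) (h : ∀ d, d = c ↔ ¬ (d = a ∨ d = b)) :
    labelsOn G {i | party i = a ∨ party i = b} = avoiding party (labels G) c := by
  ext v
  rw [mem_labelsOn, mem_avoiding, res_eq_zero_iff]
  simp only [Set.mem_ofPred_eq, h]

lemma labelsOn_eq_within (a : Fin 3) :
    labelsOn G {i | party i = a} = within party (labels G) a := by
  ext v
  rw [mem_labelsOn, mem_within]
  simp only [Set.mem_ofPred_eq, res_eq_zero_iff]
  refine and_congr_right fun _ => ⟨fun h b hb i hi => h i (by rw [hi]; exact hb),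
    fun h i hi => h _ hi i rfl⟩

lemma finrank_labelsAB :
    finrank (ZMod 2) (labelsAB party G) = finrank (ZMod 2) (avoiding party (labels G) 2) := by
  rw [← map_extAB_comap, finrank_map_of_injective extAB_injective]; rfl

lemma finrank_localA_labelsAB :
    finrank (ZMod 2) (localA (labelsAB party G)) =
      finrank (ZMod 2) (within party (labels G) 0) := by
  rw [← map_extAB_localA, finrank_map_of_injective extAB_injective]; rfl

lemma finrank_localB_labelsAB :
    finrank (ZMod 2) (localB (labelsAB party G)) =
      finrank (ZMod 2) (within party (labels G) 1) := by
  rw [← map_extAB_localB, finrank_map_of_injective extAB_injective]; rfl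

/-- The reflected entropy of a stabilizer state. -/
theorem IsStabilizerState.reflectedEntropy_eq (h : IsStabilizerState ψ G) :
    reflectedEntropy (grouped party ψ) =
      Real.logb 2 ((Nat.card (avoiding party (labels G) 2) : ℝ) /
        ((Nat.card (within party (labels G) 0) : ℝ) *
          (Nat.card (within party (labels G) 1) : ℝ))) := by
  have := vonNeumann_realigned (h.isStabGroup.isPhase (party := party)) h.rhoAB_eq
  simp only [card_eq_two_pow, finrank_labelsAB, finrank_localA_labelsAB,
    finrank_localB_labelsAB] at this
  simp only [card_eq_two_pow]
  exact this

end Reduced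

/-! ### The replica contraction -/

section Replica

variable {H : Fin 3 → Type} [∀ a, Fintype (H a)] [∀ a, DecidableEq (H a)] {n : ℕ} [NeZero n]

variable (n) in
/-- Coordinates of the lattice in which the steps `e₂ - e₀` and `e₂ - e₁` are the generators of the
torus `(ℤ/n)²`. -/
def latticeEquiv : ZMod n × (ZMod n × ZMod n) ≃ (Fin 3 → ZMod n) where
  toFun p := ![-p.2.1, -p.2.2, p.1 + p.2.1 + p.2.2]
  invFun r := (r 0 + r 1 + r 2, (-r 0, -r 1))
  left_inv p := by
    obtain ⟨l, i, j⟩ := p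
    refine Prod.ext ?_ (Prod.ext ?_ ?_)
    · change -i + -j + (l + i + j) = l; ring
    · exact neg_neg i
    · exact neg_neg j
  right_inv r := by
    funext a
    fin_cases a
    · exact neg_neg (r 0)
    · exact neg_neg (r 1)
    · change r 0 + r 1 + r 2 + -r 0 + -r 1 = r 2; ring

/-- The conjugate at r + e₂ reads the first party's label at r + e₂ − e₀. This stays in the same
layer, as the sum of the coordinates is unchanged. -/
lemma latticeEquiv_shiftA (l : ZMod n) (x : ZMod n × ZMod n) :
    latticeEquiv n (l, x) + Pi.single 2 1 - Pi.single 0 1 = latticeEquiv n (l, shiftA n x) := by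
  obtain ⟨i, j⟩ := x
  rw [shiftA_apply]
  funext a
  fin_cases a
  · change -i + 0 - 1 = -(i + 1); ring
  · change -j + 0 - 0 = -j; ring
  · change l + i + j + 1 - 0 = l + (i + 1) + j; ring

lemma latticeEquiv_shiftB (l : ZMod n) (x : ZMod n × ZMod n) :
    latticeEquiv n (l, x) + Pi.single 2 1 - Pi.single 1 1 = latticeEquiv n (l, shiftB n x) := by
  obtain ⟨i, j⟩ := x
  rw [shiftB_apply]
  funext a
  fin_cases a
  · change -i + 0 - 0 = -i; ring
  · change -j + 0 - 1 = -(j + 1); ring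
  · change l + i + j + 1 - 0 = l + i + (j + 1); ring

lemma eq_triple (f : ∀ a, H a) : f = triple (f 0) (f 1) (f 2) := by
  funext a
  fin_cases a <;> rfl

/-- Labels on the lattice, as labels on the layers. -/
def layersEquiv : (ZMod n → (ZMod n × ZMod n → H 0) × (ZMod n × ZMod n → H 1) ×
    (ZMod n × ZMod n → H 2)) ≃ ((Fin 3 → ZMod n) → ∀ a, H a) where
  toFun K r := triple ((K ((latticeEquiv n).symm r).1).1 ((latticeEquiv n).symm r).2)
    ((K ((latticeEquiv n).symm r).1).2.1 ((latticeEquiv n).symm r).2)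
    ((K ((latticeEquiv n).symm r).1).2.2 ((latticeEquiv n).symm r).2)
  invFun k l := (fun x => k (latticeEquiv n (l, x)) 0, fun x => k (latticeEquiv n (l, x)) 1,
    fun x => k (latticeEquiv n (l, x)) 2)
  left_inv K := by
    funext l
    refine Prod.ext (funext fun x => ?_) (Prod.ext (funext fun x => ?_) (funext fun x => ?_)) <;>
    simp only [Equiv.symm_apply_apply] <;> rfl
  right_inv k := by
    funext r
    simp only [Prod.mk.eta, Equiv.apply_symm_apply]
    exact (eq_triple (k r)).symm

lemma layersEquiv_apply (K : ZMod n → (ZMod n × ZMod n → H 0) × (ZMod n × ZMod n → H 1) ×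
    (ZMod n × ZMod n → H 2)) (l : ZMod n) (x : ZMod n × ZMod n) :
    layersEquiv K (latticeEquiv n (l, x)) = triple ((K l).1 x) ((K l).2.1 x) ((K l).2.2 x) := by
  simp only [layersEquiv, Equiv.coe_fn_mk, Equiv.symm_apply_apply]

/-- Translating only `g` leaves its full product unchanged. The translation is by e₂, which brings
together the two tensors that share a leg of the third party. -/
lemma prod_lattice (f g : (Fin 3 → ZMod n) → ℂ) :
    ∏ r, f r * g r = ∏ l : ZMod n, ∏ x : ZMod n × ZMod n,
      f (latticeEquiv n (l, x)) * g (latticeEquiv n (l, x) + Pi.single 2 1) := by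
  rw [Finset.prod_mul_distrib, ← Equiv.prod_comp (Equiv.addRight (Pi.single 2 1)) g,
    ← Finset.prod_mul_distrib, ← Equiv.prod_comp (latticeEquiv n), Fintype.prod_prod_type]
  rfl

/-- The replica contraction is a product of equal contractions of `ρ_AB`, one for each layer. -/
theorem replicaZ_eq_pow (ψ : (∀ a, H a) → ℂ) :
    replicaZ ψ n = (∑ a : ZMod n × ZMod n → H 0, ∑ b : ZMod n × ZMod n → H 1,
      ∏ x, rhoAB ψ (a x, b x) (a (shiftA n x), b (shiftB n x))) ^ n := by
  set Φ : (ZMod n × ZMod n → H 0) × (ZMod n × ZMod n → H 1) × (ZMod n × ZMod n → H 2) → ℂ :=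
    fun t => ∏ x, ψ (triple (t.1 x) (t.2.1 x) (t.2.2 x)) *
      conj (ψ (triple (t.1 (shiftA n x)) (t.2.1 (shiftB n x)) (t.2.2 x))) with hΦ
  have h1 : ∀ k : (Fin 3 → ZMod n) → ∀ a, H a,
      ∏ r : Fin 3 → ZMod n, ψ (k r) * conj (ψ fun a => k (r - Pi.single a 1) a) =
      ∏ l : ZMod n, ∏ x : ZMod n × ZMod n, ψ (k (latticeEquiv n (l, x))) *
        conj (ψ fun a => k (latticeEquiv n (l, x) + Pi.single 2 1 - Pi.single a 1) a) := by
    exact fun k => prod_lattice (fun r => ψ (k r)) (fun r => conj (ψ fun a => k (r - Pi.single a 1) a))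
  have h2 : ∀ K : ZMod n → (ZMod n × ZMod n → H 0) × (ZMod n × ZMod n → H 1) ×
      (ZMod n × ZMod n → H 2),
      ∏ r : Fin 3 → ZMod n, ψ (layersEquiv K r) *
        conj (ψ fun a => layersEquiv K (r - Pi.single a 1) a) = ∏ l, Φ (K l) := by
    intro K
    rw [h1]
    refine Finset.prod_congr rfl fun l _ => Finset.prod_congr rfl fun x _ => ?_
    refine congrArg₂ (· * ·) (congrArg ψ (layersEquiv_apply K l x)) (congrArg (fun y => conj (ψ y)) ?_)
    funext a
    fin_cases a
    · exact (congrArg (fun r => layersEquiv K r 0) (latticeEquiv_shiftA l x)).trans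
        (congrFun (layersEquiv_apply K l (shiftA n x)) 0)
    · exact (congrArg (fun r => layersEquiv K r 1) (latticeEquiv_shiftB l x)).trans
        (congrFun (layersEquiv_apply K l (shiftB n x)) 1)
    · exact (congrArg (fun r => layersEquiv K r 2) (add_sub_cancel_right _ _)).trans
        (congrFun (layersEquiv_apply K l x) 2)
  rw [replicaZ, ← Equiv.sum_comp layersEquiv, Finset.sum_congr rfl fun K _ => h2 K,
    ← Fintype.prod_sum (fun (_ : ZMod n) t => Φ t), Finset.prod_const, Finset.card_univ,
    ZMod.card]
  congr 1
  rw [Fintype.sum_prod_type]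
  refine Finset.sum_congr rfl fun a _ => ?_
  rw [Fintype.sum_prod_type]
  refine Finset.sum_congr rfl fun b _ => ?_
  -- The third party's label now occurs at a single site each, so the sum over it factorizes into
  -- entries of ρ_AB.
  simp only [rhoAB, Matrix.of_apply]
  rw [Fintype.prod_sum]

end Replica

section Contraction

variable {ιA ιB : Type} [Fintype ιA] [DecidableEq ιA] [Fintype ιB] [DecidableEq ιB]
  {S : Submodule (ZMod 2) (PLabel ιA × PLabel ιB)} {ph : PLabel ιA × PLabel ιB → ℂ}
  {X : Type} [Fintype X] [DecidableEq X]

open Classical in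
/-- Contractions of a sum of Pauli strings expand into contractions of Pauli strings. -/
lemma sum_prod_groupSum (s t : Equiv.Perm X) :
    ∑ a : X → ιA → Fin 2, ∑ b : X → ιB → Fin 2,
      ∏ x, groupSum S ph (a x, b x) (a (s x), b (t x)) =
    ∑ q : X → S, amp ph s t (fun r => (q r : PLabel ιA × PLabel ιB)) := by
  have h1 : ∀ x y, groupSum S ph x y =
      ∑ v : S, ph v * (pmat v.1.1 x.1 y.1 * pmat v.1.2 x.2 y.2) := fun x y => by
    rw [groupSum, Matrix.of_apply]
    exact Finset.sum_subtype _ (fun v => mem_elems) _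
  simp only [h1]
  simp only [Fintype.prod_sum]
  simp only [Finset.sum_comm (t := (Finset.univ : Finset (X → S)))]
  refine Finset.sum_congr rfl fun q _ => ?_
  rw [amp, cyc, cyc, Finset.sum_mul_sum]
  simp only [Finset.mul_sum, Finset.prod_mul_distrib]

end Contraction

/-! ### The multi-entropy -/

open Module

section MultiEntropy

lemma logb_two_pow_div (i j : ℕ) : Real.logb 2 ((2 : ℝ) ^ i / 2 ^ j) = i - j := by
  rw [Real.logb_div (by positivity) (by positivity), Real.logb_pow, Real.logb_pow,
    Real.logb_self_eq_one one_lt_two, mul_one, mul_one]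

variable {N : ℕ} {ψ : (Fin N → Fin 2) → ℂ} {party : Fin N → Fin 3}
  {G : Subgroup (QubitUnitary N)}
  {L L' : Submodule (ZMod 2) (PLabel {i // party i = 0} × PLabel {i // party i = 1})}

-- The numerator is the torus sum. The denominator collects the normalization of ρ_AB at the n²
-- sites of a layer, and the outer power counts the layers.
open Classical in
set_option synthInstance.maxSize 1000 in
lemma IsStabilizerState.replicaZ_eq (h : IsStabilizerState ψ G)
    (D : Splitting (labelsAB party G) L L' (localA (labelsAB party G)) (localB (labelsAB party G)))
    (n : ℕ) [NeZero n] :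
    replicaZ (grouped party ψ) n =
      (((2 : ℝ) ^ (finrank (ZMod 2) (localA (labelsAB party G)) * (n - 1) * n +
          finrank (ZMod 2) (localB (labelsAB party G)) * (n - 1) * n +
          (finrank (ZMod 2) L * (n - 1) * (n - 1) + finrank (ZMod 2) L' * (n - 1)) +
          (Fintype.card {i // party i = 0} + Fintype.card {i // party i = 1}) * n) /
        2 ^ ((Fintype.card {i // party i = 0} + Fintype.card {i // party i = 1}) * (n * n))) ^ n :
          ℝ) := by
  rw [replicaZ_eq_pow]
  push_cast
  congr 1
  have h1 := sum_prod_groupSum (S := labelsAB party G) (ph := signAB party G) (shiftA n) (shiftB n)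
  have h2 := D.sum_amp_torus (n := n) h.isStabGroup.isPhase
  have h3 := h1.trans (by convert h2)
  rw [h.rhoAB_eq]
  simp only [Matrix.smul_apply, Complex.real_smul, Finset.prod_mul_distrib, Finset.prod_const,
    Finset.card_univ, Fintype.card_prod, ZMod.card]
  simp only [← Finset.mul_sum]
  rw [show (∑ a : ZMod n × ZMod n → Block party 0, ∑ b : ZMod n × ZMod n → Block party 1,
    ∏ x, groupSum (labelsAB party G) (signAB party G) (a x, b x) (a (shiftA n x), b (shiftB n x)))
      = _ from h3]
  simp only [card_eq_two_pow]
  push_cast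
  rw [div_eq_inv_mul, inv_pow, ← pow_mul, pow_add, pow_add, pow_add, pow_add]
  simp only [← pow_mul]

/-- The replica contraction is a positive real, so the complex logarithm is the real one. Its
exponent contains the factor n(n − 1), the normalization cancels it, and what remains is affine in
`n`. -/
lemma IsStabilizerState.renyiMulti_eq (h : IsStabilizerState ψ G)
    (D : Splitting (labelsAB party G) L L' (localA (labelsAB party G)) (localB (labelsAB party G)))
    (n : ℕ) [NeZero n] (hn : 2 ≤ n) :
    renyiMulti (grouped party ψ) n =
      (((Fintype.card {i // party i = 0} + Fintype.card {i // party i = 1} : ℝ) -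
        finrank (ZMod 2) (localA (labelsAB party G)) -
        finrank (ZMod 2) (localB (labelsAB party G)) - finrank (ZMod 2) L : ℝ) : ℂ) * n +
      ((finrank (ZMod 2) L - finrank (ZMod 2) L' : ℝ) : ℂ) := by
  rw [renyiMulti, h.replicaZ_eq D]
  obtain ⟨m, rfl⟩ : ∃ m, n = m + 1 := ⟨n - 1, by omega⟩
  have hm : (m : ℂ) ≠ 0 := by
    rw [Nat.cast_ne_zero]; omega
  have hm1 : (m : ℂ) + 1 ≠ 0 := by exact_mod_cast Nat.succ_ne_zero m
  have hlog : Complex.log 2 = ((Real.log 2 : ℝ) : ℂ) := by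
    rw [Complex.ofReal_log (by norm_num)]; norm_num
  have hlog0 : ((Real.log 2 : ℝ) : ℂ) ≠ 0 := by
    exact_mod_cast (Real.log_pos one_lt_two).ne'
  rw [← Complex.ofReal_log (by positivity), Real.log_pow,
    Real.log_div (by positivity) (by positivity), Real.log_pow, Real.log_pow, hlog,
    Nat.add_sub_cancel, ← sub_mul]
  push_cast
  have h0 : (1 - ((m : ℂ) + 1)) ≠ 0 := by
    rw [sub_add_cancel_right]; exact neg_ne_zero.2 hm
  field_simp
  ring

/-- The multi-entropy of a stabilizer state. -/
theorem IsStabilizerState.isMultiEntropy_iff (h : IsStabilizerState ψ G) (x : ℝ) :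
    IsMultiEntropy (grouped party ψ) x ↔
      x = 1 / 2 * Real.logb 2 ((Nat.card (labels G) : ℝ) /
            (Nat.card (within party (labels G) 0) * Nat.card (within party (labels G) 1) *
              Nat.card (within party (labels G) 2))) +
          1 / 2 * Real.logb 2 ((Nat.card (labels G) : ℝ) /
            Nat.card (avoiding party (labels G) 2 ⊔ avoiding party (labels G) 0 ⊔
              avoiding party (labels G) 1 : Submodule (ZMod 2) (PLabel (Fin N)))) := by
  have hW : ∀ v ∈ labels G, ∀ w ∈ labels G, psymp v w = 0 :=
    fun v hv w hw => h.isStabGroup.psymp_eq_zero hv hw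
  obtain ⟨L, L', ⟨D⟩, hd1, hd2⟩ := exists_splitting (h.isStabGroup.isPhase (party := party))
  rw [isMultiEntropy_iff_of_affine fun n _ hn => h.renyiMulti_eq D n hn]
  have hrad : finrank (ZMod 2) (labelsAB party G ⊓ (formA _ _).orthogonal (labelsAB party G) :
      Submodule (ZMod 2) (PLabel {i // party i = 0} × PLabel {i // party i = 1})) = _ :=
    (finrank_map_of_injective extAB_injective _).symm.trans
      (congrArg (fun W : Submodule (ZMod 2) (PLabel (Fin N)) => finrank (ZMod 2) W)
        (map_extAB_radical (party := party) (labels G)))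
  have hr := finrank_radical (party := party) hW h.finrank_labels
  have hk := finrank_avoiding (party := party) hW h.finrank_labels 2
  have hN := card_parties (party := party)
  rw [← hrad] at hr
  rw [finrank_labelsAB, finrank_localA_labelsAB, finrank_localB_labelsAB] at hd1
  rw [finrank_localA_labelsAB, finrank_localB_labelsAB] at hd2
  rw [finrank_localA_labelsAB, finrank_localB_labelsAB]
  simp only [card_eq_two_pow, Nat.cast_pow, Nat.cast_ofNat, ← pow_add]
  rw [logb_two_pow_div, logb_two_pow_div, h.finrank_labels]
  -- The value at 1 is |A| + |B| − dim S_A − dim S_B − dim L'. The two splitting identities give 2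
  -- dim L' = dim S − dim(radical); the radical count and the duality count for party 2 turn this
  -- into the stated ranks.
  refine Eq.congr_right ?_
  zify at hd1 hd2 hr hk hN
  have hd1' := congrArg (Int.cast : ℤ → ℝ) hd1
  have hd2' := congrArg (Int.cast : ℤ → ℝ) hd2
  have hr' := congrArg (Int.cast : ℤ → ℝ) hr
  have hk' := congrArg (Int.cast : ℤ → ℝ) hk
  have hN' := congrArg (Int.cast : ℤ → ℝ) hN
  push_cast at hd1' hd2' hr' hk' hN' ⊢
  linarith

end MultiEntropy

end StabEntropy
end

/-! ### The two entropy formulas in terms of subgroup orders. -/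

open StabEntropy in
theorem mainTheorem2 (N : ℕ) (ψ : (Fin N → Fin 2) → ℂ) (G : Subgroup (QubitUnitary N))
    (hψ : IsStabilizerState ψ G) (party : Fin N → Fin 3)
    (GA GB GC GAB GBC GAC : Set (QubitUnitary N))
    (hA : GA = supportedOn G {i | party i = 0})
    (hB : GB = supportedOn G {i | party i = 1})
    (hC : GC = supportedOn G {i | party i = 2})
    (hAB : GAB = supportedOn G {i | party i = 0 ∨ party i = 1})
    (hBC : GBC = supportedOn G {i | party i = 1 ∨ party i = 2})
    (hAC : GAC = supportedOn G {i | party i = 0 ∨ party i = 2}) :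
    reflectedEntropy (grouped party ψ) =
        Real.logb 2 ((Nat.card GAB : ℝ) / ((Nat.card GA : ℝ) * (Nat.card GB : ℝ))) ∧
    ∀ L : ℝ, IsMultiEntropy (grouped party ψ) L ↔
      L = 1 / 2 * Real.logb 2 ((Nat.card G : ℝ) /
              ((Nat.card GA : ℝ) * (Nat.card GB : ℝ) * (Nat.card GC : ℝ))) +
          1 / 2 * Real.logb 2 ((Nat.card G : ℝ) /
              (Nat.card (GAB * GBC * GAC : Set (QubitUnitary N)) : ℝ)) := by
  have h := hψ.isStabGroup
  subst hA hB hC hAB hBC hAC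
  have e0 : labelsOn G {i | party i = 0 ∨ party i = 1} = avoiding party (labels G) 2 :=
    labelsOn_eq_avoiding 0 1 2 (by decide)
  have e1 : labelsOn G {i | party i = 1 ∨ party i = 2} = avoiding party (labels G) 0 :=
    labelsOn_eq_avoiding 1 2 0 (by decide)
  have e2 : labelsOn G {i | party i = 0 ∨ party i = 2} = avoiding party (labels G) 1 :=
    labelsOn_eq_avoiding 0 2 1 (by decide)
  rw [h.card_mul_mul, h.card_group]
  simp only [h.card_supportedOn, labelsOn_eq_within]
  rw [e0, e1, e2]
  exact ⟨hψ.reflectedEntropy_eq, hψ.isMultiEntropy_iff⟩
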